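/- **Setting.** Let $D=[0,2\pi]^3$ with periodic boundary conditions; $k,j,m$ denote wavevectors in $\mathbb Z^3$, $\sum'$ is a sum over nonzero wavevectors, $\theta_k$ are Fourier coefficients, $\|\theta\|_{L^2}^2=8\pi^3\sum|\theta_k|^2$, $\|\theta\|_{H^1}^2=8\pi^3\sum(1+|k|^2)|\theta_k|^2$, $\|u\|_{H^{1/2}}^2=8\pi^3\sum'|k|\,|u_k|^2$, and $\mathsf P_{\kappa,\kappa'}$ keeps the modes with $\kappa\le|k|<\kappa'$. For $k_h:=(k_x,k_y,0)\neq0$ let $e_k=(k_y,-k_x,0)/|k_h|$ and $f_k=(k_xk_z,k_yk_z,-|k_h|^2)/(|k||k_h|)$; for $k\ne0$ with $k_h=0$ let $e_k,f_k$ be any orthonormal pair orthogonal to $k$. *Source.* $(\Delta^{-1}g)(x)=\sum'_k G_k e^{ik\cdot x}$ where either $G_k=\gamma_k$ or $G_k=\gamma_kZ_k$. Here $\gamma_{-k}=\overline{\gamma_k}$, $\gamma_0=0$, and $|\gamma_k|\le c_g|k|^\alpha$ for $|k|\ge\kappa_g$, with $c_g\ge0$, $\kappa_g>1$, $\alpha<0$.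 The $Z_k$ ($k\neq0$) are uniformly bounded, circular (the law is invariant under rotations of $\mathbb C$), with $Z_{-k}=\overline{Z_k}$, $\mathsf E Z_j\overline{Z_k}=\delta_{jk}$, $\mathsf E|Z_k|^4=\varrho$, and the family $(Z_k)$ is independent of the velocity amplitudes below. *Velocity.* $u(x,t)=\sum'_k|k|^\beta[U_e e_kV_k(t)+U_f f_kW_k(t)]e^{ik\cdot x}$ with real $U_e,U_f$, where $V_k,W_k$ ($k\ne0$, $t\ge0$) are jointly measurable complex processes, each $V_k(t),W_k(t)$ being circular, bounded by $\Xi$ almost surely, with unit second moment and fourth absolute moment $\varsigma$, and, for all nonzero $j,k$ and all $s,t\ge0$, $$\mathsf E V_j(s)\overline{V_k(t)}=\mathsf E W_j(s)\overline{W_k(t)}=\delta_{jk}\Phi(\chi_k|s-t|),\qquad \mathsf E V_j(s)\overline{W_k(t)}=0 .$$ Here $\Phi\in C^n([0,\infty);\mathbb R)$ for some $n\ge2$, $\Phi(0)=1$, $\chi_k>0$ and $\chi_k|k|^{-2}\to0$ as $|k|\to\infty$. (Real-valued $u$, i.e. $V_{-k}=-\overline{V_k}$, $W_{-k}=\overline{W_k}$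 when $e_{-k}=-e_k$ and $f_{-k}=f_k$, is included but not required.) **Theorem.** There are an absolute constant $c_1>0$ and constants $c(\alpha,\beta)$, $c(\beta)$, $c(\Phi)$, depending only on the indicated quantities, such that the following holds whenever $\beta<-2$, $\alpha<2\min\{\beta,-3\}-1$ and $U_e,U_f$ are small enough that almost surely $$c_1\|u\|_{L^\infty(0,\infty;H^{1/2}(D))}^2<1 .$$ 1. Almost surely, the iterates $\theta^{(0)}=-\Delta^{-1}g$, $\theta^{(n+1)}(t)=-\Delta^{-1}g-\int_0^te^{(t-s)\Delta}[u(s)\cdot\nabla\theta^{(n)}(s)]\,ds$ converge in $L^2(0,T;H^1(D))$ for every $T>0$ to the unique weak solution $\theta$ (in $L^2(0,T;H^1)$ for all $T$) of $$\partial_t\theta+u\cdot\nabla\theta=\Delta\theta+g,\qquad \theta(0)=-\Delta^{-1}g .$$ Moreover $\theta=-\Delta^{-1}g+\vartheta+\delta\theta$ with $\vartheta(t)=\theta^{(1)}(t)-\theta^{(0)}=\int_0^te^{(t-s)\Delta}[u(s)\cdot\nabla\Delta^{-1}g]\,ds$, and $\vartheta,\delta\theta\in L^2(0,T;H^1)$.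 2. $\mathsf E|\vartheta_k(t)|^2<\infty$ for all $k$ and $t\ge0$. For every $k\ne0$ such that $e^{-s|k|^2/\chi_m}\Phi^{(n)}(s)$ is integrable on $(0,\infty)$ for all $m\neq0$, $$\lim_{t\to\infty}\mathsf E|\vartheta_k(t)|^2=|k|^{-4}\sum_{j\ne0,k}\bigl[U_e^2(e_{k-j}\cdot j)^2+U_f^2(f_{k-j}\cdot j)^2\bigr]|k-j|^{2\beta}|\gamma_j|^2\Bigl[1+\frac{\chi_{k-j}}{|k|^2}\Phi'(0)+\cdots+\Bigl(\frac{\chi_{k-j}}{|k|^{2}}\Bigr)^{n-1}\Phi^{(n-1)}(0)+\Bigl(\frac{\chi_{k-j}}{|k|^{2}}\Bigr)^{n-1}\int_0^\infty e^{-s|k|^2/\chi_{k-j}}\Phi^{(n)}(s)\,ds\Bigr],$$ the series being absolutely convergent. 3. (Reduction to the static case.) Suppose $X\ge\chi_m$ for all $m\neq0$. Let $s_0\ge0$ and let $\vartheta^{\rm st}=-\Delta^{-1}(u(s_0)\cdot\nabla\Delta^{-1}g)$ be the static first correction for the velocity frozen at time $s_0$. For every $k\ne0$, $L_k:=\lim_{t\to\infty}\mathsf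 E|\vartheta_k(t)|^2$ exists, $\mathsf E|\vartheta^{\rm st}_k|^2=|k|^{-4}\sum_{j\neq0,k}[U_e^2(e_{k-j}\cdot j)^2+U_f^2(f_{k-j}\cdot j)^2]|k-j|^{2\beta}|\gamma_j|^2$, and $$\bigl|L_k-\mathsf E|\vartheta^{\rm st}_k|^2\bigr|\le c(\Phi)\frac{X}{|k|^2}\,\mathsf E|\vartheta^{\rm st}_k|^2 .$$ For every $\kappa>0$, $L(\kappa):=\lim_{t\to\infty}\mathsf E\|\mathsf P_{\kappa,2\kappa}\vartheta(t)\|_{L^2}^2$ exists and $|L(\kappa)-\mathsf E\|\mathsf P_{\kappa,2\kappa}\vartheta^{\rm st}\|_{L^2}^2|\le c(\Phi)\frac{X}{\kappa^2}\mathsf E\|\mathsf P_{\kappa,2\kappa}\vartheta^{\rm st}\|_{L^2}^2$. If moreover $U_e=U_f=U$, $\kappa_g\ge16$ and $\kappa\ge4\kappa_g^2$, then, with $\|\nabla^{-1}g\|_{L^2}^2:=8\pi^3\sum'|j|^2|\gamma_j|^2$ (and the sum restricted to $1\le|j|<\kappa^{1/2}$ for $\mathsf P_{1,\kappa^{1/2}}\nabla^{-1}g$),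 $$\Bigl|L(\kappa)-\kappa^{2\beta-1}\frac{8\pi U^2}{3}\,\frac{2^{2\beta-1}-1}{2\beta-1}\|\mathsf P_{1,\kappa^{1/2}}\nabla^{-1}g\|_{L^2}^2\Bigr|\le c_g^2U^2c(\alpha,\beta)\kappa^\alpha+c(\beta)U^2\|\nabla^{-1}g\|_{L^2}^2\kappa^{2\beta-3/2}+c(\Phi)\frac{X}{\kappa^2}\mathsf E\|\mathsf P_{\kappa,2\kappa}\vartheta^{\rm st}\|_{L^2}^2 .$$ -/

import Mathlib

open MeasureTheory ProbabilityTheory Filter Topology Set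

noncomputable section

/-- Wavevectors `k ∈ ℤ³`. A `2π`-periodic field on `D = [0,2π]³` is represented throughout by the
family of its Fourier coefficients, `θ(x) = ∑ θ_k e^{i k·x}`. -/
abbrev Wave := Fin 3 → ℤ

/-- The Euclidean length `|k|`. -/
def wnorm (k : Wave) : ℝ := Real.sqrt (∑ i, (k i : ℝ) ^ 2)

/-- The length `|k_h|` of the horizontal part of `k`. -/
def hnorm (k : Wave) : ℝ := Real.sqrt ((k 0 : ℝ) ^ 2 + (k 1 : ℝ) ^ 2)

/-- The dot product of a real vector with a wavevector. -/
def rdot (a : Fin 3 → ℝ) (j : Wave) : ℝ := ∑ i, a i * (j i : ℝ)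

/-- The Craya--Herring vectors `e_k`, `f_k`. They are given by the usual formulas when `k` is not
vertical; for vertical `k` those formulas degenerate (the azimuth is undetermined) and any
orthonormal pair orthogonal to `k` is allowed. -/
structure IsCrayaHerring (e f : Wave → Fin 3 → ℝ) : Prop where
  e_eq : ∀ k, hnorm k ≠ 0 → e k = ![(k 1 : ℝ) / hnorm k, -(k 0 : ℝ) / hnorm k, 0]
  f_eq : ∀ k, hnorm k ≠ 0 → f k =
    ![(k 0 : ℝ) * k 2 / (wnorm k * hnorm k), (k 1 : ℝ) * k 2 / (wnorm k * hnorm k),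
      -(hnorm k ^ 2) / (wnorm k * hnorm k)]
  vertical : ∀ k, k ≠ 0 → hnorm k = 0 →
    (∑ i, e k i * e k i = 1) ∧ (∑ i, f k i * f k i = 1) ∧ (∑ i, e k i * f k i = 0) ∧
      rdot (e k) k = 0 ∧ rdot (f k) k = 0

/-- Fourier coefficients `|k|^β (U_e e_k V_k + U_f f_k W_k)` (`k ≠ 0`) of the velocity. -/
def velocity (β Ue Uf : ℝ) (e f : Wave → Fin 3 → ℝ) (V W : Wave → ℂ) (k : Wave) : Fin 3 → ℂ :=
  if k = 0 then 0 else fun i =>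
    ((wnorm k ^ β : ℝ) : ℂ) * ((Ue : ℂ) * (e k i : ℂ) * V k + (Uf : ℂ) * (f k i : ℂ) * W k)

/-- Fourier coefficients `∑_j i (u_{k-j} · j) θ_j` of `u · ∇θ`. -/
def advect (u : Wave → Fin 3 → ℂ) (θ : Wave → ℂ) (k : Wave) : ℂ :=
  ∑' j : Wave, Complex.I * (∑ i, u (k - j) i * (j i : ℂ)) * θ j

/-- The Duhamel integral `∫₀ᵗ e^{(t-s)Δ} F(s) ds`, mode by mode. -/
def duhamel (F : ℝ → Wave → ℂ) (t : ℝ) (k : Wave) : ℂ :=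
  ∫ s in (0 : ℝ)..t, ((Real.exp (-(t - s) * wnorm k ^ 2) : ℝ) : ℂ) * F s k

/-- The iterates `θ⁽⁰⁾ = -Δ⁻¹g`, `θ⁽ⁿ⁺¹⁾ = -Δ⁻¹g - ∫₀ᵗ e^{(t-s)Δ} [u(s)·∇θ⁽ⁿ⁾(s)] ds`.
Here and below `G` is the family of Fourier coefficients of `Δ⁻¹g`. -/
def iter (u : ℝ → Wave → Fin 3 → ℂ) (G : Wave → ℂ) : ℕ → ℝ → Wave → ℂ
  | 0 => fun _ k => -G k
  | n + 1 => fun t k => -G k - duhamel (fun s => advect (u s) (iter u G n s)) t k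

/-- `ϑ(t) = θ⁽¹⁾(t) + Δ⁻¹g = ∫₀ᵗ e^{(t-s)Δ} [u(s)·∇Δ⁻¹g] ds`. -/
def vartheta (u : ℝ → Wave → Fin 3 → ℂ) (G : Wave → ℂ) (t : ℝ) (k : Wave) : ℂ :=
  duhamel (fun s => advect (u s) G) t k

/-- `-Δ⁻¹(u·∇Δ⁻¹g)` for a time-independent velocity `u`. -/
def staticVartheta (u : Wave → Fin 3 → ℂ) (G : Wave → ℂ) (k : Wave) : ℂ :=
  (((wnorm k ^ 2)⁻¹ : ℝ) : ℂ) * advect u G k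

/-- `‖θ‖²` in `H¹(D)`. -/
def h1Sq (θ : Wave → ℂ) : ENNReal :=
  ∑' k : Wave, ENNReal.ofReal (8 * Real.pi ^ 3 * (1 + wnorm k ^ 2) * ‖θ k‖ ^ 2)

/-- `‖u‖²` in `H^{1/2}(D)`, for a mean-free vector field. -/
def hHalfSq (u : Wave → Fin 3 → ℂ) : ENNReal :=
  ∑' k : Wave, ENNReal.ofReal (8 * Real.pi ^ 3 * wnorm k * ∑ i, ‖u k i‖ ^ 2)

/-- The square of the norm of `u` in `L^∞(0,∞; H^{1/2}(D))`. -/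
def supHHalfSq (u : ℝ → Wave → Fin 3 → ℂ) : ENNReal :=
  essSup (fun t => hHalfSq (u t)) (volume.restrict (Ioi (0 : ℝ)))

/-- `‖P_{κ,κ'} θ‖²` in `L²(D)`, where `P_{κ,κ'}` keeps the modes with `κ ≤ |k| < κ'`. -/
def projSq (κ κ' : ℝ) (θ : Wave → ℂ) : ℝ :=
  8 * Real.pi ^ 3 * ∑' k : Wave, {k : Wave | κ ≤ wnorm k ∧ wnorm k < κ'}.indicator
    (fun k => ‖θ k‖ ^ 2) k

/-- The square of the distance of `θ` and `η` in `L²(0,T; H¹(D))`. -/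
def distL2H1Sq (T : ℝ) (θ η : ℝ → Wave → ℂ) : ENNReal :=
  ∫⁻ t in Ioc (0 : ℝ) T, h1Sq (fun k => θ t k - η t k)

/-- `θ ∈ L²(0,T; H¹(D))`. -/
def MemL2H1 (T : ℝ) (θ : ℝ → Wave → ℂ) : Prop :=
  (∀ k, AEMeasurable (fun t => θ t k) (volume.restrict (Ioc (0 : ℝ) T))) ∧
    (∫⁻ t in Ioc (0 : ℝ) T, h1Sq (θ t)) < ⊤

/-- `θ` is a weak solution on `[0,∞)` of `∂_tθ + u·∇θ = Δθ + g` with `θ(0) = -Δ⁻¹g`, in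
`L²(0,T; H¹)` for all `T`: the equation, tested with `e^{-i k·x}` for each `k`, holds integrated in
time. The coefficients of `g = Δ(Δ⁻¹g)` are `-|k|² G_k`. -/
def IsSolution (u : ℝ → Wave → Fin 3 → ℂ) (G : Wave → ℂ) (θ : ℝ → Wave → ℂ) : Prop :=
  (∀ T, 0 < T → MemL2H1 T θ) ∧
  ∀ t, 0 ≤ t → ∀ k, θ t k = -G k + ∫ s in (0 : ℝ)..t,
    (-((wnorm k ^ 2 : ℝ) : ℂ) * θ s k + -((wnorm k ^ 2 : ℝ) : ℂ) * G k - advect (u s) (θ s) k)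

/-- A bounded circular complex random variable with `E|Z|² = 1` and `E|Z|⁴ = ς`,
`|Z| ≤ Ξ` almost surely. -/
structure IsProperRV {Ω : Type*} [MeasurableSpace Ω] (μ : Measure Ω) (ς Ξ : ℝ) (Z : Ω → ℂ) :
    Prop where
  meas : Measurable Z
  circular : ∀ φ : ℝ, IdentDistrib (fun ω => Complex.exp ((φ : ℂ) * Complex.I) * Z ω) Z μ μ
  bound : ∀ᵐ ω ∂μ, ‖Z ω‖ ≤ Ξ
  second : ∫ ω, ‖Z ω‖ ^ 2 ∂μ = 1
  fourth : ∫ ω, ‖Z ω‖ ^ 4 ∂μ = ς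

/-- The time-correlated random amplitudes `V_k(t)`, `W_k(t)`, `k ≠ 0`, `t ≥ 0`, with time
correlation `Φ_k(t) = Φ(χ_k |t|)`. -/
structure IsVelocityProcess {Ω : Type*} [MeasurableSpace Ω] (μ : Measure Ω) (ς Ξ : ℝ)
    (Φ : ℝ → ℝ) (χ : Wave → ℝ) (V W : Wave → ℝ → Ω → ℂ) : Prop where
  measV : ∀ k, Measurable (fun p : ℝ × Ω => V k p.1 p.2)
  measW : ∀ k, Measurable (fun p : ℝ × Ω => W k p.1 p.2)
  properV : ∀ k, k ≠ 0 → ∀ t, 0 ≤ t → IsProperRV μ ς Ξ (V k t)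
  properW : ∀ k, k ≠ 0 → ∀ t, 0 ≤ t → IsProperRV μ ς Ξ (W k t)
  covV : ∀ j k, j ≠ 0 → k ≠ 0 → ∀ s t, 0 ≤ s → 0 ≤ t →
    ∫ ω, V j s ω * (starRingEnd ℂ) (V k t ω) ∂μ = if j = k then (Φ (χ k * |s - t|) : ℂ) else 0
  covW : ∀ j k, j ≠ 0 → k ≠ 0 → ∀ s t, 0 ≤ s → 0 ≤ t →
    ∫ ω, W j s ω * (starRingEnd ℂ) (W k t ω) ∂μ = if j = k then (Φ (χ k * |s - t|) : ℂ) else 0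
  covVW : ∀ j k, j ≠ 0 → k ≠ 0 → ∀ s t, 0 ≤ s → 0 ≤ t →
    ∫ ω, V j s ω * (starRingEnd ℂ) (W k t ω) ∂μ = 0

/-- The time correlation function: `Φ ∈ Cⁿ([0,∞))`, `n ≥ 2`, `Φ(0) = 1`, rates `χ_k > 0` with
`χ_k |k|⁻² → 0` as `|k| → ∞`. -/
structure IsCorrelation (n : ℕ) (Φ : ℝ → ℝ) (χ : Wave → ℝ) : Prop where
  two_le : 2 ≤ n
  smooth : ContDiffOn ℝ n Φ (Ici 0)
  zero : Φ 0 = 1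
  pos : ∀ k, k ≠ 0 → 0 < χ k
  decay : Tendsto (fun k : Wave => χ k / wnorm k ^ 2) cofinite (𝓝 0)

/-- The amplitudes `γ_k` of `Δ⁻¹g`, with `|γ_k| ≤ c_g |k|^α` when `|k| ≥ κ_g`. -/
structure IsSourceAmplitude (α cg κg : ℝ) (γ : Wave → ℂ) : Prop where
  cg_nonneg : 0 ≤ cg
  one_lt : 1 < κg
  neg : α < 0
  real : ∀ k, γ (-k) = (starRingEnd ℂ) (γ k)
  zero : γ 0 = 0
  bound : ∀ k, κg ≤ wnorm k → ‖γ k‖ ≤ cg * wnorm k ^ α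

/-- The random factors `Z_k` of a random source, independent of the velocity amplitudes. -/
structure IsSourceNoise {Ω : Type*} [MeasurableSpace Ω] (μ : Measure Ω) (ϱ Ξ : ℝ)
    (V W : Wave → ℝ → Ω → ℂ) (Z : Wave → Ω → ℂ) : Prop where
  meas : ∀ k, Measurable (Z k)
  proper : ∀ k, k ≠ 0 → IsProperRV μ ϱ Ξ (Z k)
  real : ∀ k ω, Z (-k) ω = (starRingEnd ℂ) (Z k ω)
  cov : ∀ j k, j ≠ 0 → k ≠ 0 →
    ∫ ω, Z j ω * (starRingEnd ℂ) (Z k ω) ∂μ = if j = k then 1 else 0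
  indep : IndepFun
    (fun ω (p : Wave × NNReal) => (V p.1 (p.2 : ℝ) ω, W p.1 (p.2 : ℝ) ω))
    (fun ω (k : Wave) => Z k ω) μ

/-- Fourier coefficients `G` of `Δ⁻¹g`: either deterministic, `G_k = γ_k`, or random,
`G_k = γ_k Z_k`. -/
def IsSource {Ω : Type*} [MeasurableSpace Ω] (μ : Measure Ω) (V W : Wave → ℝ → Ω → ℂ)
    (γ : Wave → ℂ) (G : Ω → Wave → ℂ) : Prop :=
  (∀ ω k, G ω k = γ k) ∨
  ∃ (ϱ Ξ : ℝ) (Z : Wave → Ω → ℂ), IsSourceNoise μ ϱ Ξ V W Z ∧ ∀ ω k, G ω k = γ k * Z k ω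

/-- `[U_e² (e_{k-j}·j)² + U_f² (f_{k-j}·j)²] |k-j|^{2β} |γ_j|²`, for `j ≠ 0, k`. -/
def spectralWeight (β Ue Uf : ℝ) (e f : Wave → Fin 3 → ℝ) (γ : Wave → ℂ) (k j : Wave) : ℝ :=
  if j = 0 ∨ j = k then 0 else
    (Ue ^ 2 * rdot (e (k - j)) j ^ 2 + Uf ^ 2 * rdot (f (k - j)) j ^ 2) *
      wnorm (k - j) ^ (2 * β) * ‖γ j‖ ^ 2

/-- The integrand `e^{-s|k|²/χ} Φ⁽ⁿ⁾(s)` of the remainder in the expansion. -/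
def remainderIntegrand (n : ℕ) (Φ : ℝ → ℝ) (x : ℝ) (k : Wave) (s : ℝ) : ℝ :=
  Real.exp (-(s * wnorm k ^ 2 / x)) * iteratedDerivWithin n Φ (Ici 0) s

/-- `1 + (χ/|k|²) Φ'(0) + ⋯ + (χ/|k|²)^{n-1} Φ⁽ⁿ⁻¹⁾(0)
    + (χ/|k|²)^{n-1} ∫₀^∞ e^{-s|k|²/χ} Φ⁽ⁿ⁾(s) ds`. -/
def correlationExpansion (n : ℕ) (Φ : ℝ → ℝ) (x : ℝ) (k : Wave) : ℝ :=
  (1 + ∑ i ∈ Finset.Ico 1 n, (x / wnorm k ^ 2) ^ i * iteratedDerivWithin i Φ (Ici 0) 0) +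
    (x / wnorm k ^ 2) ^ (n - 1) * ∫ s in Ioi (0 : ℝ), remainderIntegrand n Φ x k s

end

/-!
The velocity is small in the scale-invariant space `L^∞(H^{1/2})`, which makes the passive scalar
equation a contraction; for the first correction `ϑ` everything reduces to a lattice sum, because
the amplitudes of different wavevectors are uncorrelated.

**Solution.** On Fourier coefficients one has the product estimate
`‖u·∇θ‖_{H⁻¹} ≲ ‖u‖_{H^{1/2}} ‖θ‖_{H¹}` (`tsum_enorm_advect_sq_le`): the convolution is split
according to `|k-j| ≤ 2|k|`, and each half is a Cauchy--Schwarz inequality against a sum of `|m|⁻¹`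
or `|m|⁻²` over a ball. Young's inequality in time, mode by mode, gains the factor `|k|⁻²`
(`lintegral_enorm_heatInt_sq_le`), so the Duhamel operator contracts `L²(0,T; H¹)` uniformly in `T`
(`energy_transport_le`). The iterates therefore converge, the limit is the only mild solution, and
mild and weak solutions agree because a scalar linear integral equation has a unique solution
(`isSolution_iff_isMild`, `exists_solution`).

**Spectrum of `ϑ`.** For fixed `k` the terms `i (u_{k-j}(s)·j) G_j` are bounded by a summable sequence,
uncorrelated for different `j`, and stationary in time with covariance `w_{kj} Φ(χ_{k-j}|s-r|)`, where
`w_{kj}` is `spectralWeight` (`modeFamily_advectTerm`). Fubini turns `E|ϑ_k(t)|²` into a double integral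
of the covariance; after time reversal it converges by dominated convergence to
`|k|⁻⁴ ∑_j w_{kj} J(χ_{k-j}/|k|²)` with `J(x) = ∫₀^∞ e^{-s} Φ(xs) ds` (`tendsto_integral_vartheta`).
Repeated integration by parts expands `J` in powers of `x`
(`corrTransform_eq_correlationExpansion`). Since `|Φ| ≤ 1` by Cauchy--Schwarz and `Φ` is `C¹`,
`|Φ(s) - 1| ≤ c s`, hence `|J(x) - 1| ≤ c x`; `J = 1` is the static case, so this is the comparison of the
two spectra (`abs_limit_sub_static_le`).

**Shells.** When `U_e = U_f`, Parseval's identity in the basis `e_m, f_m, m/|m|` gives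
`w_{kj} = U² |k-j|^{2β-2} |k × j|² |γ_j|²`. For `|j| < κ^{1/2}` the factor `|k-j|` is replaced by `|k|`,
the octahedral symmetry of the lattice averages `|k × j|²` to `(2/3)|k|²|j|²`, and the remaining sum
of `|k|^{2β-4}` over the shell is an integral up to the error in Gauss's lattice point count
(`abs_sum_waveShell_rpow_sub_le`). The modes `|j| ≥ κ^{1/2}` lie in the range of the power-law bound on
`γ_j` and contribute a convergent tail (`sum_waveShell_spectralWeight_tail_le`).
-/

set_option linter.unusedSectionVars false

/-! ### Wavevectors and lattice points in balls -/

/-- A wavevector as a point of Euclidean space. -/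
noncomputable def waveVec (k : Wave) : EuclideanSpace ℝ (Fin 3) :=
  WithLp.toLp 2 (fun i => (k i : ℝ))

lemma wnorm_eq_norm (k : Wave) : wnorm k = ‖waveVec k‖ := by
  simp [wnorm, waveVec, EuclideanSpace.norm_eq]

lemma waveVec_add (k m : Wave) : waveVec (k + m) = waveVec k + waveVec m := by
  ext i; simp [waveVec]

lemma waveVec_sub (k m : Wave) : waveVec (k - m) = waveVec k - waveVec m := by
  ext i; simp [waveVec]

lemma wnorm_nonneg (k : Wave) : 0 ≤ wnorm k := Real.sqrt_nonneg _

lemma wnorm_sq (k : Wave) : wnorm k ^ 2 = ∑ i, (k i : ℝ) ^ 2 :=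
  Real.sq_sqrt (Finset.sum_nonneg fun _ _ => sq_nonneg _)

@[simp] lemma wnorm_zero : wnorm 0 = 0 := by simp [wnorm]

lemma wnorm_add_le (k m : Wave) : wnorm (k + m) ≤ wnorm k + wnorm m := by
  simpa only [wnorm_eq_norm, waveVec_add] using norm_add_le _ _

lemma wnorm_sub_le (k m : Wave) : wnorm (k - m) ≤ wnorm k + wnorm m := by
  simpa only [wnorm_eq_norm, waveVec_sub] using norm_sub_le _ _

lemma wnorm_le_add_sub (k m : Wave) : wnorm k ≤ wnorm (k - m) + wnorm m := by
  simpa using wnorm_add_le (k - m) m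

lemma abs_wnorm_sub_sub_le (k m : Wave) : |wnorm (k - m) - wnorm k| ≤ wnorm m := by
  have h1 := wnorm_sub_le k m
  have h2 := wnorm_le_add_sub k m
  rw [abs_le]; constructor <;> linarith

lemma one_le_wnorm_sq {k : Wave} (hk : k ≠ 0) : 1 ≤ wnorm k ^ 2 := by
  rw [wnorm_sq]
  obtain ⟨i, hi⟩ := Function.ne_iff.1 hk
  have h1 : (1 : ℝ) ≤ (k i : ℝ) ^ 2 := by
    have : (1 : ℤ) ≤ k i ^ 2 := Int.one_le_abs (by simpa using hi) |> fun h => by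
      rw [← sq_abs]; nlinarith
    exact_mod_cast this
  exact h1.trans (Finset.single_le_sum (f := fun i => (k i : ℝ) ^ 2)
    (fun _ _ => sq_nonneg _) (Finset.mem_univ i))

lemma one_le_wnorm {k : Wave} (hk : k ≠ 0) : 1 ≤ wnorm k := by
  have := one_le_wnorm_sq hk
  nlinarith [wnorm_nonneg k]

lemma wnorm_pos {k : Wave} (hk : k ≠ 0) : 0 < wnorm k := one_pos.trans_le (one_le_wnorm hk)

lemma wnorm_ne_zero {k : Wave} (hk : k ≠ 0) : wnorm k ≠ 0 := (wnorm_pos hk).ne'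

lemma ne_zero_of_wnorm_pos {k : Wave} (hk : 0 < wnorm k) : k ≠ 0 := by
  rintro rfl; simp at hk

lemma abs_apply_le_wnorm (k : Wave) (i : Fin 3) : |(k i : ℝ)| ≤ wnorm k := by
  refine Real.abs_le_sqrt ?_
  exact Finset.single_le_sum (f := fun i => (k i : ℝ) ^ 2)
    (fun _ _ => sq_nonneg _) (Finset.mem_univ i)

lemma finite_wnorm_le (R : ℝ) : {k : Wave | wnorm k ≤ R}.Finite := by
  refine (Set.Finite.pi' (fun _ : Fin 3 => Set.finite_Icc (-⌈R⌉) ⌈R⌉)).subset ?_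
  intro k hk i
  have h : |(k i : ℝ)| ≤ ⌈R⌉ := ((abs_apply_le_wnorm k i).trans hk).trans (Int.le_ceil R)
  rw [abs_le] at h
  exact ⟨by exact_mod_cast h.1, by exact_mod_cast h.2⟩

/-- The unit cube `k + [0,1)³`. -/
def unitCube (k : Wave) : Set (Fin 3 → ℝ) :=
  Set.pi univ fun i => Ico (k i : ℝ) (k i + 1)

lemma volume_unitCube (k : Wave) : volume (unitCube k) = 1 := by
  simp [unitCube, Real.volume_pi_Ico]

lemma measurableSet_unitCube (k : Wave) : MeasurableSet (unitCube k) :=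
  MeasurableSet.univ_pi fun _ => measurableSet_Ico

lemma mem_unitCube_iff {k : Wave} {x : Fin 3 → ℝ} : x ∈ unitCube k ↔ (fun i => ⌊x i⌋) = k := by
  simp [unitCube, funext_iff, Int.floor_eq_iff, Set.mem_pi]

lemma volume_biUnion_unitCube (S : Finset Wave) : volume (⋃ k ∈ S, unitCube k) = S.card := by
  rw [measure_biUnion_finset _ fun k _ => measurableSet_unitCube k]
  · simp [volume_unitCube]
  · intro k _ m _ hkm
    refine Set.disjoint_left.2 fun x hx hx' => hkm ?_
    rw [← mem_unitCube_iff.1 hx, mem_unitCube_iff.1 hx']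

lemma volume_euclidean_ball (r : ℝ) :
    volume {x : Fin 3 → ℝ | ‖(WithLp.toLp 2 x : EuclideanSpace ℝ (Fin 3))‖ < r} =
      ENNReal.ofReal r ^ 3 * ENNReal.ofReal (Real.pi * 4 / 3) := by
  rw [← EuclideanSpace.volume_ball_fin_three 0,
    ← (PiLp.volume_preserving_toLp (Fin 3)).measure_preimage measurableSet_ball.nullMeasurableSet]
  congr 1; ext x; simp

lemma abs_norm_sub_wnorm_lt {k : Wave} {x : Fin 3 → ℝ} (hx : x ∈ unitCube k) :
    |‖(WithLp.toLp 2 x : EuclideanSpace ℝ (Fin 3))‖ - wnorm k| < 2 := by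
  rw [wnorm_eq_norm]
  refine (abs_norm_sub_norm_le _ _).trans_lt ?_
  rw [EuclideanSpace.norm_eq, Real.sqrt_lt' (by norm_num)]
  have : ∀ i, ‖((WithLp.toLp 2 x : EuclideanSpace ℝ (Fin 3)) - waveVec k) i‖ ^ 2 ≤ 1 := by
    intro i
    have h := hx i (mem_univ i)
    simp only [waveVec, PiLp.sub_apply, Real.norm_eq_abs, sq_abs]
    nlinarith [h.1, h.2]
  calc _ ≤ ∑ _i : Fin 3, (1 : ℝ) := Finset.sum_le_sum fun i _ => this i
    _ < _ := by norm_num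

/-- Gauss's lattice point count: a ball of radius `R` holds `4πR³/3 + O(R²)` wavevectors, whichever
of those on its boundary are counted. -/
lemma abs_card_sub_le {R : ℝ} (hR : 1 ≤ R) (S : Finset Wave) (h1 : ∀ k ∈ S, wnorm k ≤ R)
    (h2 : ∀ k, wnorm k < R → k ∈ S) :
    |(S.card : ℝ) - 4 * Real.pi / 3 * R ^ 3| ≤ 36 * Real.pi * R ^ 2 := by
  have hpi := Real.pi_pos
  have hup : (S.card : ENNReal) ≤ ENNReal.ofReal (R + 2) ^ 3 * ENNReal.ofReal (Real.pi * 4 / 3) := by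
    rw [← volume_biUnion_unitCube, ← volume_euclidean_ball]
    refine measure_mono (iUnion₂_subset fun k hk x hx => ?_)
    have := (abs_lt.1 (abs_norm_sub_wnorm_lt hx)).2
    have := h1 k hk
    simp only [mem_ofPred_eq]; linarith
  have hlo : ENNReal.ofReal (R - 2) ^ 3 * ENNReal.ofReal (Real.pi * 4 / 3) ≤ (S.card : ENNReal) := by
    rw [← volume_biUnion_unitCube, ← volume_euclidean_ball]
    refine measure_mono fun x hx => ?_
    simp only [mem_ofPred_eq] at hx
    have hm : x ∈ unitCube (fun i => ⌊x i⌋) := mem_unitCube_iff.2 rfl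
    have := (abs_lt.1 (abs_norm_sub_wnorm_lt hm)).1
    exact mem_iUnion₂.2 ⟨_, h2 _ (by linarith), hm⟩
  have hup' : (S.card : ℝ) ≤ (R + 2) ^ 3 * (Real.pi * 4 / 3) := by
    rw [← ENNReal.ofReal_pow (by linarith), ← ENNReal.ofReal_mul (by positivity),
      ← ENNReal.ofReal_natCast] at hup
    exact (ENNReal.ofReal_le_ofReal_iff (by positivity)).1 hup
  have hlo' : (R - 2) ^ 3 * (Real.pi * 4 / 3) ≤ (S.card : ℝ) := by
    rcases le_total R 2 with h | h
    · have : (R - 2) ^ 3 ≤ 0 := by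
        have : (R - 2) ^ 3 = (R - 2) ^ 2 * (R - 2) := by ring
        rw [this]; exact mul_nonpos_of_nonneg_of_nonpos (sq_nonneg _) (by linarith)
      exact (mul_nonpos_of_nonpos_of_nonneg this (by positivity)).trans (Nat.cast_nonneg _)
    · rw [← ENNReal.ofReal_pow (by linarith),
        ← ENNReal.ofReal_mul (pow_nonneg (by linarith) 3), ← ENNReal.ofReal_natCast] at hlo
      exact (ENNReal.ofReal_le_ofReal_iff (by positivity)).1 hlo
  have e1 : 6 * R ^ 2 + 12 * R + 8 ≤ 27 * R ^ 2 := by nlinarith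
  have e2 : Real.pi * (6 * R ^ 2 + 12 * R + 8) ≤ Real.pi * (27 * R ^ 2) :=
    mul_le_mul_of_nonneg_left e1 hpi.le
  have e3 : Real.pi * (6 * R ^ 2 - 12 * R + 8) ≤ Real.pi * (27 * R ^ 2) :=
    mul_le_mul_of_nonneg_left (by nlinarith) hpi.le
  rw [abs_le]; constructor <;> nlinarith

/-- The wavevectors of length at most `R`, as a finite set. -/
noncomputable def waveBall (R : ℝ) : Finset Wave := (finite_wnorm_le R).toFinset

@[simp] lemma mem_waveBall {R : ℝ} {k : Wave} : k ∈ waveBall R ↔ wnorm k ≤ R := by simp [waveBall]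

lemma card_waveBall_le {R : ℝ} (hR : 1 ≤ R) :
    ((waveBall R).card : ℝ) ≤ 38 * Real.pi * R ^ 3 := by
  have h := (abs_le.1 (abs_card_sub_le hR (waveBall R) (by simp) (fun k hk => by simpa using hk.le))).2
  have h3 : Real.pi * R ^ 2 ≤ Real.pi * R ^ 3 :=
    mul_le_mul_of_nonneg_left (pow_le_pow_right₀ hR (by norm_num)) Real.pi_pos.le
  have : 0 ≤ Real.pi * R ^ 3 := by positivity
  linarith

/-- Summation by parts for a power of the length: the sum is an integral of counting functions. -/
lemma sum_wnorm_rpow_eq {a b : ℝ} (ha : 0 < a) (S : Finset Wave)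
    (hS : ∀ k ∈ S, a ≤ wnorm k ∧ wnorm k ≤ b) (p : ℝ) :
    IntervalIntegrable (fun r => -p * r ^ (p - 1) * (((S.filter fun k => wnorm k ≤ r).card : ℕ) : ℝ))
      volume a b ∧
    ∑ k ∈ S, wnorm k ^ p = b ^ p * S.card +
      ∫ r in a..b, -p * r ^ (p - 1) * (((S.filter fun k => wnorm k ≤ r).card : ℕ) : ℝ) := by
  have hcont : ContinuousOn (fun r : ℝ => -p * r ^ (p - 1)) (Ioi 0) := fun r hr =>
    (continuousAt_const.mul (Real.continuousAt_rpow_const r _ (Or.inl (ne_of_gt hr)))).continuousWithinAt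
  have hfun : (fun r : ℝ => -p * r ^ (p - 1) * (((S.filter fun k => wnorm k ≤ r).card : ℕ) : ℝ)) =
      fun r => ∑ k ∈ S, (Ici (wnorm k)).indicator (fun r => -p * r ^ (p - 1)) r := by
    ext r
    rw [Finset.card_filter]; push_cast
    rw [Finset.mul_sum]
    refine Finset.sum_congr rfl fun k _ => ?_
    by_cases h : wnorm k ≤ r <;> simp [h, indicator]
  have hint : ∀ k ∈ S, IntervalIntegrable
      (fun r => (Ici (wnorm k)).indicator (fun r => -p * r ^ (p - 1)) r) volume a b := by
    intro k hk
    have hab : a ≤ b := (hS k hk).1.trans (hS k hk).2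
    have : IntervalIntegrable (fun r : ℝ => -p * r ^ (p - 1)) volume a b :=
      (hcont.mono fun x hx => by
        rw [uIcc_of_le hab] at hx; exact ha.trans_le hx.1).intervalIntegrable
    rw [intervalIntegrable_iff] at this ⊢
    exact this.indicator measurableSet_Ici
  rw [hfun]
  refine ⟨?_, ?_⟩
  · have h := IntervalIntegrable.sum S hint
    rwa [Finset.sum_fn] at h
  rw [intervalIntegral.integral_finsetSum hint, mul_comm, ← nsmul_eq_mul, ← Finset.sum_const,
    ← Finset.sum_add_distrib]
  refine Finset.sum_congr rfl fun k hk => ?_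
  obtain ⟨h1, h2⟩ := hS k hk
  have hk0 : 0 < wnorm k := ha.trans_le h1
  have hint' : ∀ x y, 0 < x → x ≤ y → IntervalIntegrable (fun r : ℝ => -p * r ^ (p - 1)) volume x y :=
    fun x y hx hxy => (hcont.mono fun z hz => by
      rw [uIcc_of_le hxy] at hz; exact hx.trans_le hz.1).intervalIntegrable
  have e1 : ∫ r in a..b, (Ici (wnorm k)).indicator (fun r => -p * r ^ (p - 1)) r =
      ∫ r in (wnorm k)..b, -p * r ^ (p - 1) := by
    rw [intervalIntegral.integral_of_le (h1.trans h2), intervalIntegral.integral_of_le h2,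
      setIntegral_indicator measurableSet_Ici]
    refine setIntegral_congr_set ?_
    have : (Ioc a b ∩ Ici (wnorm k) : Set ℝ) =ᵐ[volume] (Ioc a b ∩ Ioi (wnorm k) : Set ℝ) :=
      (ae_eq_refl _).inter Ioi_ae_eq_Ici.symm
    refine this.trans (Eq.eventuallyEq ?_)
    ext x
    constructor
    · rintro ⟨⟨_, h⟩, h'⟩; exact ⟨h', h⟩
    · rintro ⟨h, h'⟩; exact ⟨⟨h1.trans_lt h, h'⟩, h⟩
  rw [e1]
  have e2 : ∫ r in (wnorm k)..b, -p * r ^ (p - 1) = -(b ^ p) - -(wnorm k ^ p) := by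
    refine intervalIntegral.integral_eq_sub_of_hasDerivAt (f := fun r => -(r ^ p)) ?_ (hint' _ _ hk0 h2)
    intro x hx
    rw [uIcc_of_le h2] at hx
    have := (Real.hasDerivAt_rpow_const (x := x) (p := p) (Or.inl (hk0.trans_le hx.1).ne')).neg
    exact this.congr_deriv (by ring)
  rw [e2]; ring

lemma sum_wnorm_rpow_le {R p : ℝ} (hR : 1 ≤ R) (hp : p ≤ 0) (hp3 : p + 3 ≠ 0) (S : Finset Wave)
    (hS : ∀ k ∈ S, k ≠ 0 ∧ wnorm k ≤ R) :
    ∑ k ∈ S, wnorm k ^ p ≤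
      38 * Real.pi * (R ^ (p + 3) + -p * ((R ^ (p + 3) - 1) / (p + 3))) := by
  have hpi := Real.pi_pos
  obtain ⟨hi, he⟩ := sum_wnorm_rpow_eq one_pos S
    (fun k hk => ⟨one_le_wnorm (hS k hk).1, (hS k hk).2⟩) p
  have hc : ∀ r, 1 ≤ r → (((S.filter fun k => wnorm k ≤ r).card : ℕ) : ℝ) ≤ 38 * Real.pi * r ^ 3 :=
    fun r hr => by
      refine le_trans (Nat.cast_le.2 (Finset.card_le_card fun k hk => ?_)) (card_waveBall_le hr)
      simpa using (Finset.mem_filter.1 hk).2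
  have hS' : (S.card : ℝ) ≤ 38 * Real.pi * R ^ 3 := by
    have := hc R hR
    rwa [Finset.filter_true_of_mem fun k hk => (hS k hk).2] at this
  have hcont : ContinuousOn (fun r : ℝ => r ^ (p + 2)) (uIcc 1 R) := fun r hr => by
    rw [uIcc_of_le hR] at hr
    exact (Real.continuousAt_rpow_const r _
      (Or.inl (one_pos.trans_le hr.1).ne')).continuousWithinAt
  have h1 : ∫ r in (1 : ℝ)..R, -p * r ^ (p - 1) *
      (((S.filter fun k => wnorm k ≤ r).card : ℕ) : ℝ) ≤
      ∫ r in (1 : ℝ)..R, 38 * Real.pi * -p * r ^ (p + 2) := by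
    refine intervalIntegral.integral_mono_on hR hi (hcont.intervalIntegrable.const_mul _) ?_
    intro r hr
    have hr0 : 0 < r := one_pos.trans_le hr.1
    have : r ^ (p + 2) = r ^ (p - 1) * r ^ 3 := by
      rw [← Real.rpow_natCast, ← Real.rpow_add hr0]; congr 1; push_cast; ring
    rw [this]
    calc _ ≤ -p * r ^ (p - 1) * (38 * Real.pi * r ^ 3) :=
          mul_le_mul_of_nonneg_left (hc r hr.1) (mul_nonneg (by linarith) (by positivity))
      _ = _ := by ring
  have h2 : ∫ r in (1 : ℝ)..R, r ^ (p + 2) = (R ^ (p + 3) - 1) / (p + 3) := by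
    rw [integral_rpow (Or.inr ⟨fun h => hp3 (by linarith), fun h => by
      rw [uIcc_of_le hR] at h; linarith [h.1]⟩), Real.one_rpow]
    ring_nf
  rw [intervalIntegral.integral_const_mul, h2] at h1
  have h3 : R ^ p * S.card ≤ 38 * Real.pi * R ^ (p + 3) := by
    have : R ^ (p + 3) = R ^ p * R ^ 3 := by
      rw [← Real.rpow_natCast, ← Real.rpow_add (by linarith)]; norm_num
    rw [this]
    calc _ ≤ R ^ p * (38 * Real.pi * R ^ 3) := mul_le_mul_of_nonneg_left hS' (by positivity)
      _ = _ := by ring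
  rw [he]; linarith

/-- For `-3 < p ≤ 0` the sum of `|k|^p` over a ball grows like the integral. -/
lemma sum_waveBall_rpow_le {R p : ℝ} (hp : p ≤ 0) (hp3 : -3 < p) (hR : 0 ≤ R) :
    ∑ k ∈ (waveBall R).erase 0, wnorm k ^ p ≤ 38 * Real.pi * (3 / (p + 3)) * R ^ (p + 3) := by
  have hp3' : 0 < p + 3 := by linarith
  rcases lt_or_ge R 1 with h | h
  · rw [Finset.sum_eq_zero]
    · positivity
    · intro k hk
      rw [Finset.mem_erase, mem_waveBall] at hk
      linarith [one_le_wnorm hk.1]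
  · refine (sum_wnorm_rpow_le h hp hp3'.ne' _ (by simp)).trans ?_
    rw [mul_assoc (38 * Real.pi)]
    refine mul_le_mul_of_nonneg_left ?_ (by positivity)
    have : R ^ (p + 3) + -p * ((R ^ (p + 3) - 1) / (p + 3)) =
      3 / (p + 3) * R ^ (p + 3) + p / (p + 3) := by field_simp; ring
    rw [this]
    have : p / (p + 3) ≤ 0 := div_nonpos_of_nonpos_of_nonneg hp hp3'.le
    linarith

lemma sum_inv_wnorm_le (R : ℝ) (hR : 0 ≤ R) :
    ∑ k ∈ waveBall R, (wnorm k)⁻¹ ≤ 57 * Real.pi * R ^ 2 := by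
  have h := sum_waveBall_rpow_le (p := -1) (by norm_num) (by norm_num) hR
  have e : ∑ k ∈ waveBall R, (wnorm k)⁻¹ = ∑ k ∈ (waveBall R).erase 0, wnorm k ^ (-1 : ℝ) := by
    simp only [Real.rpow_neg_one]
    exact (Finset.sum_erase _ (by simp)).symm
  rw [e]; refine h.trans_eq ?_
  rw [show (-1 : ℝ) + 3 = (2 : ℕ) by norm_num, Real.rpow_natCast]
  push_cast; ring

lemma sum_inv_wnorm_sq_le (R : ℝ) (hR : 0 ≤ R) :
    ∑ k ∈ waveBall R, (wnorm k ^ 2)⁻¹ ≤ 114 * Real.pi * R := by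
  have h := sum_waveBall_rpow_le (p := -2) (by norm_num) (by norm_num) hR
  have e : ∑ k ∈ waveBall R, (wnorm k ^ 2)⁻¹ = ∑ k ∈ (waveBall R).erase 0, wnorm k ^ (-2 : ℝ) := by
    have : ∀ k, wnorm k ^ (-2 : ℝ) = (wnorm k ^ 2)⁻¹ := fun k => by
      rw [Real.rpow_neg (wnorm_nonneg k)]; norm_cast
    simp only [this]
    exact (Finset.sum_erase _ (by simp)).symm
  rw [e]; refine h.trans_eq ?_
  rw [show (-2 : ℝ) + 3 = 1 by norm_num, Real.rpow_one]
  ring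

lemma summable_wnorm_rpow {p : ℝ} (hp : p < -3) : Summable fun k : Wave => wnorm k ^ p := by
  refine summable_of_sum_le (c := 38 * Real.pi * (1 + p / (p + 3)))
    (fun k => Real.rpow_nonneg (wnorm_nonneg k) _) fun S => ?_
  have hp3 : p + 3 < 0 := by linarith
  have h0 : ∑ k ∈ S.erase 0, wnorm k ^ p = ∑ k ∈ S, wnorm k ^ p :=
    Finset.sum_erase _ (by rw [wnorm_zero, Real.zero_rpow (by linarith)])
  rw [← h0]
  obtain ⟨R, hR⟩ : ∃ R, ∀ k ∈ S, wnorm k ≤ R :=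
    ⟨∑ k ∈ S, wnorm k, fun k hk => Finset.single_le_sum (f := wnorm) (fun k _ => wnorm_nonneg k) hk⟩
  have h1 := sum_wnorm_rpow_le (le_max_left 1 R) (p := p) (by linarith) hp3.ne (S.erase 0)
    (fun k hk => ⟨(Finset.mem_erase.1 hk).1,
      (hR k (Finset.mem_erase.1 hk).2).trans (le_max_right _ _)⟩)
  refine h1.trans (mul_le_mul_of_nonneg_left ?_ (by positivity))
  have hM : (max 1 R) ^ (p + 3) ≤ 1 := Real.rpow_le_one_of_one_le_of_nonpos (le_max_left _ _) hp3.le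
  have hM0 : 0 ≤ (max 1 R) ^ (p + 3) := Real.rpow_nonneg (by positivity) _
  have : -p * (((max 1 R) ^ (p + 3) - 1) / (p + 3)) =
      p / (p + 3) - (max 1 R) ^ (p + 3) * (p / (p + 3)) := by field_simp; ring
  have h2 : 0 ≤ p / (p + 3) := div_nonneg_of_nonpos (by linarith) hp3.le
  rw [this]
  nlinarith [mul_nonneg hM0 h2]

/-- The wavevectors with `κ ≤ |k| < 2κ`, as a finite set. -/
noncomputable def waveShell (κ : ℝ) : Finset Wave :=
  (waveBall (2 * κ)).filter fun k => κ ≤ wnorm k ∧ wnorm k < 2 * κ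

@[simp] lemma mem_waveShell {κ : ℝ} {k : Wave} :
    k ∈ waveShell κ ↔ κ ≤ wnorm k ∧ wnorm k < 2 * κ := by
  simp only [waveShell, Finset.mem_filter, mem_waveBall, and_iff_right_iff_imp]
  exact fun h => h.2.le

lemma abs_card_waveShell_filter_sub_le {κ r : ℝ} (hκ : 1 ≤ κ) (h1 : κ ≤ r) (h2 : r ≤ 2 * κ) :
    |((((waveShell κ).filter fun k => wnorm k ≤ r).card : ℕ) : ℝ) -
      4 * Real.pi / 3 * (r ^ 3 - κ ^ 3)| ≤ 180 * Real.pi * κ ^ 2 := by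
  set A := (waveBall r).filter fun k => wnorm k < 2 * κ
  set B := (waveBall κ).filter fun k => wnorm k < κ
  have hA := abs_card_sub_le (hκ.trans h1) A (fun k hk => by simpa using (Finset.mem_filter.1 hk).1)
    (fun k hk => by simp only [A, Finset.mem_filter, mem_waveBall]; exact ⟨hk.le, by linarith⟩)
  have hB := abs_card_sub_le hκ B (fun k hk => by simpa using (Finset.mem_filter.1 hk).1)
    (fun k hk => by simp only [B, Finset.mem_filter, mem_waveBall]; exact ⟨hk.le, hk⟩)
  have hBA : B ⊆ A := fun k hk => by
    simp only [A, B, Finset.mem_filter, mem_waveBall] at hk ⊢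
    constructor <;> linarith [hk.2]
  have hAB : (waveShell κ).filter (fun k => wnorm k ≤ r) = A \ B := by
    ext k
    simp only [A, B, Finset.mem_filter, mem_waveShell, Finset.mem_sdiff, mem_waveBall, not_and, not_lt]
    constructor
    · rintro ⟨⟨h3, h4⟩, h5⟩; exact ⟨⟨h5, h4⟩, fun _ => h3⟩
    · rintro ⟨⟨h5, h4⟩, h3⟩
      refine ⟨⟨?_, h4⟩, h5⟩
      by_contra h; exact h (h3 (not_le.1 h).le)
  rw [hAB, Finset.card_sdiff_of_subset hBA, Nat.cast_sub (Finset.card_le_card hBA)]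
  rw [abs_le] at hA hB ⊢
  have : Real.pi * r ^ 2 ≤ Real.pi * (4 * κ ^ 2) :=
    mul_le_mul_of_nonneg_left (by nlinarith) Real.pi_pos.le
  constructor <;> linarith [hA.1, hA.2, hB.1, hB.2]

/-- Sums of powers over a dyadic shell agree with the integral up to one order of `κ`. -/
lemma abs_sum_waveShell_rpow_sub_le {κ p : ℝ} (hκ : 1 ≤ κ) (hp : p < -3) :
    |∑ k ∈ waveShell κ, wnorm k ^ p - 4 * Real.pi * (((2 * κ) ^ (p + 3) - κ ^ (p + 3)) / (p + 3))| ≤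
      180 * Real.pi * κ ^ (p + 2) := by
  have hκ0 : 0 < κ := one_pos.trans_le hκ
  have hle : κ ≤ 2 * κ := by linarith
  have hp3 : p + 3 ≠ 0 := by linarith
  obtain ⟨hi, he⟩ := sum_wnorm_rpow_eq hκ0 (waveShell κ)
    (fun k hk => ⟨(mem_waveShell.1 hk).1, (mem_waveShell.1 hk).2.le⟩) p
  have hrp : ∀ q : ℝ, ContinuousOn (fun r : ℝ => r ^ q) (uIcc κ (2 * κ)) := fun q r hr => by
    rw [uIcc_of_le hle] at hr
    exact (Real.continuousAt_rpow_const r _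
      (Or.inl (hκ0.trans_le hr.1).ne')).continuousWithinAt
  have h0 : (0 : ℝ) ∉ uIcc κ (2 * κ) := fun h => by
    rw [uIcc_of_le hle] at h; linarith [h.1]
  set v : ℝ → ℝ := fun r => 4 * Real.pi / 3 * (r ^ 3 - κ ^ 3) with hv
  -- the continuous counterpart of the summation by parts
  have hw : ∀ r, κ ≤ r → -p * r ^ (p - 1) * v r =
      4 * Real.pi / 3 * -p * r ^ (p + 2) - 4 * Real.pi / 3 * -p * κ ^ 3 * r ^ (p - 1) := by
    intro r hr
    have : r ^ (p + 2) = r ^ (p - 1) * r ^ 3 := by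
      rw [← Real.rpow_natCast, ← Real.rpow_add (hκ0.trans_le hr)]; congr 1; push_cast; ring
    rw [this, hv]; ring
  have hvi : IntervalIntegrable (fun r => -p * r ^ (p - 1) * v r) volume κ (2 * κ) :=
    (((continuousOn_const.mul (hrp _)).mul (by fun_prop))).intervalIntegrable
  have key : (2 * κ) ^ p * v (2 * κ) + ∫ r in κ..(2 * κ), -p * r ^ (p - 1) * v r =
      4 * Real.pi * (((2 * κ) ^ (p + 3) - κ ^ (p + 3)) / (p + 3)) := by
    have e1 : ∫ r in κ..(2 * κ), -p * r ^ (p - 1) * v r =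
        ∫ r in κ..(2 * κ), (4 * Real.pi / 3 * -p * r ^ (p + 2) -
          4 * Real.pi / 3 * -p * κ ^ 3 * r ^ (p - 1)) :=
      intervalIntegral.integral_congr fun r hr => hw r (by rw [uIcc_of_le hle] at hr; exact hr.1)
    rw [e1, intervalIntegral.integral_sub ((hrp _).intervalIntegrable.const_mul _)
      ((hrp _).intervalIntegrable.const_mul _), intervalIntegral.integral_const_mul,
      intervalIntegral.integral_const_mul, integral_rpow (Or.inr ⟨by linarith, h0⟩),
      integral_rpow (Or.inr ⟨by linarith, h0⟩)]
    have a1 : p + 2 + 1 = p + 3 := by ring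
    have a2 : p - 1 + 1 = p := by ring
    have a3 : ∀ r : ℝ, 0 < r → r ^ (p + 3) = r ^ p * r ^ 3 := fun r hr => by
      rw [← Real.rpow_natCast, ← Real.rpow_add hr]; norm_num
    have hp0 : p ≠ 0 := by linarith
    rw [a1, a2, a3 κ hκ0, a3 (2 * κ) (by linarith), hv]
    field_simp
    ring
  have hn := fun r h1 h2 => abs_card_waveShell_filter_sub_le (r := r) hκ h1 h2
  have hn2 : |((waveShell κ).card : ℝ) - v (2 * κ)| ≤ 180 * Real.pi * κ ^ 2 := by
    have := hn (2 * κ) hle le_rfl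
    rwa [Finset.filter_true_of_mem fun k hk => (mem_waveShell.1 hk).2.le] at this
  have hdiff : |(∫ r in κ..(2 * κ), -p * r ^ (p - 1) *
      ((((waveShell κ).filter fun k => wnorm k ≤ r).card : ℕ) : ℝ)) -
      ∫ r in κ..(2 * κ), -p * r ^ (p - 1) * v r| ≤
      180 * Real.pi * κ ^ 2 * (κ ^ p - (2 * κ) ^ p) := by
    rw [← intervalIntegral.integral_sub hi hvi, ← Real.norm_eq_abs]
    have hbi : IntervalIntegrable (fun r => 180 * Real.pi * κ ^ 2 * -p * r ^ (p - 1)) volume κ (2 * κ) :=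
      (hrp _).intervalIntegrable.const_mul _
    refine (intervalIntegral.norm_integral_le_of_norm_le hle
      (Eventually.of_forall fun r hr => ?_) hbi).trans_eq ?_
    · have hr0 : 0 < r := hκ0.trans hr.1
      rw [← mul_sub, norm_mul, norm_mul, Real.norm_of_nonneg (by linarith : 0 ≤ -p),
        Real.norm_of_nonneg (by positivity : 0 ≤ r ^ (p - 1)), Real.norm_eq_abs]
      calc _ ≤ -p * r ^ (p - 1) * (180 * Real.pi * κ ^ 2) :=
            mul_le_mul_of_nonneg_left (hn r hr.1.le hr.2) (mul_nonneg (by linarith) (by positivity))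
        _ = _ := by ring
    · rw [intervalIntegral.integral_const_mul, integral_rpow (Or.inr ⟨by linarith, h0⟩),
        show p - 1 + 1 = p by ring]
      have hp0 : p ≠ 0 := by linarith
      field_simp; ring
  have hκp : κ ^ (p + 2) = κ ^ 2 * κ ^ p := by
    rw [← Real.rpow_natCast, ← Real.rpow_add hκ0]; congr 1; push_cast; ring
  have h2p : 0 ≤ (2 * κ) ^ p := by positivity
  have hn3 : |(2 * κ) ^ p * (waveShell κ).card - (2 * κ) ^ p * v (2 * κ)| ≤
      (2 * κ) ^ p * (180 * Real.pi * κ ^ 2) := by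
    rw [← mul_sub, abs_mul, abs_of_nonneg h2p]
    exact mul_le_mul_of_nonneg_left hn2 h2p
  rw [he, ← key, hκp]
  rw [abs_le] at hdiff hn3 ⊢
  constructor <;> linarith [hdiff.1, hdiff.2, hn3.1, hn3.2]

/-! ### Multiplication `H^{1/2} × H¹ → H⁻¹` on Fourier coefficients -/

lemma lintegral_mul_sq_le {α : Type*} [MeasurableSpace α] (μ : Measure α) {f g : α → ENNReal}
    (hf : AEMeasurable f μ) (hg : AEMeasurable g μ) :
    (∫⁻ x, f x * g x ∂μ) ^ 2 ≤ (∫⁻ x, f x ^ 2 ∂μ) * ∫⁻ x, g x ^ 2 ∂μ := by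
  have h := ENNReal.lintegral_mul_le_Lp_mul_Lq μ Real.HolderConjugate.two_two hf hg
  have hs : ∀ x : ENNReal, (x ^ (1 / 2 : ℝ)) ^ 2 = x := fun x => by
    rw [← ENNReal.rpow_natCast, ← ENNReal.rpow_mul]; norm_num
  calc _ ≤ _ := pow_le_pow_left' h 2
    _ = _ := by rw [mul_pow, hs, hs]; simp only [ENNReal.rpow_ofNat]

lemma tsum_mul_sq_le {ι : Type*} (f g : ι → ENNReal) :
    (∑' i, f i * g i) ^ 2 ≤ (∑' i, f i ^ 2) * ∑' i, g i ^ 2 := by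
  let _ : MeasurableSpace ι := ⊤
  have h := lintegral_mul_sq_le (Measure.count : Measure ι) (f := f) (g := g)
    (measurable_from_top.aemeasurable) (measurable_from_top.aemeasurable)
  simpa only [lintegral_count] using h

lemma ennreal_add_sq_le (a b : ENNReal) : (a + b) ^ 2 ≤ 4 * (a ^ 2 + b ^ 2) := by
  have h1 : a + b ≤ 2 * max a b := by
    rw [two_mul]; exact add_le_add (le_max_left _ _) (le_max_right _ _)
  have h2 : (max a b) ^ 2 ≤ a ^ 2 + b ^ 2 := by
    rcases le_total a b with h | h
    · rw [max_eq_right h]; exact le_add_self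
    · rw [max_eq_left h]; exact le_self_add
  calc (a + b) ^ 2 ≤ (2 * max a b) ^ 2 := pow_le_pow_left' h1 2
    _ = 4 * (max a b) ^ 2 := by rw [mul_pow]; norm_num
    _ ≤ _ := by gcongr

lemma tsum_ite_waveBall (R : ℝ) (f : Wave → ℝ) (hf : ∀ k, 0 ≤ f k) :
    ∑' k : Wave, (if wnorm k ≤ R then ENNReal.ofReal (f k) else 0) =
      ENNReal.ofReal (∑ k ∈ waveBall R, f k) := by
  rw [ENNReal.ofReal_sum_of_nonneg fun k _ => hf k, tsum_eq_sum (s := waveBall R)]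
  · exact Finset.sum_congr rfl fun k hk => by rw [if_pos (by simpa using hk)]
  · exact fun k hk => by rw [if_neg (by simpa using hk)]

lemma tsum_conv_comm (a b : Wave → ENNReal) :
    ∑' k : Wave, ∑' j : Wave, a (k - j) * b j = (∑' m, a m) * ∑' j, b j := by
  rw [ENNReal.tsum_comm, ← ENNReal.tsum_mul_left]
  refine tsum_congr fun j => ?_
  rw [ENNReal.tsum_mul_right]
  congr 1
  exact (Equiv.subRight j).tsum_eq a

/-- The weight `|m|^{-1/2}`, zero at `m = 0`. -/
noncomputable def invSqrtWeight (m : Wave) : ENNReal := ENNReal.ofReal √((wnorm m)⁻¹)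

lemma invSqrtWeight_sq (m : Wave) : invSqrtWeight m ^ 2 = ENNReal.ofReal (wnorm m)⁻¹ := by
  rw [invSqrtWeight, ← ENNReal.ofReal_pow (Real.sqrt_nonneg _),
    Real.sq_sqrt (inv_nonneg.2 (wnorm_nonneg m))]

/-- Low-frequency velocities: the part of the convolution with `|m| ≤ 2|k|`, by Cauchy--Schwarz
against `∑_{|m| ≤ 2|k|} |m|⁻¹ ≲ |k|²`. -/
lemma tsum_low_le (a b : Wave → ENNReal) :
    ∑' k : Wave, ENNReal.ofReal (wnorm k ^ 2)⁻¹ *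
      (∑' j : Wave, if wnorm (k - j) ≤ 2 * wnorm k then
        invSqrtWeight (k - j) * a (k - j) * b j else 0) ^ 2 ≤
      ENNReal.ofReal (228 * Real.pi) * ((∑' m, a m ^ 2) * ∑' j, b j ^ 2) := by
  rw [← tsum_conv_comm (fun m => a m ^ 2), ← ENNReal.tsum_mul_left]
  refine ENNReal.tsum_le_tsum fun k => ?_
  have h1 : (∑' j : Wave, if wnorm (k - j) ≤ 2 * wnorm k then
        invSqrtWeight (k - j) * a (k - j) * b j else 0) ^ 2 ≤
      ENNReal.ofReal (57 * Real.pi * (2 * wnorm k) ^ 2) * ∑' j, a (k - j) ^ 2 * b j ^ 2 := by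
    have h2 := tsum_mul_sq_le (fun j => if wnorm (k - j) ≤ 2 * wnorm k then
      invSqrtWeight (k - j) else 0) (fun j => a (k - j) * b j)
    have h3 : ∑' j, (if wnorm (k - j) ≤ 2 * wnorm k then invSqrtWeight (k - j) else 0) ^ 2 ≤
        ENNReal.ofReal (57 * Real.pi * (2 * wnorm k) ^ 2) := by
      refine le_trans (le_of_eq ?_) (ENNReal.ofReal_le_ofReal
        (sum_inv_wnorm_le (2 * wnorm k) (by linarith [wnorm_nonneg k])))
      rw [← tsum_ite_waveBall _ _ fun k => inv_nonneg.2 (wnorm_nonneg k),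
        ← (Equiv.subLeft k).tsum_eq]
      refine tsum_congr fun j => ?_
      simp only [Equiv.subLeft_apply, sub_sub_cancel]
      split_ifs
      · exact invSqrtWeight_sq _
      · simp
    simp only [mul_pow, ite_mul, zero_mul] at h2
    simp only [mul_assoc]
    refine h2.trans ?_
    simp only [← mul_assoc]
    exact mul_le_mul_left h3 _
  refine (mul_le_mul_right h1 _).trans ?_
  rw [← mul_assoc, ← ENNReal.ofReal_mul (inv_nonneg.2 (sq_nonneg _))]
  refine mul_le_mul_left (ENNReal.ofReal_le_ofReal ?_) _
  rcases eq_or_ne k 0 with rfl | hk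
  · simp [Real.pi_pos.le]
  · have := wnorm_ne_zero hk
    field_simp; norm_num

/-- High-frequency velocities: the part of the convolution with `|m| > 2|k|`; there `|k| < |j|` and
`|m|` is comparable with `|j|`, and `|j|⁻¹ ∑_{|k| ≤ |j|} |k|⁻² ≲ 1`. -/
lemma tsum_high_le (a b : Wave → ENNReal) :
    ∑' k : Wave, ENNReal.ofReal (wnorm k ^ 2)⁻¹ *
      (∑' j : Wave, if wnorm (k - j) ≤ 2 * wnorm k then 0 else
        invSqrtWeight (k - j) * a (k - j) * b j) ^ 2 ≤
      ENNReal.ofReal (171 * Real.pi) * ((∑' m, a m ^ 2) * ∑' j, b j ^ 2) := by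
  have h1 : ∀ k : Wave, (∑' j : Wave, if wnorm (k - j) ≤ 2 * wnorm k then 0 else
        invSqrtWeight (k - j) * a (k - j) * b j) ^ 2 ≤
      (∑' m, a m ^ 2) * ∑' j, if wnorm (k - j) ≤ 2 * wnorm k then 0 else
        ENNReal.ofReal (wnorm (k - j))⁻¹ * b j ^ 2 := by
    intro k
    have h2 := tsum_mul_sq_le (fun j => a (k - j)) (fun j => if wnorm (k - j) ≤ 2 * wnorm k then 0
      else invSqrtWeight (k - j) * b j)
    have h3 := (Equiv.subLeft k).tsum_eq (fun m => a m ^ 2)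
    simp only [Equiv.subLeft_apply] at h3
    rw [h3] at h2
    convert h2 using 2
    · refine tsum_congr fun j => ?_
      split_ifs <;> ring
    · refine tsum_congr fun j => ?_
      split_ifs
      · simp
      · rw [mul_pow, invSqrtWeight_sq]
  calc _ ≤ ∑' k : Wave, (∑' m, a m ^ 2) * ∑' j, ENNReal.ofReal (wnorm k ^ 2)⁻¹ *
        (if wnorm (k - j) ≤ 2 * wnorm k then 0 else
        ENNReal.ofReal (wnorm (k - j))⁻¹ * b j ^ 2) := by
        refine ENNReal.tsum_le_tsum fun k => ?_
        rw [ENNReal.tsum_mul_left, mul_left_comm]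
        exact mul_le_mul_right (h1 k) _
    _ = (∑' m, a m ^ 2) * ∑' j, b j ^ 2 * ∑' k, ENNReal.ofReal (wnorm k ^ 2)⁻¹ *
        (if wnorm (k - j) ≤ 2 * wnorm k then 0 else ENNReal.ofReal (wnorm (k - j))⁻¹) := by
        rw [ENNReal.tsum_mul_left, ENNReal.tsum_comm]
        congr 1
        refine tsum_congr fun j => ?_
        rw [← ENNReal.tsum_mul_left]
        refine tsum_congr fun k => ?_
        split_ifs <;> ring
    _ ≤ (∑' m, a m ^ 2) * ∑' j, b j ^ 2 * ENNReal.ofReal (171 * Real.pi) := by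
        refine mul_le_mul_right (ENNReal.tsum_le_tsum fun j => mul_le_mul_right ?_ _) _
        calc _ ≤ ∑' k, (if wnorm k ≤ wnorm j then
              ENNReal.ofReal ((wnorm k ^ 2)⁻¹ * (3 / 2 * (wnorm j)⁻¹)) else 0) := by
              refine ENNReal.tsum_le_tsum fun k => ?_
              split_ifs with h2 h3 h3
              · simp
              · simp
              · rw [← ENNReal.ofReal_mul (inv_nonneg.2 (sq_nonneg _))]
                refine ENNReal.ofReal_le_ofReal ?_
                refine mul_le_mul_of_nonneg_left ?_ (inv_nonneg.2 (sq_nonneg _))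
                have h4 := wnorm_sub_le k j
                have h5 : wnorm j ≤ wnorm k + wnorm (k - j) := by
                  simpa using wnorm_sub_le k (k - j)
                rcases eq_or_ne j 0 with rfl | hj
                · simp only [sub_zero, wnorm_zero] at h2 h3
                  linarith
                · have hj0 := wnorm_pos hj
                  rw [show 3 / 2 * (wnorm j)⁻¹ = (2 / 3 * wnorm j)⁻¹ by field_simp]
                  exact inv_anti₀ (by positivity) (by linarith)
              · exfalso
                have h4 := wnorm_sub_le k j
                linarith
          _ = ENNReal.ofReal (∑ k ∈ waveBall (wnorm j), (wnorm k ^ 2)⁻¹ * (3 / 2 * (wnorm j)⁻¹)) :=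
              tsum_ite_waveBall _ _ fun k => mul_nonneg (inv_nonneg.2 (sq_nonneg _))
                (mul_nonneg (by norm_num) (inv_nonneg.2 (wnorm_nonneg j)))
          _ ≤ _ := by
              refine ENNReal.ofReal_le_ofReal ?_
              rw [← Finset.sum_mul]
              refine (mul_le_mul_of_nonneg_right (sum_inv_wnorm_sq_le _ (wnorm_nonneg j))
                (mul_nonneg (by norm_num) (inv_nonneg.2 (wnorm_nonneg j)))).trans ?_
              rcases eq_or_ne j 0 with rfl | hj
              · simp [Real.pi_pos.le]
              · have := wnorm_ne_zero hj
                field_simp; norm_num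
    _ = _ := by rw [ENNReal.tsum_mul_right]; ring

lemma tsum_product_le (a b : Wave → ENNReal) :
    ∑' k : Wave, ENNReal.ofReal (wnorm k ^ 2)⁻¹ *
      (∑' j : Wave, invSqrtWeight (k - j) * a (k - j) * b j) ^ 2 ≤
      ENNReal.ofReal (1596 * Real.pi) * ((∑' m, a m ^ 2) * ∑' j, b j ^ 2) := by
  have hs : ∀ k : Wave, ∑' j : Wave, invSqrtWeight (k - j) * a (k - j) * b j =
      (∑' j : Wave, if wnorm (k - j) ≤ 2 * wnorm k then
        invSqrtWeight (k - j) * a (k - j) * b j else 0) +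
      ∑' j : Wave, if wnorm (k - j) ≤ 2 * wnorm k then 0 else
        invSqrtWeight (k - j) * a (k - j) * b j := by
    intro k
    rw [← ENNReal.tsum_add]
    refine tsum_congr fun j => ?_
    split_ifs <;> simp
  calc _ ≤ ∑' k : Wave, 4 * (ENNReal.ofReal (wnorm k ^ 2)⁻¹ *
      (∑' j : Wave, if wnorm (k - j) ≤ 2 * wnorm k then
        invSqrtWeight (k - j) * a (k - j) * b j else 0) ^ 2 +
      ENNReal.ofReal (wnorm k ^ 2)⁻¹ * (∑' j : Wave, if wnorm (k - j) ≤ 2 * wnorm k then 0 else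
        invSqrtWeight (k - j) * a (k - j) * b j) ^ 2) := by
        refine ENNReal.tsum_le_tsum fun k => ?_
        rw [hs k, ← mul_add, mul_left_comm]
        exact mul_le_mul_right (ennreal_add_sq_le _ _) _
    _ ≤ 4 * (ENNReal.ofReal (228 * Real.pi) * ((∑' m, a m ^ 2) * ∑' j, b j ^ 2) +
        ENNReal.ofReal (171 * Real.pi) * ((∑' m, a m ^ 2) * ∑' j, b j ^ 2)) := by
        rw [ENNReal.tsum_mul_left, ENNReal.tsum_add]
        exact mul_le_mul_right (add_le_add (tsum_low_le a b) (tsum_high_le a b)) _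
    _ = _ := by
        have hpi := Real.pi_pos
        rw [← add_mul, ← ENNReal.ofReal_add (by positivity) (by positivity), ← mul_assoc]
        congr 1
        rw [show (4 : ENNReal) = ENNReal.ofReal 4 by simp, ← ENNReal.ofReal_mul (by norm_num)]
        congr 1; ring

lemma enorm_tsum_le {ι : Type*} (f : ι → ℂ) : ‖∑' i, f i‖ₑ ≤ ∑' i, ‖f i‖ₑ := by
  by_cases h : Summable fun i => ‖f i‖₊
  · have h1 := nnnorm_tsum_le h
    calc _ ≤ ((∑' i, ‖f i‖₊ : NNReal) : ENNReal) := by exact_mod_cast h1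
      _ = _ := ENNReal.coe_tsum h
  · have : ∑' i, ‖f i‖ₑ = ⊤ := by
      by_contra h'
      exact h (ENNReal.tsum_coe_ne_top_iff_summable.1 h')
    rw [this]; exact le_top

/-- The Euclidean length of a complex vector. -/
noncomputable def vnorm (v : Fin 3 → ℂ) : ℝ := √(∑ i, ‖v i‖ ^ 2)

lemma vnorm_nonneg (v : Fin 3 → ℂ) : 0 ≤ vnorm v := Real.sqrt_nonneg _

lemma vnorm_sq (v : Fin 3 → ℂ) : vnorm v ^ 2 = ∑ i, ‖v i‖ ^ 2 :=
  Real.sq_sqrt (Finset.sum_nonneg fun _ _ => sq_nonneg _)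

lemma norm_dot_le (v : Fin 3 → ℂ) (j : Wave) : ‖∑ i, v i * (j i : ℂ)‖ ≤ vnorm v * wnorm j := by
  refine (norm_sum_le _ _).trans ?_
  have h := Real.sum_mul_le_sqrt_mul_sqrt Finset.univ (fun i => ‖v i‖) (fun i => |(j i : ℝ)|)
  simp only [sq_abs] at h
  refine le_trans (le_of_eq ?_) h
  exact Finset.sum_congr rfl fun i _ => by simp

/-- The `j`-th term of the convolution defining `u · ∇θ`. -/
noncomputable def advectTerm (u : Wave → Fin 3 → ℂ) (θ : Wave → ℂ) (k j : Wave) : ℂ :=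
  Complex.I * (∑ i, u (k - j) i * (j i : ℂ)) * θ j

lemma advect_eq_tsum (u : Wave → Fin 3 → ℂ) (θ : Wave → ℂ) (k : Wave) :
    advect u θ k = ∑' j, advectTerm u θ k j := rfl

lemma enorm_advectTerm_le {u : Wave → Fin 3 → ℂ} (hu : u 0 = 0) (θ : Wave → ℂ) (k j : Wave) :
    ‖advectTerm u θ k j‖ₑ ≤ invSqrtWeight (k - j) *
      ENNReal.ofReal (√(wnorm (k - j)) * vnorm (u (k - j))) * ENNReal.ofReal (wnorm j * ‖θ j‖) := by
  rw [← ofReal_norm, invSqrtWeight, ← ENNReal.ofReal_mul (Real.sqrt_nonneg _),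
    ← ENNReal.ofReal_mul (mul_nonneg (Real.sqrt_nonneg _)
      (mul_nonneg (Real.sqrt_nonneg _) (vnorm_nonneg _)))]
  refine ENNReal.ofReal_le_ofReal ?_
  rcases eq_or_ne (k - j) 0 with h | h
  · simp [advectTerm, h, hu]
  · rw [← mul_assoc √_, ← Real.sqrt_mul (inv_nonneg.2 (wnorm_nonneg _)),
      inv_mul_cancel₀ (wnorm_ne_zero h), Real.sqrt_one, one_mul, ← mul_assoc, advectTerm, norm_mul,
      norm_mul, Complex.norm_I, one_mul]
    exact mul_le_mul_of_nonneg_right (norm_dot_le _ _) (norm_nonneg _)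

lemma one_le_eight_pi_cubed : 1 ≤ 8 * Real.pi ^ 3 := by
  have : 1 ≤ Real.pi ^ 3 := one_le_pow₀ (by linarith [Real.pi_gt_three])
  linarith

lemma tsum_sqrt_wnorm_vnorm_sq_le (u : Wave → Fin 3 → ℂ) :
    ∑' m, ENNReal.ofReal (√(wnorm m) * vnorm (u m)) ^ 2 ≤ hHalfSq u := by
  refine ENNReal.tsum_le_tsum fun m => ?_
  rw [← ENNReal.ofReal_pow (mul_nonneg (Real.sqrt_nonneg _) (vnorm_nonneg _)), mul_pow,
    Real.sq_sqrt (wnorm_nonneg m), vnorm_sq]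
  refine ENNReal.ofReal_le_ofReal ?_
  have h0 : 0 ≤ wnorm m * ∑ i, ‖u m i‖ ^ 2 :=
    mul_nonneg (wnorm_nonneg m) (Finset.sum_nonneg fun _ _ => sq_nonneg _)
  nlinarith [one_le_eight_pi_cubed]

lemma tsum_wnorm_norm_sq_le (θ : Wave → ℂ) :
    ∑' j, ENNReal.ofReal (wnorm j * ‖θ j‖) ^ 2 ≤ h1Sq θ := by
  refine ENNReal.tsum_le_tsum fun m => ?_
  rw [← ENNReal.ofReal_pow (mul_nonneg (wnorm_nonneg m) (norm_nonneg _)), mul_pow]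
  refine ENNReal.ofReal_le_ofReal (mul_le_mul_of_nonneg_right ?_ (sq_nonneg _))
  nlinarith [one_le_eight_pi_cubed, sq_nonneg (wnorm m)]

/-- The critical product estimate `‖u·∇θ‖_{H⁻¹} ≲ ‖u‖_{H^{1/2}} ‖θ‖_{H¹}`, homogeneous in `u`. -/
lemma tsum_enorm_advect_sq_le {u : Wave → Fin 3 → ℂ} (hu : u 0 = 0) (θ : Wave → ℂ) :
    ∑' k : Wave, ENNReal.ofReal (wnorm k ^ 2)⁻¹ * ‖advect u θ k‖ₑ ^ 2 ≤
      ENNReal.ofReal (1596 * Real.pi) * (hHalfSq u * h1Sq θ) := by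
  calc _ ≤ ∑' k : Wave, ENNReal.ofReal (wnorm k ^ 2)⁻¹ *
      (∑' j : Wave, invSqrtWeight (k - j) *
        ENNReal.ofReal (√(wnorm (k - j)) * vnorm (u (k - j))) *
          ENNReal.ofReal (wnorm j * ‖θ j‖)) ^ 2 := by
        refine ENNReal.tsum_le_tsum fun k => ?_
        gcongr
        exact (enorm_tsum_le _).trans (ENNReal.tsum_le_tsum fun j => enorm_advectTerm_le hu θ k j)
    _ ≤ _ := tsum_product_le (fun m => ENNReal.ofReal (√(wnorm m) * vnorm (u m)))
          (fun j => ENNReal.ofReal (wnorm j * ‖θ j‖))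
    _ ≤ _ := by
        gcongr
        · exact tsum_sqrt_wnorm_vnorm_sq_le u
        · exact tsum_wnorm_norm_sq_le θ

lemma tsum_enorm_advectTerm_sq_le {u : Wave → Fin 3 → ℂ} (hu : u 0 = 0) (θ : Wave → ℂ) (k : Wave) :
    (∑' j, ‖advectTerm u θ k j‖ₑ) ^ 2 ≤ hHalfSq u * h1Sq θ := by
  have hw : ∀ m, invSqrtWeight m ≤ 1 := fun m => by
    rw [invSqrtWeight, ← ENNReal.ofReal_one]
    refine ENNReal.ofReal_le_ofReal (Real.sqrt_le_one.2 ?_)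
    rcases eq_or_ne m 0 with rfl | hm
    · simp
    · exact inv_le_one_of_one_le₀ (one_le_wnorm hm)
  calc _ ≤ (∑' j : Wave, ENNReal.ofReal (√(wnorm (k - j)) * vnorm (u (k - j))) *
          ENNReal.ofReal (wnorm j * ‖θ j‖)) ^ 2 := by
        gcongr with j
        refine (enorm_advectTerm_le hu θ k j).trans ?_
        rw [mul_assoc]
        exact mul_le_of_le_one_left (by positivity) (hw _)
    _ ≤ _ := tsum_mul_sq_le _ _
    _ ≤ _ := by
        gcongr
        · have h3 := (Equiv.subLeft k).tsum_eq
            (fun m => ENNReal.ofReal (√(wnorm m) * vnorm (u m)) ^ 2)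
          simp only [Equiv.subLeft_apply] at h3
          rw [h3]
          exact tsum_sqrt_wnorm_vnorm_sq_le u
        · exact tsum_wnorm_norm_sq_le θ

lemma enorm_advect_sq_le {u : Wave → Fin 3 → ℂ} (hu : u 0 = 0) (θ : Wave → ℂ) (k : Wave) :
    ‖advect u θ k‖ₑ ^ 2 ≤ hHalfSq u * h1Sq θ :=
  (pow_le_pow_left' (enorm_tsum_le _) 2).trans (tsum_enorm_advectTerm_sq_le hu θ k)

lemma summable_advectTerm {u : Wave → Fin 3 → ℂ} (hu : u 0 = 0) {θ : Wave → ℂ}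
    (h1 : hHalfSq u ≠ ⊤) (h2 : h1Sq θ ≠ ⊤) (k : Wave) : Summable (advectTerm u θ k) := by
  have h := tsum_enorm_advectTerm_sq_le hu θ k
  have h3 : ∑' j, ‖advectTerm u θ k j‖ₑ ≠ ⊤ := by
    intro h4
    rw [h4] at h
    exact ENNReal.mul_ne_top h1 h2 (top_le_iff.1 (by simpa using h))
  exact Summable.of_nnnorm (ENNReal.tsum_coe_ne_top_iff_summable.1 h3)

lemma advect_sub {u : Wave → Fin 3 → ℂ} (hu : u 0 = 0) {θ η : Wave → ℂ}
    (h1 : hHalfSq u ≠ ⊤) (h2 : h1Sq θ ≠ ⊤) (h3 : h1Sq η ≠ ⊤) (k : Wave) :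
    advect u (fun k => θ k - η k) k = advect u θ k - advect u η k := by
  simp only [advect_eq_tsum]
  rw [← (summable_advectTerm hu h1 h2 k).tsum_sub (summable_advectTerm hu h1 h3 k)]
  exact tsum_congr fun j => by simp only [advectTerm]; ring

lemma advect_neg (u : Wave → Fin 3 → ℂ) (θ : Wave → ℂ) (k : Wave) :
    advect u (fun k => -θ k) k = -advect u θ k := by
  simp only [advect_eq_tsum, ← tsum_neg]
  exact tsum_congr fun j => by simp only [advectTerm]; ring

/-- Advection by a divergence-free field conserves the mean. -/
lemma advect_apply_zero {u : Wave → Fin 3 → ℂ} (hdiv : ∀ m, ∑ i, u m i * (m i : ℂ) = 0)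
    (θ : Wave → ℂ) : advect u θ 0 = 0 := by
  rw [advect_eq_tsum]
  refine (tsum_congr fun j => ?_).trans tsum_zero
  have h := hdiv (0 - j)
  have : ∑ i, u (0 - j) i * (j i : ℂ) = 0 := by
    rw [← neg_eq_zero, ← Finset.sum_neg_distrib, ← h]
    exact Finset.sum_congr rfl fun i _ => by simp
  simp only [advectTerm, this]; simp

/-! ### The Duhamel integral of a single Fourier mode -/

/-- The Duhamel integral `∫₀ᵗ e^{-(t-s)l} F(s) ds` of a scalar function. -/
noncomputable def heatInt (F : ℝ → ℂ) (l t : ℝ) : ℂ :=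
  ∫ s in (0 : ℝ)..t, ((Real.exp (-(t - s) * l) : ℝ) : ℂ) * F s

/-- The heat kernel `e^{-xl}` of a mode, extended by zero to negative times. -/
noncomputable def heatKer (l x : ℝ) : ENNReal :=
  (Ici (0 : ℝ)).indicator (fun x => ENNReal.ofReal (Real.exp (-x * l))) x

lemma measurable_heatKer (l : ℝ) : Measurable (heatKer l) :=
  Measurable.indicator (by fun_prop) measurableSet_Ici

lemma lintegral_heatKer {l : ℝ} (hl : 0 < l) : ∫⁻ x, heatKer l x = ENNReal.ofReal l⁻¹ := by
  have h1 : IntegrableOn (fun x : ℝ => Real.exp (-x * l)) (Ioi 0) := by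
    simpa [mul_comm] using integrableOn_exp_mul_Ioi (neg_lt_zero.2 hl) 0
  have h2 : ∫ x in Ioi (0 : ℝ), Real.exp (-x * l) = l⁻¹ := by
    have := integral_exp_mul_Ioi (neg_lt_zero.2 hl) 0
    simpa [mul_comm] using this
  simp only [heatKer]
  rw [lintegral_indicator measurableSet_Ici, setLIntegral_congr Ioi_ae_eq_Ici.symm, ← h2,
    ofReal_integral_eq_lintegral_ofReal h1 (Eventually.of_forall fun x => (Real.exp_pos _).le)]

lemma enorm_heatInt_le {F : ℝ → ℂ} {l t : ℝ} (ht : 0 ≤ t) :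
    ‖heatInt F l t‖ₑ ≤ ∫⁻ s in Ioc 0 t, heatKer l (t - s) * ‖F s‖ₑ := by
  rw [heatInt, intervalIntegral.integral_of_le ht]
  refine (enorm_integral_le_lintegral_enorm _).trans_eq ?_
  refine setLIntegral_congr_fun measurableSet_Ioc fun s hs => ?_
  have : t - s ∈ Ici (0 : ℝ) := sub_nonneg.2 hs.2
  simp only [heatKer, indicator_of_mem this, enorm_mul]
  rw [← ofReal_norm, Complex.norm_real, Real.norm_of_nonneg (Real.exp_pos _).le]

lemma enorm_heatInt_sq_le {F : ℝ → ℂ} {l t : ℝ} (hl : 0 < l) (ht : 0 ≤ t)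
    (hF : AEMeasurable F (volume.restrict (Ioc 0 t))) :
    ‖heatInt F l t‖ₑ ^ 2 ≤ ENNReal.ofReal l⁻¹ * ∫⁻ s in Ioc 0 t, heatKer l (t - s) * ‖F s‖ₑ ^ 2 := by
  have hk : Measurable fun s => heatKer l (t - s) := (measurable_heatKer l).comp (by fun_prop)
  have hs : ∀ x : ENNReal, (x ^ (1 / 2 : ℝ)) ^ 2 = x := fun x => by
    rw [← ENNReal.rpow_natCast, ← ENNReal.rpow_mul]; norm_num
  calc _ ≤ (∫⁻ s in Ioc 0 t, heatKer l (t - s) * ‖F s‖ₑ) ^ 2 :=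
        pow_le_pow_left' (enorm_heatInt_le ht) 2
    _ = (∫⁻ s in Ioc 0 t, heatKer l (t - s) ^ (1 / 2 : ℝ) *
          (heatKer l (t - s) ^ (1 / 2 : ℝ) * ‖F s‖ₑ)) ^ 2 := by
        simp only [← mul_assoc, ← sq, hs]
    _ ≤ _ := lintegral_mul_sq_le _ (hk.pow_const _).aemeasurable
          ((hk.pow_const _).aemeasurable.mul hF.enorm)
    _ ≤ _ := by
        simp only [mul_pow, hs]
        refine mul_le_mul_left ?_ _
        refine (setLIntegral_le_lintegral _ _).trans_eq ?_
        rw [lintegral_sub_left_eq_self (heatKer l) t, lintegral_heatKer hl]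

/-- Young's inequality in time: the Duhamel integral gains the factor `l⁻¹` in `L²(0,T)`. -/
lemma lintegral_enorm_heatInt_sq_le {F : ℝ → ℂ} {l T : ℝ} (hl : 0 < l)
    (hF : AEMeasurable F (volume.restrict (Ioc 0 T))) :
    ∫⁻ t in Ioc 0 T, ‖heatInt F l t‖ₑ ^ 2 ≤
      ENNReal.ofReal l⁻¹ ^ 2 * ∫⁻ s in Ioc 0 T, ‖F s‖ₑ ^ 2 := by
  calc _ ≤ ∫⁻ t in Ioc 0 T, ENNReal.ofReal l⁻¹ *
        ∫⁻ s in Ioc 0 T, heatKer l (t - s) * ‖F s‖ₑ ^ 2 := by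
        refine setLIntegral_mono' measurableSet_Ioc fun t ht => ?_
        have hsub : Ioc 0 t ⊆ Ioc 0 T := Ioc_subset_Ioc_right ht.2
        refine (enorm_heatInt_sq_le hl ht.1.le (hF.mono_set hsub)).trans ?_
        gcongr
    _ = ENNReal.ofReal l⁻¹ * ∫⁻ s in Ioc 0 T, ∫⁻ t in Ioc 0 T, heatKer l (t - s) * ‖F s‖ₑ ^ 2 := by
        rw [lintegral_const_mul' _ _ ENNReal.ofReal_ne_top, lintegral_lintegral_swap]
        refine AEMeasurable.mul ?_ ?_
        · exact ((measurable_heatKer l).comp (by fun_prop : Measurable fun p : ℝ × ℝ => p.1 - p.2)).aemeasurable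
        · exact (hF.enorm.pow_const 2).comp_snd
    _ ≤ ENNReal.ofReal l⁻¹ * ∫⁻ s in Ioc 0 T, ENNReal.ofReal l⁻¹ * ‖F s‖ₑ ^ 2 := by
        gcongr with s
        have hk : Measurable fun t => heatKer l (t - s) := (measurable_heatKer l).comp (by fun_prop)
        rw [lintegral_mul_const _ hk]
        refine mul_le_mul_left ?_ _
        refine (setLIntegral_le_lintegral _ _).trans_eq ?_
        rw [lintegral_sub_right_eq_self (heatKer l) s, lintegral_heatKer hl]
    _ = _ := by
        rw [lintegral_const_mul' _ _ ENNReal.ofReal_ne_top, ← mul_assoc, sq]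

lemma heatKer_le_one {l : ℝ} (hl : 0 ≤ l) (x : ℝ) : heatKer l x ≤ 1 := by
  simp only [heatKer, indicator_apply]
  split_ifs with h
  · rw [← ENNReal.ofReal_one]
    refine ENNReal.ofReal_le_ofReal (Real.exp_le_one_iff.2 ?_)
    rw [neg_mul]; exact neg_nonpos.2 (mul_nonneg h hl)
  · exact zero_le_one

lemma enorm_heatInt_sq_le_of_le {F : ℝ → ℂ} {l t T : ℝ} (hl : 0 ≤ l) (ht : 0 ≤ t) (htT : t ≤ T)
    (hF : AEMeasurable F (volume.restrict (Ioc 0 T))) :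
    ‖heatInt F l t‖ₑ ^ 2 ≤ ENNReal.ofReal T * ∫⁻ s in Ioc 0 T, ‖F s‖ₑ ^ 2 := by
  have h1 : ‖heatInt F l t‖ₑ ≤ ∫⁻ s in Ioc 0 T, 1 * ‖F s‖ₑ :=
    (enorm_heatInt_le ht).trans ((lintegral_mono fun s =>
      mul_le_mul_left (heatKer_le_one hl _) _).trans
      (lintegral_mono_set (Ioc_subset_Ioc_right htT)))
  refine (pow_le_pow_left' h1 2).trans ((lintegral_mul_sq_le _ aemeasurable_const hF.enorm).trans ?_)
  simp

lemma heatInt_eq_mul (F : ℝ → ℂ) (l t : ℝ) :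
    heatInt F l t = ((Real.exp (-(t * l)) : ℝ) : ℂ) *
      ∫ s in (0 : ℝ)..t, ((Real.exp (s * l) : ℝ) : ℂ) * F s := by
  rw [heatInt, ← intervalIntegral.integral_const_mul]
  congr 1; ext s
  rw [← mul_assoc, ← Complex.ofReal_mul, ← Real.exp_add]
  ring_nf

lemma continuousOn_heatInt {F : ℝ → ℂ} {l T : ℝ} (hT : 0 ≤ T) (hF : IntegrableOn F (Ioc 0 T)) :
    ContinuousOn (heatInt F l) (Icc 0 T) := by
  have h1 : IntegrableOn (fun s => ((Real.exp (s * l) : ℝ) : ℂ) * F s) (uIcc 0 T) := by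
    rw [uIcc_of_le hT]
    refine IntegrableOn.continuousOn_mul (by fun_prop) ?_ isCompact_Icc
    rwa [integrableOn_Icc_iff_integrableOn_Ioc]
  have h2 := intervalIntegral.continuousOn_primitive_interval h1
  rw [uIcc_of_le hT] at h2
  refine ContinuousOn.congr (f := fun t => ((Real.exp (-(t * l)) : ℝ) : ℂ) *
      ∫ s in (0 : ℝ)..t, ((Real.exp (s * l) : ℝ) : ℂ) * F s) ?_ fun t _ => heatInt_eq_mul F l t
  exact ContinuousOn.mul (by fun_prop) h2

lemma heatInt_sub {F G : ℝ → ℂ} {l t T : ℝ} (ht : 0 ≤ t) (htT : t ≤ T)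
    (hF : IntegrableOn F (Ioc 0 T)) (hG : IntegrableOn G (Ioc 0 T)) :
    heatInt (fun s => F s - G s) l t = heatInt F l t - heatInt G l t := by
  have h : ∀ {F : ℝ → ℂ}, IntegrableOn F (Ioc 0 T) → IntervalIntegrable
      (fun s => ((Real.exp (-(t - s) * l) : ℝ) : ℂ) * F s) volume 0 t := by
    intro F hF
    refine IntervalIntegrable.continuousOn_mul ?_ (by fun_prop)
    rw [intervalIntegrable_iff_integrableOn_Ioc_of_le ht]
    exact hF.mono_set (Ioc_subset_Ioc_right htT)
  simp only [heatInt]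
  rw [← intervalIntegral.integral_sub (h hF) (h hG)]
  simp only [mul_sub]

/-- The Duhamel integral solves `z' = F - l z`, in integrated form. -/
lemma heatInt_eq_integral {F : ℝ → ℂ} {l t : ℝ} (ht : 0 ≤ t) (hF : IntegrableOn F (Ioc 0 t)) :
    heatInt F l t = ∫ s in (0 : ℝ)..t, (F s - l * heatInt F l s) := by
  have hFi : IntervalIntegrable F volume 0 t :=
    (intervalIntegrable_iff_integrableOn_Ioc_of_le ht).2 hF
  have hDi : IntervalIntegrable (fun s => (l : ℂ) * heatInt F l s) volume 0 t := by
    refine ContinuousOn.intervalIntegrable ?_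
    rw [uIcc_of_le ht]
    exact continuousOn_const.mul (continuousOn_heatInt ht hF)
  have key : ∫ r in (0 : ℝ)..t, (l : ℂ) * heatInt F l r =
      ∫ s in (0 : ℝ)..t, (1 - ((Real.exp (-(t - s) * l) : ℝ) : ℂ)) * F s := by
    set K : ℝ → ℝ → ℂ := fun r s => (Iic r).indicator
      (fun s => (l : ℂ) * ((Real.exp (-(r - s) * l) : ℝ) : ℂ)) s with hK
    have e1 : ∀ r ∈ Ioc 0 t, (l : ℂ) * heatInt F l r = ∫ s in Ioc 0 t, K r s * F s := by
      intro r hr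
      have : ∀ s, K r s * F s = (Iic r).indicator
          (fun s => (l : ℂ) * (((Real.exp (-(r - s) * l) : ℝ) : ℂ) * F s)) s := by
        intro s; simp only [hK, indicator_apply]; split_ifs <;> ring
      simp only [this]
      rw [setIntegral_indicator measurableSet_Iic, Ioc_inter_Iic, min_eq_right hr.2,
        integral_const_mul, heatInt, intervalIntegral.integral_of_le hr.1.le]
    have hmeasK : Measurable (Function.uncurry K) := by
      have : Function.uncurry K = {p : ℝ × ℝ | p.2 ≤ p.1}.indicator
          (fun p => (l : ℂ) * ((Real.exp (-(p.1 - p.2) * l) : ℝ) : ℂ)) := by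
        ext ⟨r, s⟩; simp [hK, indicator_apply]
      rw [this]
      exact Measurable.indicator (by fun_prop) (measurableSet_le measurable_snd measurable_fst)
    have hint : Integrable (Function.uncurry fun r s => K r s * F s)
        ((volume.restrict (Ioc 0 t)).prod (volume.restrict (Ioc 0 t))) := by
      have hb := (Integrable.comp_snd hF (volume.restrict (Ioc 0 t))).norm.const_mul
        (|l| * Real.exp (t * |l|))
      refine hb.mono' (hmeasK.aestronglyMeasurable.mul hF.aestronglyMeasurable.comp_snd) ?_
      have hae : ∀ᵐ p : ℝ × ℝ ∂(volume.restrict (Ioc 0 t)).prod (volume.restrict (Ioc 0 t)),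
          p ∈ Ioc 0 t ×ˢ Ioc 0 t := by
        rw [Measure.prod_restrict]
        exact ae_restrict_mem (measurableSet_Ioc.prod measurableSet_Ioc)
      filter_upwards [hae] with p hp
      simp only [Function.uncurry, norm_mul]
      refine mul_le_mul_of_nonneg_right ?_ (norm_nonneg _)
      simp only [hK, indicator_apply]
      split_ifs with h
      · rw [norm_mul, Complex.norm_real, Complex.norm_real, Real.norm_eq_abs,
          Real.norm_of_nonneg (Real.exp_pos _).le]
        refine mul_le_mul_of_nonneg_left (Real.exp_le_exp.2 ?_) (abs_nonneg l)
        have h1 : p.1 - p.2 ≤ t := by linarith [hp.1.2, hp.2.1]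
        have h2 : 0 ≤ p.1 - p.2 := sub_nonneg.2 h
        calc -(p.1 - p.2) * l ≤ (p.1 - p.2) * |l| := by nlinarith [neg_abs_le l]
          _ ≤ _ := mul_le_mul_of_nonneg_right h1 (abs_nonneg l)
      · rw [norm_zero]; positivity
    rw [intervalIntegral.integral_of_le ht, intervalIntegral.integral_of_le ht,
      setIntegral_congr_fun measurableSet_Ioc e1, integral_integral_swap hint]
    refine setIntegral_congr_fun measurableSet_Ioc fun s hs => ?_
    simp only [integral_mul_const]
    congr 1
    have e2 : ∀ r ∈ Ioc 0 t, K r s = (Ici s).indicator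
        (fun r => (l : ℂ) * ((Real.exp (-(r - s) * l) : ℝ) : ℂ)) r := by
      intro r _; simp [hK, indicator_apply]
    rw [setIntegral_congr_fun measurableSet_Ioc e2, setIntegral_indicator measurableSet_Ici]
    have e3 : (Ioc 0 t ∩ Ici s : Set ℝ) = Icc s t := by
      ext x; simp only [mem_inter_iff, mem_Ioc, mem_Ici, mem_Icc]
      exact ⟨fun h => ⟨h.2, h.1.2⟩, fun h => ⟨⟨hs.1.trans_le h.1, h.2⟩, h.1⟩⟩
    rw [e3, integral_Icc_eq_integral_Ioc, ← intervalIntegral.integral_of_le hs.2]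
    have hd : ∀ r ∈ uIcc s t, HasDerivAt (fun r : ℝ => -((Real.exp (-(r - s) * l) : ℝ) : ℂ))
        ((l : ℂ) * ((Real.exp (-(r - s) * l) : ℝ) : ℂ)) r := by
      intro r _
      have h1 : HasDerivAt (fun r : ℝ => -(r - s) * l) (-l) r := by
        simpa using (((hasDerivAt_id r).sub_const s).neg.mul_const l)
      have h2 := (h1.exp.ofReal_comp).neg
      refine h2.congr_deriv ?_
      push_cast; ring
    rw [intervalIntegral.integral_eq_sub_of_hasDerivAt hd
      ((by fun_prop : Continuous _).intervalIntegrable _ _)]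
    simp only [sub_self, neg_zero, zero_mul, Real.exp_zero, Complex.ofReal_one]
    ring
  have hEi : IntervalIntegrable (fun s => ((Real.exp (-(t - s) * l) : ℝ) : ℂ) * F s) volume 0 t :=
    hFi.continuousOn_mul (by fun_prop)
  rw [intervalIntegral.integral_sub hFi hDi, key, heatInt, eq_sub_iff_add_eq]
  simp only [sub_mul, one_mul]
  rw [intervalIntegral.integral_sub hFi hEi]
  ring

/-- The linear integral equation `w(t) = c ∫₀ᵗ w` has only the zero solution. -/
lemma eq_zero_of_eq_mul_integral {w : ℝ → ℂ} {c : ℂ} {T : ℝ} (hw : IntegrableOn w (Ioc 0 T))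
    (h : ∀ t ∈ Icc 0 T, w t = c * ∫ s in (0 : ℝ)..t, w s) : ∀ t ∈ Icc 0 T, w t = 0 := by
  intro t ht
  have hT : 0 ≤ T := ht.1.trans ht.2
  have hc : ContinuousOn w (Icc 0 T) := by
    have h1 := intervalIntegral.continuousOn_primitive_interval (f := w) (a := 0) (b := T)
      (μ := volume) (by rw [uIcc_of_le hT, integrableOn_Icc_iff_integrableOn_Ioc]; exact hw)
    rw [uIcc_of_le hT] at h1
    exact (continuousOn_const.mul h1).congr h
  have hW : Continuous (IccExtend hT ((Icc 0 T).domRestrict w)) := hc.domRestrict.Icc_extend'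
  set W := IccExtend hT ((Icc 0 T).domRestrict w) with hWdef
  have hWw : ∀ x ∈ Icc 0 T, W x = w x := fun x hx => IccExtend_of_mem hT _ hx
  have hv : ∀ x ∈ Icc 0 T, w x = c * ∫ s in (0 : ℝ)..x, W s := by
    intro x hx
    rw [h x hx]
    congr 1
    refine intervalIntegral.integral_congr fun s hs => (hWw s ?_).symm
    rw [uIcc_of_le hx.1] at hs
    exact ⟨hs.1, hs.2.trans hx.2⟩
  have hd : ∀ x, HasDerivAt (fun x => ∫ s in (0 : ℝ)..x, W s) (W x) x :=
    fun x => (hW.integral_hasStrictDerivAt 0 x).hasDerivAt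
  have h0 := eq_zero_of_abs_deriv_le_mul_abs_self_of_eq_zero_right (K := ‖c‖)
    (f := fun x => ∫ s in (0 : ℝ)..x, W s) (f' := W) (a := 0) (b := T)
    (fun x _ => (hd x).continuousAt.continuousWithinAt) (fun x _ => (hd x).hasDerivWithinAt)
    (by simp) (fun x hx => by
      rw [hWw x ⟨hx.1, hx.2.le⟩, hv x ⟨hx.1, hx.2.le⟩, norm_mul]) t ht
  rw [hv t ht, h0, mul_zero]

lemma eq_neg_heatInt {F z : ℝ → ℂ} {l T : ℝ} (hF : IntegrableOn F (Ioc 0 T))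
    (hz : IntegrableOn z (Ioc 0 T))
    (h : ∀ t ∈ Icc 0 T, z t = ∫ s in (0 : ℝ)..t, (-(l : ℂ) * z s - F s)) :
    ∀ t ∈ Icc 0 T, z t = -heatInt F l t := by
  intro t ht
  have hT : 0 ≤ T := ht.1.trans ht.2
  have hD : IntegrableOn (heatInt F l) (Ioc 0 T) :=
    ((continuousOn_heatInt hT hF).integrableOn_Icc).mono_set Ioc_subset_Icc_self
  have h0 := eq_zero_of_eq_mul_integral (w := fun t => z t + heatInt F l t) (c := -(l : ℂ))
    (hz.add hD) (fun t ht => by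
      have hi : ∀ {f : ℝ → ℂ}, IntegrableOn f (Ioc 0 T) → IntervalIntegrable f volume 0 t :=
        fun hf => (intervalIntegrable_iff_integrableOn_Ioc_of_le ht.1).2
          (hf.mono_set (Ioc_subset_Ioc_right ht.2))
      rw [h t ht, heatInt_eq_integral ht.1 (hF.mono_set (Ioc_subset_Ioc_right ht.2)),
        ← intervalIntegral.integral_const_mul,
        ← intervalIntegral.integral_add (((hi hz).const_mul _).sub (hi hF))
          ((hi hF).sub ((hi hD).const_mul _))]
      congr 1; ext s; ring) t ht
  exact eq_neg_of_add_eq_zero_left h0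

/-! ### The fixed point in `L²(0,T; H¹)` for a small velocity -/

/-- The constant in the smallness condition: it turns the product estimate and Young's inequality
into a contraction with factor `1/8` for squared norms. It is `8` times the constant `1596π` of the
product estimate times `2 · 8π³`, from `1 + |k|² ≤ 2|k|²` and the normalization of the norms. -/
noncomputable def smallConst : ℝ := 204288 * Real.pi ^ 4

lemma smallConst_pos : 0 < smallConst := by unfold smallConst; have := Real.pi_pos; positivity

lemma one_le_smallConst : 1 ≤ smallConst := by
  have : 1 ≤ Real.pi ^ 4 := one_le_pow₀ (by linarith [Real.pi_gt_three])
  unfold smallConst; linarith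

/-- The squared norm in `L²(0,T; H¹)`. -/
noncomputable def energy (T : ℝ) (η : ℝ → Wave → ℂ) : ENNReal := ∫⁻ t in Ioc (0 : ℝ) T, h1Sq (η t)

lemma h1Sq_eq (θ : Wave → ℂ) :
    h1Sq θ = ∑' k : Wave, ENNReal.ofReal (8 * Real.pi ^ 3 * (1 + wnorm k ^ 2)) * ‖θ k‖ₑ ^ 2 := by
  refine tsum_congr fun k => ?_
  have := Real.pi_pos
  rw [ENNReal.ofReal_mul (by positivity), ← ofReal_norm, ENNReal.ofReal_pow (norm_nonneg _)]

lemma enorm_sq_le_h1Sq (θ : Wave → ℂ) (k : Wave) : ‖θ k‖ₑ ^ 2 ≤ h1Sq θ := by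
  rw [h1Sq_eq]
  refine le_trans ?_ (ENNReal.le_tsum k)
  refine le_mul_of_one_le_left zero_le ?_
  rw [← ENNReal.ofReal_one]
  refine ENNReal.ofReal_le_ofReal ?_
  nlinarith [one_le_eight_pi_cubed, sq_nonneg (wnorm k)]

lemma h1Sq_neg (θ : Wave → ℂ) : h1Sq (fun k => -θ k) = h1Sq θ := by simp [h1Sq]

lemma h1Sq_sub_le (θ η : Wave → ℂ) : h1Sq (fun k => θ k - η k) ≤ 4 * (h1Sq θ + h1Sq η) := by
  simp only [h1Sq_eq]
  rw [← ENNReal.tsum_add, ← ENNReal.tsum_mul_left]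
  refine ENNReal.tsum_le_tsum fun k => ?_
  calc _ ≤ ENNReal.ofReal (8 * Real.pi ^ 3 * (1 + wnorm k ^ 2)) * (4 * (‖θ k‖ₑ ^ 2 + ‖η k‖ₑ ^ 2)) := by
        refine mul_le_mul_right ?_ _
        exact (pow_le_pow_left' enorm_sub_le 2).trans (ennreal_add_sq_le _ _)
    _ = _ := by ring

lemma aemeasurable_h1Sq {T : ℝ} {η : ℝ → Wave → ℂ}
    (h : ∀ k, AEMeasurable (fun t => η t k) (volume.restrict (Ioc (0 : ℝ) T))) :
    AEMeasurable (fun t => h1Sq (η t)) (volume.restrict (Ioc (0 : ℝ) T)) := by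
  simp only [h1Sq_eq]
  exact AEMeasurable.tsum fun k => ((h k).enorm.pow_const 2).const_mul _

lemma energy_sub_le {T : ℝ} {θ η : ℝ → Wave → ℂ}
    (h : ∀ k, AEMeasurable (fun t => θ t k) (volume.restrict (Ioc (0 : ℝ) T))) :
    energy T (fun t k => θ t k - η t k) ≤ 4 * (energy T θ + energy T η) := by
  simp only [energy]
  rw [← lintegral_add_left' (aemeasurable_h1Sq h), ← lintegral_const_mul' _ _ (by norm_num)]
  exact lintegral_mono fun t => h1Sq_sub_le _ _

lemma MemL2H1.sub {T : ℝ} {θ η : ℝ → Wave → ℂ} (h1 : MemL2H1 T θ) (h2 : MemL2H1 T η) :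
    MemL2H1 T (fun t k => θ t k - η t k) := by
  refine ⟨fun k => (h1.1 k).sub (h2.1 k), (energy_sub_le h1.1).trans_lt ?_⟩
  exact ENNReal.mul_lt_top (by norm_num) (ENNReal.add_lt_top.2 ⟨h1.2, h2.2⟩)

lemma MemL2H1.neg {T : ℝ} {θ : ℝ → Wave → ℂ} (h1 : MemL2H1 T θ) :
    MemL2H1 T (fun t k => -θ t k) := by
  refine ⟨fun k => (h1.1 k).neg, ?_⟩
  simp only [h1Sq_neg]; exact h1.2

lemma memL2H1_const {T : ℝ} {G : Wave → ℂ} (hG : h1Sq G ≠ ⊤) : MemL2H1 T (fun _ => G) := by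
  refine ⟨fun k => aemeasurable_const, ?_⟩
  rw [setLIntegral_const]
  exact ENNReal.mul_lt_top hG.lt_top (by simp)

lemma integrableOn_of_lintegral_enorm_sq {F : ℝ → ℂ} {T : ℝ}
    (hF : AEMeasurable F (volume.restrict (Ioc 0 T)))
    (h : ∫⁻ s in Ioc 0 T, ‖F s‖ₑ ^ 2 < ⊤) : IntegrableOn F (Ioc 0 T) := by
  refine ⟨hF.aestronglyMeasurable, ?_⟩
  have h1 := lintegral_mul_sq_le (volume.restrict (Ioc 0 T)) (f := fun _ => 1)
    aemeasurable_const hF.enorm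
  simp only [one_mul] at h1
  rw [hasFiniteIntegral_iff_enorm]
  by_contra h2
  rw [not_lt, top_le_iff] at h2
  rw [h2] at h1
  refine (ENNReal.mul_lt_top (?_ : ∫⁻ _ in Ioc 0 T, 1 ^ 2 < ⊤) h).ne (top_le_iff.1 (by simpa using h1))
  simp

lemma MemL2H1.integrableOn {T : ℝ} {θ : ℝ → Wave → ℂ} (h : MemL2H1 T θ) (k : Wave) :
    IntegrableOn (fun t => θ t k) (Ioc 0 T) :=
  integrableOn_of_lintegral_enorm_sq (h.1 k)
    ((lintegral_mono fun t => enorm_sq_le_h1Sq (θ t) k).trans_lt h.2)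

/-- A measurable, divergence-free and small velocity field. -/
structure SmallVelocity (u : ℝ → Wave → Fin 3 → ℂ) : Prop where
  zero : ∀ t, u t 0 = 0
  div : ∀ t m, ∑ i, u t m i * (m i : ℂ) = 0
  meas : ∀ k i, Measurable fun t => u t k i
  small : ∀ᵐ t ∂volume.restrict (Ioi (0 : ℝ)), ENNReal.ofReal smallConst * hHalfSq (u t) ≤ 1

lemma SmallVelocity.hHalfSq_le {u : ℝ → Wave → Fin 3 → ℂ} (hu : SmallVelocity u) (T : ℝ) :
    ∀ᵐ t ∂volume.restrict (Ioc (0 : ℝ) T), hHalfSq (u t) ≤ 1 := by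
  filter_upwards [ae_mono (Measure.restrict_mono Ioc_subset_Ioi_self le_rfl) hu.small] with t ht
  refine le_trans (le_mul_of_one_le_left zero_le ?_) ht
  rw [← ENNReal.ofReal_one]
  exact ENNReal.ofReal_le_ofReal one_le_smallConst

lemma MemL2H1.h1Sq_lt_top {T : ℝ} {η : ℝ → Wave → ℂ} (h : MemL2H1 T η) :
    ∀ᵐ t ∂volume.restrict (Ioc (0 : ℝ) T), h1Sq (η t) ≠ ⊤ :=
  (ae_lt_top' (aemeasurable_h1Sq h.1) h.2.ne).mono fun _ ht => ht.ne

lemma aemeasurable_advect {u : ℝ → Wave → Fin 3 → ℂ} (hu : SmallVelocity u) {T : ℝ}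
    {η : ℝ → Wave → ℂ} (h : MemL2H1 T η) (k : Wave) :
    AEMeasurable (fun s => advect (u s) (η s) k) (volume.restrict (Ioc (0 : ℝ) T)) := by
  refine aemeasurable_of_tendsto_metrizable_ae (atTop : Filter (Finset Wave))
    (f := fun S s => ∑ j ∈ S, advectTerm (u s) (η s) k j) (fun S => ?_) ?_
  · refine Finset.aemeasurable_fun_sum _ fun j _ => ?_
    unfold advectTerm
    refine AEMeasurable.mul (Measurable.aemeasurable ?_) (h.1 j)
    exact measurable_const.mul (Finset.measurable_fun_sum _ fun i _ => (hu.meas _ i).mul_const _)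
  · filter_upwards [hu.hHalfSq_le T, h.h1Sq_lt_top] with s h1 h2
    exact (summable_advectTerm (hu.zero s) (h1.trans_lt ENNReal.one_lt_top).ne h2 k).hasSum

lemma lintegral_enorm_advect_sq_le {u : ℝ → Wave → Fin 3 → ℂ} (hu : SmallVelocity u) {T : ℝ}
    (η : ℝ → Wave → ℂ) (k : Wave) :
    ∫⁻ s in Ioc 0 T, ‖advect (u s) (η s) k‖ₑ ^ 2 ≤ energy T η := by
  refine lintegral_mono_ae ?_
  filter_upwards [hu.hHalfSq_le T] with s hs
  exact (enorm_advect_sq_le (hu.zero s) (η s) k).trans (mul_le_of_le_one_left zero_le hs)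

lemma integrableOn_advect {u : ℝ → Wave → Fin 3 → ℂ} (hu : SmallVelocity u) {T : ℝ}
    {η : ℝ → Wave → ℂ} (h : MemL2H1 T η) (k : Wave) :
    IntegrableOn (fun s => advect (u s) (η s) k) (Ioc (0 : ℝ) T) :=
  integrableOn_of_lintegral_enorm_sq (aemeasurable_advect hu h k)
    ((lintegral_enorm_advect_sq_le hu η k).trans_lt h.2)

/-- The solution operator `η ↦ ∫₀ᵗ e^{(t-s)Δ} [u(s)·∇η(s)] ds`. -/
noncomputable def transport (u : ℝ → Wave → Fin 3 → ℂ) (η : ℝ → Wave → ℂ) : ℝ → Wave → ℂ :=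
  duhamel fun s => advect (u s) (η s)

lemma transport_apply (u : ℝ → Wave → Fin 3 → ℂ) (η : ℝ → Wave → ℂ) (t : ℝ) (k : Wave) :
    transport u η t k = heatInt (fun s => advect (u s) (η s) k) (wnorm k ^ 2) t := rfl

lemma aemeasurable_transport {u : ℝ → Wave → Fin 3 → ℂ} (hu : SmallVelocity u) {T : ℝ} (hT : 0 ≤ T)
    {η : ℝ → Wave → ℂ} (h : MemL2H1 T η) (k : Wave) :
    AEMeasurable (fun t => transport u η t k) (volume.restrict (Ioc (0 : ℝ) T)) :=
  ((continuousOn_heatInt hT (integrableOn_advect hu h k)).mono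
    Ioc_subset_Icc_self).aemeasurable measurableSet_Ioc

/-- The solution operator contracts `L²(0,T; H¹)`, for every `T`. -/
lemma energy_transport_le {u : ℝ → Wave → Fin 3 → ℂ} (hu : SmallVelocity u) {T : ℝ} (hT : 0 ≤ T)
    {η : ℝ → Wave → ℂ} (h : MemL2H1 T η) :
    8 * energy T (transport u η) ≤ energy T η := by
  have hpi := Real.pi_pos
  have hmode : ∀ k, ENNReal.ofReal (8 * Real.pi ^ 3 * (1 + wnorm k ^ 2)) *
      ∫⁻ t in Ioc 0 T, ‖transport u η t k‖ₑ ^ 2 ≤ ENNReal.ofReal (16 * Real.pi ^ 3) *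
      ∫⁻ s in Ioc 0 T, ENNReal.ofReal (wnorm k ^ 2)⁻¹ * ‖advect (u s) (η s) k‖ₑ ^ 2 := by
    intro k
    rcases eq_or_ne k 0 with rfl | hk
    · have : ∀ t, transport u η t 0 = 0 := fun t => by
        simp only [transport_apply, heatInt, advect_apply_zero (hu.div _), mul_zero,
          intervalIntegral.integral_zero]
      simp [this]
    · have hk1 := one_le_wnorm_sq hk
      have hk0 : 0 < wnorm k ^ 2 := by linarith
      refine (mul_le_mul_right (lintegral_enorm_heatInt_sq_le hk0
        (aemeasurable_advect hu h k)) (ENNReal.ofReal (8 * Real.pi ^ 3 * (1 + wnorm k ^ 2)))).trans ?_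
      · rw [lintegral_const_mul' _ _ ENNReal.ofReal_ne_top, ← mul_assoc, ← mul_assoc,
          ← ENNReal.ofReal_pow (by positivity), ← ENNReal.ofReal_mul (by positivity),
          ← ENNReal.ofReal_mul (by positivity)]
        refine mul_le_mul_left (ENNReal.ofReal_le_ofReal ?_) _
        have e : 8 * Real.pi ^ 3 * (1 + wnorm k ^ 2) * (wnorm k ^ 2)⁻¹ ^ 2 =
          8 * Real.pi ^ 3 * ((1 + wnorm k ^ 2) * (wnorm k ^ 2)⁻¹) * (wnorm k ^ 2)⁻¹ := by ring
        rw [e]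
        refine mul_le_mul_of_nonneg_right ?_ (by positivity)
        have : (1 + wnorm k ^ 2) * (wnorm k ^ 2)⁻¹ ≤ 2 := by
          rw [← div_eq_mul_inv, div_le_iff₀ hk0]; linarith
        have h8 : 0 ≤ 8 * Real.pi ^ 3 := by positivity
        nlinarith
  have hsum : energy T (transport u η) ≤ ENNReal.ofReal (16 * Real.pi ^ 3) *
      ∫⁻ s in Ioc 0 T, ENNReal.ofReal (1596 * Real.pi) * (hHalfSq (u s) * h1Sq (η s)) := by
    simp only [energy, h1Sq_eq (transport u η _)]
    rw [lintegral_tsum fun k =>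
      ((aemeasurable_transport hu hT h k).enorm.pow_const 2).const_mul _]
    calc _ = ∑' k, ENNReal.ofReal (8 * Real.pi ^ 3 * (1 + wnorm k ^ 2)) *
          ∫⁻ t in Ioc 0 T, ‖transport u η t k‖ₑ ^ 2 :=
          tsum_congr fun k => lintegral_const_mul' _ _ ENNReal.ofReal_ne_top
      _ ≤ _ := ENNReal.tsum_le_tsum hmode
      _ ≤ _ := by
          rw [ENNReal.tsum_mul_left, ← lintegral_tsum fun k =>
            ((aemeasurable_advect hu h k).enorm.pow_const 2).const_mul _]
          gcongr with s
          exact tsum_enorm_advect_sq_le (hu.zero s) (η s)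
  calc _ ≤ 8 * (ENNReal.ofReal (16 * Real.pi ^ 3) *
      ∫⁻ s in Ioc 0 T, ENNReal.ofReal (1596 * Real.pi) * (hHalfSq (u s) * h1Sq (η s))) :=
        mul_le_mul_right hsum _
    _ = ∫⁻ s in Ioc 0 T, ENNReal.ofReal smallConst * hHalfSq (u s) * h1Sq (η s) := by
        rw [← mul_assoc, ← lintegral_const_mul' _ _ (ENNReal.mul_ne_top (by norm_num)
          ENNReal.ofReal_ne_top)]
        congr 1; ext s
        rw [← mul_assoc, ← mul_assoc]
        congr 2
        rw [show (8 : ENNReal) = ENNReal.ofReal 8 by simp, ← ENNReal.ofReal_mul (by norm_num),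
          ← ENNReal.ofReal_mul (by positivity), smallConst]
        congr 1; ring
    _ ≤ _ := by
        refine lintegral_mono_ae ?_
        filter_upwards [ae_mono (Measure.restrict_mono Ioc_subset_Ioi_self le_rfl) hu.small]
          with s hs
        exact mul_le_of_le_one_left zero_le hs

lemma memL2H1_transport {u : ℝ → Wave → Fin 3 → ℂ} (hu : SmallVelocity u) {T : ℝ} (hT : 0 ≤ T)
    {η : ℝ → Wave → ℂ} (h : MemL2H1 T η) : MemL2H1 T (transport u η) := by
  refine ⟨aemeasurable_transport hu hT h, lt_of_le_of_lt ?_ h.2⟩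
  exact le_trans (le_mul_of_one_le_left zero_le (by norm_num)) (energy_transport_le hu hT h)

lemma enorm_transport_sq_le {u : ℝ → Wave → Fin 3 → ℂ} (hu : SmallVelocity u) {t T : ℝ}
    (ht : 0 ≤ t) (htT : t ≤ T) {η : ℝ → Wave → ℂ} (h : MemL2H1 T η) (k : Wave) :
    ‖transport u η t k‖ₑ ^ 2 ≤ ENNReal.ofReal T * energy T η :=
  (enorm_heatInt_sq_le_of_le (sq_nonneg _) ht htT (aemeasurable_advect hu h k)).trans
    (mul_le_mul_right (lintegral_enorm_advect_sq_le hu η k) _)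

lemma heatInt_congr_ae {F F' : ℝ → ℂ} {l t T : ℝ} (ht : 0 ≤ t) (htT : t ≤ T)
    (h : ∀ᵐ s ∂volume.restrict (Ioc 0 T), F s = F' s) : heatInt F l t = heatInt F' l t := by
  simp only [heatInt, intervalIntegral.integral_of_le ht]
  refine integral_congr_ae ?_
  filter_upwards [ae_mono (Measure.restrict_mono (Ioc_subset_Ioc_right htT) le_rfl) h] with s hs
  rw [hs]

lemma transport_sub {u : ℝ → Wave → Fin 3 → ℂ} (hu : SmallVelocity u) {t T : ℝ}
    (ht : 0 ≤ t) (htT : t ≤ T) {θ η : ℝ → Wave → ℂ} (h1 : MemL2H1 T θ) (h2 : MemL2H1 T η)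
    (k : Wave) : transport u (fun t k => θ t k - η t k) t k =
      transport u θ t k - transport u η t k := by
  simp only [transport_apply]
  rw [← heatInt_sub ht htT (integrableOn_advect hu h1 k) (integrableOn_advect hu h2 k)]
  refine heatInt_congr_ae ht htT ?_
  filter_upwards [hu.hHalfSq_le T, h1.h1Sq_lt_top, h2.h1Sq_lt_top] with s hs h3 h4
  exact advect_sub (hu.zero s) (hs.trans_lt ENNReal.one_lt_top).ne h3 h4 k

lemma transport_neg (u : ℝ → Wave → Fin 3 → ℂ) (θ : ℝ → Wave → ℂ) (t : ℝ) (k : Wave) :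
    transport u (fun t k => -θ t k) t k = -transport u θ t k := by
  simp only [transport_apply, advect_neg, heatInt, mul_neg, intervalIntegral.integral_neg]

lemma iter_succ_eq (u : ℝ → Wave → Fin 3 → ℂ) (G : Wave → ℂ) (m : ℕ) (t : ℝ) (k : Wave) :
    iter u G (m + 1) t k = -G k - transport u (iter u G m) t k := rfl

lemma memL2H1_iter {u : ℝ → Wave → Fin 3 → ℂ} (hu : SmallVelocity u) {G : Wave → ℂ}
    (hG : h1Sq G ≠ ⊤) {T : ℝ} (hT : 0 ≤ T) (m : ℕ) : MemL2H1 T (iter u G m) := by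
  induction m with
  | zero => exact (memL2H1_const hG).neg
  | succ m ih => exact (memL2H1_const hG).neg.sub (memL2H1_transport hu hT ih)

/-- A mild solution of the transport--diffusion equation, as a fixed point of the iteration. -/
def IsMild (u : ℝ → Wave → Fin 3 → ℂ) (G : Wave → ℂ) (θ : ℝ → Wave → ℂ) : Prop :=
  (∀ T, 0 < T → MemL2H1 T θ) ∧ ∀ t, 0 ≤ t → ∀ k, θ t k = -G k - transport u θ t k

lemma isSolution_iff_isMild {u : ℝ → Wave → Fin 3 → ℂ} (hu : SmallVelocity u) {G : Wave → ℂ}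
    {θ : ℝ → Wave → ℂ} : IsSolution u G θ ↔ IsMild u G θ := by
  refine and_congr_right fun hmem => ⟨fun h t ht k => ?_, fun h t ht k => ?_⟩
  · have hT : 0 < max t 1 := lt_max_of_lt_right one_pos
    have hθ := hmem _ hT
    have h1 := eq_neg_heatInt (z := fun s => θ s k + G k) (l := wnorm k ^ 2)
      (integrableOn_advect hu hθ k)
      ((hθ.integrableOn k).add (integrableOn_const (by simp))) (fun s hs => by
        rw [h s hs.1 k, neg_add_cancel_comm]
        congr 1; ext r; ring) t ⟨ht, le_max_left _ _⟩
    rw [transport_apply, sub_eq_add_neg, ← h1]; ring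
  · have h1 : IntegrableOn (fun s => advect (u s) (θ s) k) (Ioc 0 t) :=
      (integrableOn_advect hu (hmem (max t 1) (lt_max_of_lt_right one_pos)) k).mono_set
        (Ioc_subset_Ioc_right (le_max_left _ _))
    rw [h t ht k, transport_apply, heatInt_eq_integral ht h1, sub_eq_add_neg,
      ← intervalIntegral.integral_neg]
    congr 1
    refine intervalIntegral.integral_congr fun s hs => ?_
    rw [uIcc_of_le ht] at hs
    have h2 := h s hs.1 k
    rw [transport_apply] at h2
    simp only [h2]
    ring

lemma IsMild.unique {u : ℝ → Wave → Fin 3 → ℂ} (hu : SmallVelocity u) {G : Wave → ℂ}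
    {θ η : ℝ → Wave → ℂ} (hθ : IsMild u G θ) (hη : IsMild u G η) :
    ∀ t, 0 ≤ t → η t = θ t := by
  intro t ht
  set T := max t 1
  have hT : 0 < T := lt_max_of_lt_right one_pos
  have h1 := hθ.1 T hT
  have h2 := hη.1 T hT
  have hd := h2.sub h1
  have hfix : ∀ s, 0 ≤ s → s ≤ T → ∀ k, η s k - θ s k =
      -transport u (fun s k => η s k - θ s k) s k := by
    intro s hs hsT k
    rw [transport_sub hu hs hsT h2 h1, hθ.2 s hs k, hη.2 s hs k]; ring
  have he : energy T (fun s k => η s k - θ s k) =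
      energy T (transport u (fun s k => η s k - θ s k)) := by
    refine lintegral_congr_ae ?_
    filter_upwards [ae_restrict_mem measurableSet_Ioc] with s hs
    rw [← h1Sq_neg (transport u _ s)]
    congr 1; ext k
    exact hfix s hs.1.le hs.2 k
  have h8 := energy_transport_le hu hT.le hd
  rw [← he] at h8
  have h0 : energy T (fun s k => η s k - θ s k) = 0 := by
    by_contra hne
    have hlt := ENNReal.mul_lt_mul_left hne hd.2.ne (by norm_num : (1 : ENNReal) < 8)
    rw [one_mul] at hlt
    exact absurd h8 (not_le.2 hlt)
  ext k
  have h3 := enorm_transport_sq_le hu ht (le_max_left t 1) hd k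
  rw [h0, mul_zero, ← neg_eq_iff_eq_neg.2 (hfix t ht (le_max_left _ _) k)] at h3
  exact (sub_eq_zero.1 (by simpa using h3)).symm

lemma h1Sq_le_of_tendsto {θ : ℕ → Wave → ℂ} {η : Wave → ℂ}
    (h : ∀ k, Tendsto (fun p => θ p k) atTop (𝓝 (η k))) :
    h1Sq η ≤ liminf (fun p => h1Sq (θ p)) atTop := by
  let _ : MeasurableSpace Wave := ⊤
  simp only [h1Sq, ← lintegral_count]
  refine le_trans (le_of_eq ?_) (lintegral_liminf_le' fun p => measurable_from_top.aemeasurable)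
  refine lintegral_congr fun k => ?_
  refine (Tendsto.liminf_eq ?_).symm
  refine (ENNReal.continuous_ofReal.tendsto _).comp ?_
  exact ((h k).norm.pow 2).const_mul _

/-- Existence: the iterates converge in `L²(0,T; H¹)` for every `T`, to a mild solution. -/
lemma exists_isMild {u : ℝ → Wave → Fin 3 → ℂ} (hu : SmallVelocity u) {G : Wave → ℂ}
    (hG : h1Sq G ≠ ⊤) : ∃ θ, IsMild u G θ ∧
      ∀ T, 0 < T → Tendsto (fun m => distL2H1Sq T (iter u G m) θ) atTop (𝓝 0) := by
  have hit : ∀ {T}, 0 ≤ T → ∀ m, MemL2H1 T (iter u G m) := fun hT m => memL2H1_iter hu hG hT m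
  have hsucc : ∀ {T}, 0 ≤ T → ∀ m l t, t ∈ Icc 0 T → ∀ k,
      iter u G (m + 1) t k - iter u G (l + 1) t k =
        -transport u (fun t k => iter u G m t k - iter u G l t k) t k := by
    intro T hT m l t ht k
    rw [iter_succ_eq, iter_succ_eq, transport_sub hu ht.1 ht.2 (hit hT m) (hit hT l)]; ring
  have hstep : ∀ {T}, 0 ≤ T → ∀ m l, 8 * energy T (fun t k => iter u G (m + 1) t k - iter u G (l + 1) t k) ≤
      energy T (fun t k => iter u G m t k - iter u G l t k) := by
    intro T hT m l
    refine le_trans (le_of_eq ?_) (energy_transport_le hu hT ((hit hT m).sub (hit hT l)))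
    congr 1
    refine lintegral_congr_ae ?_
    filter_upwards [ae_restrict_mem measurableSet_Ioc] with t ht
    rw [← h1Sq_neg (transport u _ t)]
    congr 1; ext k
    exact hsucc hT m l t ⟨ht.1.le, ht.2⟩ k
  -- the iterates stay in a ball around the first one
  have hball : ∀ {T}, 0 ≤ T → ∀ p, energy T (fun t k => iter u G 0 t k - iter u G p t k) ≤
      energy T (fun _ => G) := by
    intro T hT p
    induction p with
    | zero =>
      refine le_trans (le_of_eq ?_) zero_le
      simp [energy, h1Sq]
    | succ p ih =>
      have e : energy T (fun t k => iter u G 0 t k - iter u G (p + 1) t k) =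
          energy T (transport u (iter u G p)) := by
        refine lintegral_congr fun t => ?_
        congr 1; ext k
        change -G k - (-G k - transport u (iter u G p) t k) = _
        ring
      rw [e]
      have h1 := energy_transport_le hu hT (hit hT p)
      have h2 : energy T (iter u G p) ≤ 8 * energy T (fun _ => G) := by
        have h3 := energy_sub_le (T := T) (θ := iter u G 0)
          (η := fun t k => iter u G 0 t k - iter u G p t k) (hit hT 0).1
        have e1 : energy T (iter u G 0) = energy T (fun _ => G) := by
          simp only [energy, iter, h1Sq_neg]
        simp only [sub_sub_cancel] at h3
        calc _ ≤ 4 * (energy T (iter u G 0) + energy T (fun t k => iter u G 0 t k - iter u G p t k)) := h3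
          _ ≤ 4 * (energy T (fun _ => G) + energy T (fun _ => G)) := by
            rw [e1]; exact mul_le_mul_right (add_le_add le_rfl ih) _
          _ = _ := by ring
      have h4 := h1.trans h2
      exact (ENNReal.mul_le_mul_iff_right (by norm_num) (by norm_num)).1 h4
  have hcauchy : ∀ {T}, 0 ≤ T → ∀ m p, energy T (fun t k => iter u G m t k - iter u G (m + p) t k) ≤
      (8⁻¹ : ENNReal) ^ m * energy T (fun _ => G) := by
    intro T hT m p
    induction m with
    | zero => simpa using hball hT p
    | succ m ih =>
      have h1 := (hstep hT m (m + p)).trans ih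
      rw [show m + 1 + p = m + p + 1 by ring, pow_succ', mul_assoc, mul_comm 8⁻¹,
        ← div_eq_mul_inv, ENNReal.le_div_iff_mul_le (by simp) (by simp), mul_comm]
      exact h1
  have hgeom : ∀ {T} (C : ENNReal), C ≠ ⊤ → Tendsto (fun m => C * ((8⁻¹ : ENNReal) ^ m *
      energy T (fun _ => G))) atTop (𝓝 0) := by
    intro T C hC
    have h1 : Tendsto (fun m => (8⁻¹ : ENNReal) ^ m) atTop (𝓝 0) :=
      ENNReal.tendsto_pow_atTop_nhds_zero_of_lt_one (by simp)
    have h2 := ENNReal.Tendsto.const_mul (a := C) (ENNReal.Tendsto.mul_const (b := energy T fun _ => G) h1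
      (Or.inr (memL2H1_const hG).2.ne)) (Or.inr hC)
    simpa using h2
  have hptw : ∀ t, 0 ≤ t → ∀ k, ∃ z, Tendsto (fun m => iter u G m t k) atTop (𝓝 z) := by
    intro t ht k
    have hb : ∀ m p, ‖iter u G (m + 1) t k - iter u G (m + 1 + p) t k‖ₑ ^ 2 ≤
        ENNReal.ofReal t * ((8⁻¹ : ENNReal) ^ m * energy t (fun _ => G)) := by
      intro m p
      rw [show m + 1 + p = m + p + 1 by ring, hsucc ht m (m + p) t ⟨ht, le_rfl⟩ k, enorm_neg]
      exact (enorm_transport_sq_le hu ht le_rfl ((hit ht m).sub (hit ht (m + p))) k).trans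
        (mul_le_mul_right (hcauchy ht m p) _)
    refine cauchySeq_tendsto_of_complete ?_
    rw [EMetric.cauchySeq_iff']
    intro ε hε
    have hε2 : 0 < ε ^ 2 := pos_iff_ne_zero.2 (pow_ne_zero 2 hε.ne')
    obtain ⟨m, hm⟩ := ((hgeom (T := t) (ENNReal.ofReal t) ENNReal.ofReal_ne_top).eventually
      (gt_mem_nhds hε2)).exists
    refine ⟨m + 1, fun n hn => ?_⟩
    obtain ⟨p, rfl⟩ := Nat.exists_eq_add_of_le hn
    have h3 := (hb m p).trans_lt hm
    rw [edist_comm, edist_eq_enorm_sub]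
    exact not_le.1 fun h4 => absurd h3 (not_lt.2 (pow_le_pow_left' h4 2))
  choose! θ hθ using hptw
  have hmeas : ∀ T, 0 < T → ∀ k, AEMeasurable (fun t => θ t k) (volume.restrict (Ioc (0 : ℝ) T)) := by
    intro T hT k
    refine aemeasurable_of_tendsto_metrizable_ae atTop (fun m => (hit hT.le m).1 k) ?_
    filter_upwards [ae_restrict_mem measurableSet_Ioc] with t ht
    exact hθ t ht.1.le k
  -- Fatou's lemma bounds the distance of an iterate to the pointwise limit
  have hdist : ∀ T, 0 < T → ∀ m, energy T (fun t k => iter u G m t k - θ t k) ≤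
      (8⁻¹ : ENNReal) ^ m * energy T (fun _ => G) := by
    intro T hT m
    calc _ ≤ ∫⁻ t in Ioc 0 T, liminf (fun p => h1Sq
          (fun k => iter u G m t k - iter u G (m + p) t k)) atTop := by
          refine setLIntegral_mono' measurableSet_Ioc fun t ht => h1Sq_le_of_tendsto fun k => ?_
          exact tendsto_const_nhds.sub ((hθ t ht.1.le k).comp (tendsto_add_atTop_nat m) |>.congr
            fun p => by simp [add_comm])
      _ ≤ _ := lintegral_liminf_le' fun p =>
          aemeasurable_h1Sq ((hit hT.le m).sub (hit hT.le (m + p))).1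
      _ ≤ _ := liminf_le_of_le (by isBoundedDefault) fun b hb => by
          obtain ⟨p, hp⟩ := hb.exists
          exact hp.trans (hcauchy hT.le m p)
  have hmem : ∀ T, 0 < T → MemL2H1 T θ := by
    intro T hT
    have h1 : MemL2H1 T (fun t k => iter u G 0 t k - θ t k) := by
      refine ⟨fun k => ((hit hT.le 0).1 k).sub (hmeas T hT k), (hdist T hT 0).trans_lt ?_⟩
      rw [pow_zero, one_mul]; exact (memL2H1_const hG).2
    simpa using (hit hT.le 0).sub h1
  refine ⟨θ, ⟨hmem, fun t ht k => ?_⟩, fun T hT => ?_⟩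
  · have hT : 0 < max t 1 := lt_max_of_lt_right one_pos
    have htT : t ≤ max t 1 := le_max_left _ _
    set T := max t 1
    have h1 : Tendsto (fun m => iter u G (m + 1) t k - (-G k - transport u θ t k)) atTop (𝓝 0) := by
      rw [tendsto_zero_iff_enorm_tendsto_zero]
      have h2 : Tendsto (fun m => ‖iter u G (m + 1) t k - (-G k - transport u θ t k)‖ₑ ^ 2) atTop
          (𝓝 0) := by
        refine tendsto_of_tendsto_of_tendsto_of_le_of_le tendsto_const_nhds
          (hgeom (T := T) (ENNReal.ofReal T) ENNReal.ofReal_ne_top) (fun _ => zero_le) fun m => ?_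
        have e : iter u G (m + 1) t k - (-G k - transport u θ t k) =
            -transport u (fun t k => iter u G m t k - θ t k) t k := by
          rw [transport_sub hu ht htT (hit hT.le m) (hmem T hT), iter_succ_eq]; ring
        simp only [e, enorm_neg]
        exact (enorm_transport_sq_le hu ht htT ((hit hT.le m).sub (hmem T hT)) k).trans
          (mul_le_mul_right (hdist T hT m) _)
      have h3 := (ENNReal.continuous_rpow_const (y := 1 / 2)).tendsto 0 |>.comp h2
      simp only [Function.comp_def, ← ENNReal.rpow_natCast, ← ENNReal.rpow_mul] at h3
      simpa using h3
    have h4 := ((hθ t ht k).comp (tendsto_add_atTop_nat 1)).sub_const (-G k - transport u θ t k)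
    exact sub_eq_zero.1 (tendsto_nhds_unique h4 h1)
  · refine tendsto_of_tendsto_of_tendsto_of_le_of_le tendsto_const_nhds
      (hgeom (T := T) 1 ENNReal.one_ne_top) (fun _ => zero_le) fun m => ?_
    rw [one_mul]; exact hdist T hT m

/-- The deterministic part of the theorem: for a small velocity and a source in `H¹` the iteration
converges to the unique solution, which splits off the source and the first correction. -/
lemma exists_solution {u : ℝ → Wave → Fin 3 → ℂ} (hu : SmallVelocity u) {G : Wave → ℂ}
    (hG : h1Sq G ≠ ⊤) : ∃ θ,
      IsSolution u G θ ∧ (∀ η, IsSolution u G η → ∀ t, 0 ≤ t → η t = θ t) ∧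
      (∀ T, 0 < T → (∀ m, MemL2H1 T (iter u G m)) ∧ MemL2H1 T (vartheta u G) ∧
        MemL2H1 T (fun t k => θ t k + G k - vartheta u G t k) ∧
        Tendsto (fun m => distL2H1Sq T (iter u G m) θ) atTop (𝓝 0)) ∧
      ∀ t k, iter u G 1 t k = -G k + vartheta u G t k := by
  obtain ⟨θ, hθ, hlim⟩ := exists_isMild hu hG
  have hv : ∀ T, 0 < T → MemL2H1 T (vartheta u G) :=
    fun T hT => memL2H1_transport hu hT.le (memL2H1_const hG)
  refine ⟨θ, (isSolution_iff_isMild hu).2 hθ,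
    fun η hη => hθ.unique hu ((isSolution_iff_isMild hu).1 hη),
    fun T hT => ⟨memL2H1_iter hu hG hT.le, hv T hT, ?_, hlim T hT⟩, fun t k => ?_⟩
  · simpa using ((hθ.1 T hT).sub (memL2H1_const hG).neg).sub (hv T hT)
  · rw [iter_succ_eq]
    have : transport u (iter u G 0) t k = -vartheta u G t k := transport_neg u (fun _ => G) t k
    rw [this]; ring

/-! ### Second moments of a Duhamel integral -/

section BoundedField

variable {Ω : Type*} [MeasurableSpace Ω] {μ : Measure Ω} [IsProbabilityMeasure μ]

lemma norm_heatInt_le {F : ℝ → ℂ} {l t B : ℝ} (hl : 0 ≤ l) (ht : 0 ≤ t) (hF : ∀ s, ‖F s‖ ≤ B) :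
    ‖heatInt F l t‖ ≤ B * t := by
  have := intervalIntegral.norm_integral_le_of_norm_le_const (a := 0) (b := t) (C := B)
    (f := fun s => ((Real.exp (-(t - s) * l) : ℝ) : ℂ) * F s) (fun s hs => by
      rw [uIoc_of_le ht] at hs
      rw [norm_mul, Complex.norm_real, Real.norm_of_nonneg (Real.exp_pos _).le]
      refine (mul_le_of_le_one_left (norm_nonneg _) (Real.exp_le_one_iff.2 ?_)).trans (hF s)
      rw [neg_mul]; exact neg_nonpos.2 (mul_nonneg (sub_nonneg.2 hs.2) hl))
  rwa [sub_zero, abs_of_nonneg ht] at this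

lemma measurable_heatInt {Y : ℝ → Ω → ℂ} (hY : Measurable fun p : ℝ × Ω => Y p.1 p.2)
    {l t : ℝ} (ht : 0 ≤ t) : Measurable fun ω => heatInt (fun s => Y s ω) l t := by
  simp only [heatInt, intervalIntegral.integral_of_le ht]
  have h : Measurable fun p : Ω × ℝ => ((Real.exp (-(t - p.2) * l) : ℝ) : ℂ) * Y p.2 p.1 :=
    Measurable.mul (by fun_prop) (hY.comp measurable_swap)
  exact (h.stronglyMeasurable.integral_prod_right (ν := volume.restrict (Ioc 0 t))).measurable

lemma measurable_mul_conj {a : ℝ → Ω → ℂ} (ha : Measurable fun p : ℝ × Ω => a p.1 p.2) :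
    Measurable (Function.uncurry fun (ω : Ω) (z : ℝ × ℝ) =>
      a z.1 ω * (starRingEnd ℂ) (a z.2 ω)) := by
  have h1 : Measurable fun p : Ω × ℝ × ℝ => a p.2.1 p.1 :=
    ha.comp ((measurable_fst.comp measurable_snd).prodMk measurable_fst)
  have h2 : Measurable fun p : Ω × ℝ × ℝ => a p.2.2 p.1 :=
    ha.comp ((measurable_snd.comp measurable_snd).prodMk measurable_fst)
  exact h1.mul (Complex.continuous_conj.measurable.comp h2)

/-- The second moment of a Duhamel integral, by Fubini, is a double integral of the covariance. -/
lemma integral_norm_heatInt_sq {Y : ℝ → Ω → ℂ} (hY : Measurable fun p : ℝ × Ω => Y p.1 p.2)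
    {B : ℝ} (hB : ∀ s ω, ‖Y s ω‖ ≤ B) {ρ : ℝ → ℝ}
    (hcov : ∀ s r, 0 ≤ s → 0 ≤ r → ∫ ω, Y s ω * (starRingEnd ℂ) (Y r ω) ∂μ = (ρ |s - r| : ℂ))
    {l t : ℝ} (ht : 0 ≤ t) :
    ∫ ω, ‖heatInt (fun s => Y s ω) l t‖ ^ 2 ∂μ =
      ∫ z : ℝ × ℝ in Ioc 0 t ×ˢ Ioc 0 t,
        Real.exp (-(t - z.1) * l) * Real.exp (-(t - z.2) * l) * ρ |z.1 - z.2| := by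
  set ν := volume.restrict (Ioc (0 : ℝ) t) with hν
  have hνν : (volume.restrict (Ioc (0 : ℝ) t ×ˢ Ioc (0 : ℝ) t) : Measure (ℝ × ℝ)) = ν.prod ν := by
    rw [hν, Measure.prod_restrict]; rfl
  set a : ℝ → Ω → ℂ := fun s ω => ((Real.exp (-(t - s) * l) : ℝ) : ℂ) * Y s ω with ha
  have ham : Measurable fun p : ℝ × Ω => a p.1 p.2 := Measurable.mul (by fun_prop) hY
  have hmem : ∀ᵐ z ∂ν.prod ν, z ∈ Ioc 0 t ×ˢ Ioc 0 t := by
    rw [← hνν]; exact ae_restrict_mem (measurableSet_Ioc.prod measurableSet_Ioc)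
  rw [hνν]
  have key : ((∫ ω, ‖heatInt (fun s => Y s ω) l t‖ ^ 2 ∂μ : ℝ) : ℂ) =
      ((∫ z, Real.exp (-(t - z.1) * l) * Real.exp (-(t - z.2) * l) * ρ |z.1 - z.2| ∂ν.prod ν : ℝ) : ℂ) := by
    rw [← integral_complex_ofReal, ← integral_complex_ofReal]
    have e1 : ∀ ω, ((‖heatInt (fun s => Y s ω) l t‖ ^ 2 : ℝ) : ℂ) =
        ∫ z, a z.1 ω * (starRingEnd ℂ) (a z.2 ω) ∂ν.prod ν := by
      intro ω
      rw [integral_prod_mul (fun s => a s ω) (fun r => (starRingEnd ℂ) (a r ω)), integral_conj,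
        Complex.mul_conj, heatInt, intervalIntegral.integral_of_le ht, Complex.normSq_eq_norm_sq]
    simp only [e1]
    have hC : 0 ≤ Real.exp (t * |l|) * |B| := by positivity
    have hab : ∀ s ∈ Ioc 0 t, ∀ ω, ‖a s ω‖ ≤ Real.exp (t * |l|) * |B| := by
      intro s hs ω
      have h1 : t - s ≤ t := by linarith [hs.1]
      have h2 : 0 ≤ t - s := sub_nonneg.2 hs.2
      have h3 : -(t - s) * l ≤ t * |l| :=
        calc -(t - s) * l ≤ (t - s) * |l| := by nlinarith [neg_abs_le l]
          _ ≤ _ := mul_le_mul_of_nonneg_right h1 (abs_nonneg l)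
      rw [ha, norm_mul, Complex.norm_real, Real.norm_of_nonneg (Real.exp_pos _).le]
      exact mul_le_mul (Real.exp_le_exp.2 h3) ((hB s ω).trans (le_abs_self B)) (norm_nonneg _)
        (Real.exp_pos _).le
    have hint : Integrable (Function.uncurry fun (ω : Ω) (z : ℝ × ℝ) =>
        a z.1 ω * (starRingEnd ℂ) (a z.2 ω)) (μ.prod (ν.prod ν)) := by
      have hm := measurable_mul_conj ham
      refine Integrable.of_bound hm.aestronglyMeasurable
        ((Real.exp (t * |l|) * |B|) * (Real.exp (t * |l|) * |B|)) ?_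
      have : ∀ᵐ p ∂μ.prod (ν.prod ν), p.2 ∈ Ioc 0 t ×ˢ Ioc 0 t :=
        Measure.quasiMeasurePreserving_snd.ae hmem
      filter_upwards [this] with p hp
      simp only [Function.uncurry, norm_mul, RCLike.norm_conj]
      exact mul_le_mul (hab _ hp.1 _) (hab _ hp.2 _) (norm_nonneg _) hC
    rw [integral_integral_swap hint]
    refine integral_congr_ae ?_
    filter_upwards [hmem] with z hz
    have e2 : ∀ ω, a z.1 ω * (starRingEnd ℂ) (a z.2 ω) =
        ((Real.exp (-(t - z.1) * l) * Real.exp (-(t - z.2) * l) : ℝ) : ℂ) *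
          (Y z.1 ω * (starRingEnd ℂ) (Y z.2 ω)) := by
      intro ω
      simp only [ha, map_mul, Complex.conj_ofReal]
      push_cast; ring
    simp only [e2]
    rw [integral_const_mul, hcov _ _ hz.1.1.le hz.2.1.le]
    push_cast; ring
  exact_mod_cast key

end BoundedField

/-- The Laplace transform of the correlation, from the double integral over the quadrant. -/
lemma integral_quadrant_exp_mul {ρ : ℝ → ℝ} (hρ : Continuous fun x => ρ |x|) {B : ℝ}
    (hB : ∀ x, |ρ (|x|)| ≤ B) {l : ℝ} (hl : 0 < l) :
    Integrable (fun z : ℝ × ℝ => Real.exp (-z.1 * l) * Real.exp (-z.2 * l) * ρ |z.1 - z.2|)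
      ((volume.restrict (Ioi 0)).prod (volume.restrict (Ioi 0))) ∧
    ∫ z : ℝ × ℝ, Real.exp (-z.1 * l) * Real.exp (-z.2 * l) * ρ |z.1 - z.2|
      ∂((volume.restrict (Ioi 0)).prod (volume.restrict (Ioi 0))) =
      l⁻¹ * ∫ x in Ioi (0 : ℝ), Real.exp (-x * l) * ρ x := by
  have hexp : ∀ {c : ℝ}, 0 < c → IntegrableOn (fun x : ℝ => Real.exp (-x * c)) (Ioi 0) := by
    intro c hc
    simpa [mul_comm] using integrableOn_exp_mul_Ioi (neg_lt_zero.2 hc) 0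
  have hexpi : ∀ {c : ℝ}, 0 < c → ∫ x in Ioi (0 : ℝ), Real.exp (-x * c) = c⁻¹ := by
    intro c hc
    have := integral_exp_mul_Ioi (neg_lt_zero.2 hc) 0
    simpa [mul_comm] using this
  set ν := (volume.restrict (Ioi 0) : Measure ℝ) with hν
  set H : ℝ × ℝ → ℝ := fun z => Real.exp (-z.1 * l) * Real.exp (-z.2 * l) * ρ |z.1 - z.2| with hH
  have hHc : Continuous H := by
    have : Continuous fun z : ℝ × ℝ => ρ |z.1 - z.2| := hρ.comp (by fun_prop : Continuous fun z : ℝ × ℝ => z.1 - z.2)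
    exact Continuous.mul (by fun_prop) this
  have hHi : Integrable H (ν.prod ν) := by
    refine (((hexp hl).mul_prod (hexp hl)).mul_const B).mono' hHc.aestronglyMeasurable ?_
    refine Eventually.of_forall fun z => ?_
    rw [hH, norm_mul, Real.norm_of_nonneg (by positivity)]
    exact mul_le_mul_of_nonneg_left (hB _) (by positivity)
  refine ⟨hHi, ?_⟩
  have hsplit : ∫ z, H z ∂ν.prod ν = (∫ z, {z : ℝ × ℝ | z.1 < z.2}.indicator H z ∂ν.prod ν) +
      ∫ z, {z : ℝ × ℝ | z.2 ≤ z.1}.indicator H z ∂ν.prod ν := by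
    rw [← integral_add (hHi.indicator (measurableSet_lt measurable_fst measurable_snd))
      (hHi.indicator (measurableSet_le measurable_snd measurable_fst))]
    refine integral_congr_ae (Eventually.of_forall fun z => ?_)
    by_cases h : z.1 < z.2
    · simp [h, not_le.2 h]
    · simp [h, not_lt.1 h]
  have hsym : ∫ z, {z : ℝ × ℝ | z.2 ≤ z.1}.indicator H z ∂ν.prod ν =
      ∫ z, {z : ℝ × ℝ | z.1 ≤ z.2}.indicator H z ∂ν.prod ν := by
    rw [← integral_prod_swap]
    refine integral_congr_ae (Eventually.of_forall fun z => ?_)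
    simp only [indicator_apply, hH, Prod.fst_swap, Prod.snd_swap, mem_ofPred_eq, abs_sub_comm z.2 z.1]
    split_ifs <;> ring
  have hinner : ∀ a ∈ Ioi (0 : ℝ), ∫ b in Ioi a, H (a, b) =
      Real.exp (-a * (2 * l)) * ∫ x in Ioi (0 : ℝ), Real.exp (-x * l) * ρ x := by
    intro a _
    have h1 : ∫ b in Ioi a, H (a, b) = ∫ b, (Ioi (0 : ℝ)).indicator
        (fun x => Real.exp (-a * (2 * l)) * (Real.exp (-x * l) * ρ x)) (b - a) := by
      rw [← integral_indicator measurableSet_Ioi]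
      refine integral_congr_ae (Eventually.of_forall fun b => ?_)
      simp only [indicator_apply, mem_Ioi, sub_pos, hH]
      split_ifs with h
      · rw [abs_sub_comm, abs_of_pos (sub_pos.2 h), ← mul_assoc, ← Real.exp_add, ← Real.exp_add]
        ring_nf
      · rfl
    rw [h1, integral_sub_right_eq_self (fun x => (Ioi (0 : ℝ)).indicator _ x) a,
      integral_indicator measurableSet_Ioi, integral_const_mul]
  have hIoi : ∀ (S : Set (ℝ × ℝ)), MeasurableSet S →
      (∀ a ∈ Ioi (0 : ℝ), (Ioi 0 ∩ {b | (a, b) ∈ S} : Set ℝ) =ᵐ[volume] Ioi a) →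
      ∫ z, S.indicator H z ∂ν.prod ν =
        (2 * l)⁻¹ * ∫ x in Ioi (0 : ℝ), Real.exp (-x * l) * ρ x := by
    intro S hS hSa
    rw [integral_prod _ (hHi.indicator hS)]
    have h1 : ∀ a ∈ Ioi (0 : ℝ), ∫ b, S.indicator H (a, b) ∂ν =
        Real.exp (-a * (2 * l)) * ∫ x in Ioi (0 : ℝ), Real.exp (-x * l) * ρ x := by
      intro a ha
      rw [← hinner a ha, ← setIntegral_congr_set (hSa a ha), ← setIntegral_indicator]
      · rfl
      · exact measurable_prodMk_left hS
    rw [hν, setIntegral_congr_fun measurableSet_Ioi h1, integral_mul_const, hexpi (by positivity)]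
  rw [hsplit, hsym, hIoi _ (measurableSet_lt measurable_fst measurable_snd),
    hIoi _ (measurableSet_le measurable_fst measurable_snd)]
  · field_simp; ring
  · intro a ha
    have : (Ioi 0 ∩ {b | (a, b) ∈ {z : ℝ × ℝ | z.1 ≤ z.2}} : Set ℝ) = Ici a := by
      ext b; simp only [mem_inter_iff, mem_Ioi, mem_ofPred_eq, mem_Ici, and_iff_right_iff_imp]
      exact fun h => (show (0:ℝ) < a from ha).trans_le h
    rw [this]; exact Ioi_ae_eq_Ici.symm
  · intro a ha
    have : (Ioi 0 ∩ {b | (a, b) ∈ {z : ℝ × ℝ | z.1 < z.2}} : Set ℝ) = Ioi a := by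
      ext b; simp only [mem_inter_iff, mem_Ioi, mem_ofPred_eq, and_iff_right_iff_imp]
      exact fun h => (show (0:ℝ) < a from ha).trans h
    rw [this]
    exact ae_eq_refl _

lemma tendsto_double_integral {ρ : ℝ → ℝ} (hρ : Continuous fun x => ρ |x|) {B : ℝ}
    (hB : ∀ x, |ρ (|x|)| ≤ B) {l : ℝ} (hl : 0 < l) :
    Tendsto (fun t => ∫ z : ℝ × ℝ in Ioc 0 t ×ˢ Ioc 0 t,
        Real.exp (-(t - z.1) * l) * Real.exp (-(t - z.2) * l) * ρ |z.1 - z.2|) atTop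
      (𝓝 (l⁻¹ * ∫ x in Ioi (0 : ℝ), Real.exp (-x * l) * ρ x)) := by
  obtain ⟨hi, he⟩ := integral_quadrant_exp_mul hρ hB hl
  set H : ℝ × ℝ → ℝ := fun z => Real.exp (-z.1 * l) * Real.exp (-z.2 * l) * ρ |z.1 - z.2| with hH
  rw [← he]
  -- reversing time turns the integrals into those of one function over growing squares
  have hrev : ∀ t, ∫ z : ℝ × ℝ in Ioc 0 t ×ˢ Ioc 0 t,
        Real.exp (-(t - z.1) * l) * Real.exp (-(t - z.2) * l) * ρ |z.1 - z.2| =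
      ∫ z, (Iio t ×ˢ Iio t).indicator H z ∂((volume.restrict (Ioi 0)).prod (volume.restrict (Ioi 0))) := by
    intro t
    have e1 : ∫ z : ℝ × ℝ in Ioc 0 t ×ˢ Ioc 0 t,
        Real.exp (-(t - z.1) * l) * Real.exp (-(t - z.2) * l) * ρ |z.1 - z.2| =
        ∫ z : ℝ × ℝ, (Ico 0 t ×ˢ Ico 0 t).indicator H ((t, t) - z) := by
      rw [← integral_indicator (measurableSet_Ioc.prod measurableSet_Ioc)]
      refine integral_congr_ae (Eventually.of_forall fun z => ?_)
      have hiff : z ∈ Ioc 0 t ×ˢ Ioc 0 t ↔ (t, t) - z ∈ Ico 0 t ×ˢ Ico 0 t := by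
        simp only [mem_prod, mem_Ioc, mem_Ico, Prod.fst_sub, Prod.snd_sub]
        constructor <;> rintro ⟨⟨_, _⟩, _, _⟩ <;> refine ⟨⟨?_, ?_⟩, ?_, ?_⟩ <;> linarith
      simp only [indicator_apply, hiff, hH, Prod.fst_sub, Prod.snd_sub, sub_sub_sub_cancel_left,
        abs_sub_comm z.2 z.1]
    have : (Measure.prod volume volume : Measure (ℝ × ℝ)) = volume := rfl
    rw [e1, integral_sub_left_eq_self, integral_indicator (measurableSet_Ico.prod measurableSet_Ico),
      integral_indicator (measurableSet_Iio.prod measurableSet_Iio), Measure.prod_restrict,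
      Measure.restrict_restrict (measurableSet_Iio.prod measurableSet_Iio), this]
    refine setIntegral_congr_set ?_
    rw [prod_inter_prod, ← this]
    have h1 : (Ico 0 t : Set ℝ) =ᵐ[volume] (Iio t ∩ Ioi 0 : Set ℝ) := by
      rw [inter_comm, Ioi_inter_Iio]; exact Ioo_ae_eq_Ico.symm
    exact Measure.set_prod_ae_eq h1 h1
  simp only [hrev]
  refine tendsto_integral_filter_of_dominated_convergence (fun z => ‖H z‖)
    (Eventually.of_forall fun t => ?_) (Eventually.of_forall fun t => Eventually.of_forall fun z => ?_)
    hi.norm (Eventually.of_forall fun z => ?_)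
  · exact hi.aestronglyMeasurable.indicator (measurableSet_Iio.prod measurableSet_Iio)
  · exact norm_indicator_le_norm_self _ _
  · refine tendsto_const_nhds.congr' ?_
    filter_upwards [eventually_gt_atTop z.1, eventually_gt_atTop z.2] with t h1 h2
    rw [indicator_of_mem]
    exact ⟨h1, h2⟩

lemma summable_sq_of_summable {ι : Type*} {f : ι → ℝ} (hf : ∀ i, 0 ≤ f i) (h : Summable f) :
    Summable fun i => f i ^ 2 := by
  have h1 := (h.mul_of_nonneg h hf hf).comp_injective
    (i := fun j => (j, j)) fun a b hab => (Prod.mk.inj hab).1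
  simpa only [sq, Function.comp_def] using h1

/-- A countable family of jointly measurable processes that is bounded by a summable sequence,
uncorrelated between different indices and stationary in time, with covariances `R j`. -/
structure ModeFamily {Ω ι : Type*} [MeasurableSpace Ω] [DecidableEq ι] (μ : Measure Ω)
    (X : ι → ℝ → Ω → ℂ) (M : ι → ℝ) (R : ι → ℝ → ℝ) : Prop where
  meas : ∀ j, Measurable fun p : ℝ × Ω => X j p.1 p.2
  summable : Summable M
  bound : ∀ j s, 0 ≤ s → ∀ᵐ ω ∂μ, ‖X j s ω‖ ≤ M j
  cov : ∀ j l s r, 0 ≤ s → 0 ≤ r →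
    ∫ ω, X j s ω * (starRingEnd ℂ) (X l r ω) ∂μ = if j = l then (R j |s - r| : ℂ) else 0
  cont : ∀ j, Continuous fun x => R j |x|

namespace ModeFamily

variable {Ω ι : Type*} [MeasurableSpace Ω] [DecidableEq ι] [Countable ι] {μ : Measure Ω}
  [IsProbabilityMeasure μ] {X : ι → ℝ → Ω → ℂ} {M : ι → ℝ} {R : ι → ℝ → ℝ}

lemma M_nonneg (h : ModeFamily μ X M R) (j : ι) : 0 ≤ M j := by
  obtain ⟨ω, hω⟩ := (h.bound j 0 le_rfl).exists
  exact (norm_nonneg _).trans hω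

lemma ae_bound (h : ModeFamily μ X M R) {s : ℝ} (hs : 0 ≤ s) : ∀ᵐ ω ∂μ, ∀ j, ‖X j s ω‖ ≤ M j :=
  ae_all_iff.2 fun j => h.bound j s hs

lemma measurableSet_bound (h : ModeFamily μ X M R) :
    MeasurableSet {p : ℝ × Ω | ∀ j, ‖X j p.1 p.2‖ ≤ M j} := by
  rw [ofPred_forall]
  exact MeasurableSet.iInter fun j => measurableSet_le (h.meas j).norm measurable_const

/-- Almost surely the bounds hold at almost all times, by Fubini. -/
lemma ae_ae_bound (h : ModeFamily μ X M R) :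
    ∀ᵐ ω ∂μ, ∀ᵐ s ∂volume.restrict (Ioi (0 : ℝ)), ∀ j, ‖X j s ω‖ ≤ M j := by
  rw [← Measure.ae_ae_comm (p := fun s ω => ∀ j, ‖X j s ω‖ ≤ M j) h.measurableSet_bound]
  filter_upwards [ae_restrict_mem measurableSet_Ioi] with s hs
  exact h.ae_bound (le_of_lt hs)

/-- The family cut off where it exceeds its bound. -/
noncomputable def cutoff (X : ι → ℝ → Ω → ℂ) (M : ι → ℝ) (j : ι) (s : ℝ) (ω : Ω) : ℂ :=
  if ‖X j s ω‖ ≤ M j then X j s ω else 0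

lemma norm_cutoff_le (h : ModeFamily μ X M R) (j : ι) (s : ℝ) (ω : Ω) :
    ‖cutoff X M j s ω‖ ≤ M j := by
  unfold cutoff
  split_ifs with h1
  · exact h1
  · rw [norm_zero]; exact h.M_nonneg j

lemma summable_norm_cutoff (h : ModeFamily μ X M R) (s : ℝ) (ω : Ω) :
    Summable fun j => ‖cutoff X M j s ω‖ :=
  h.summable.of_nonneg_of_le (fun _ => norm_nonneg _) fun j => h.norm_cutoff_le j s ω

lemma measurable_cutoff (h : ModeFamily μ X M R) (j : ι) :
    Measurable fun p : ℝ × Ω => cutoff X M j p.1 p.2 :=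
  Measurable.ite (measurableSet_le (h.meas j).norm measurable_const) (h.meas j) measurable_const

lemma measurable_tsum_cutoff (h : ModeFamily μ X M R) :
    Measurable fun p : ℝ × Ω => ∑' j, cutoff X M j p.1 p.2 := by
  refine measurable_of_tendsto_metrizable' (atTop : Filter (Finset ι))
    (f := fun S (p : ℝ × Ω) => ∑ j ∈ S, cutoff X M j p.1 p.2)
    (fun S => Finset.measurable_fun_sum _ fun j _ => h.measurable_cutoff j) ?_
  rw [tendsto_pi_nhds]
  exact fun p => (h.summable_norm_cutoff p.1 p.2).of_norm.hasSum

lemma norm_tsum_cutoff_le (h : ModeFamily μ X M R) (s : ℝ) (ω : Ω) :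
    ‖∑' j, cutoff X M j s ω‖ ≤ ∑' j, M j :=
  tsum_of_norm_bounded h.summable.hasSum fun j => h.norm_cutoff_le j s ω

lemma tsum_cutoff_eq {s : ℝ} {ω : Ω} (h : ∀ j, ‖X j s ω‖ ≤ M j) :
    ∑' j, cutoff X M j s ω = ∑' j, X j s ω :=
  tsum_congr fun j => if_pos (h j)

lemma abs_cov_le (h : ModeFamily μ X M R) (j : ι) (x : ℝ) : |R j (|x|)| ≤ M j ^ 2 := by
  have h1 := h.cov j j |x| 0 (abs_nonneg x) le_rfl
  rw [if_pos rfl, sub_zero, abs_abs] at h1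
  have h2 := norm_integral_le_of_norm_le_const (μ := μ)
    (f := fun ω => X j |x| ω * (starRingEnd ℂ) (X j 0 ω)) (C := M j ^ 2) (by
      filter_upwards [h.bound j |x| (abs_nonneg x), h.bound j 0 le_rfl] with ω h3 h4
      rw [norm_mul, RCLike.norm_conj, sq]
      exact mul_le_mul h3 h4 (norm_nonneg _) (h.M_nonneg j))
  simpa [h1] using h2

lemma summable_sq (h : ModeFamily μ X M R) : Summable fun j => M j ^ 2 :=
  summable_sq_of_summable h.M_nonneg h.summable

lemma summable_cov (h : ModeFamily μ X M R) (x : ℝ) : Summable fun j => R j |x| :=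
  Summable.of_norm_bounded h.summable_sq fun j => h.abs_cov_le j x

/-- The modes are uncorrelated, so the covariance of the sum is the sum of the covariances. -/
lemma integral_tsum_mul_conj (h : ModeFamily μ X M R) {s r : ℝ} (hs : 0 ≤ s) (hr : 0 ≤ r) :
    ∫ ω, (∑' j, X j s ω) * (starRingEnd ℂ) (∑' j, X j r ω) ∂μ = ((∑' j, R j |s - r| : ℝ) : ℂ) := by
  set F : ι × ι → Ω → ℂ := fun z ω => X z.1 s ω * (starRingEnd ℂ) (X z.2 r ω) with hF
  have hms : ∀ j s, Measurable (X j s) := fun j s => (h.meas j).comp measurable_prodMk_left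
  have hFb : ∀ z, ∀ᵐ ω ∂μ, ‖F z ω‖ ≤ M z.1 * M z.2 := by
    intro z
    filter_upwards [h.bound z.1 s hs, h.bound z.2 r hr] with ω h1 h2
    rw [hF, norm_mul, RCLike.norm_conj]
    exact mul_le_mul h1 h2 (norm_nonneg _) (h.M_nonneg _)
  have hFi : ∀ z, Integrable (F z) μ := fun z => Integrable.of_bound
    ((hms _ _).mul (Complex.continuous_conj.measurable.comp (hms _ _))).aestronglyMeasurable _ (hFb z)
  have hsum : Summable fun z => ∫ ω, ‖F z ω‖ ∂μ := by
    refine (h.summable.mul_of_nonneg h.summable h.M_nonneg h.M_nonneg).of_nonneg_of_le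
      (fun z => integral_nonneg fun _ => norm_nonneg _) fun z => ?_
    have := integral_mono_ae (hFi z).norm (integrable_const (μ := μ) (M z.1 * M z.2)) (hFb z)
    simpa using this
  have h1 := (hasSum_integral_of_summable_integral_norm hFi hsum).tsum_eq
  have h2 : ∫ ω, (∑' j, X j s ω) * (starRingEnd ℂ) (∑' j, X j r ω) ∂μ =
      ∫ ω, ∑' z, F z ω ∂μ := by
    refine integral_congr_ae ?_
    filter_upwards [h.ae_bound hs, h.ae_bound hr] with ω h3 h4
    have h5 : Summable fun j => ‖X j s ω‖ := h.summable.of_nonneg_of_le (fun _ => norm_nonneg _) h3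
    have h6 : Summable fun j => ‖(starRingEnd ℂ) (X j r ω)‖ := by
      simp only [RCLike.norm_conj]
      exact h.summable.of_nonneg_of_le (fun _ => norm_nonneg _) h4
    rw [Complex.conj_tsum, tsum_mul_tsum_of_summable_norm h5 h6]
  rw [h2, ← h1]
  have h3 : ∀ z : ι × ι, ∫ ω, F z ω ∂μ = if z.1 = z.2 then (R z.1 |s - r| : ℂ) else 0 :=
    fun z => h.cov z.1 z.2 s r hs hr
  simp only [h3]
  have hinj : Function.Injective fun j : ι => (j, j) := fun a b hab => (Prod.mk.inj hab).1
  rw [← hinj.tsum_eq (f := fun z : ι × ι => if z.1 = z.2 then (R z.1 |s - r| : ℂ) else 0)]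
  · simp [Complex.ofReal_tsum]
  · intro z hz
    rw [Function.mem_support, ne_eq, ite_eq_right_iff, Classical.not_imp] at hz
    exact ⟨z.1, Prod.ext rfl hz.1⟩

lemma integral_norm_tsum_sq (h : ModeFamily μ X M R) {s : ℝ} (hs : 0 ≤ s) :
    ∫ ω, ‖∑' j, X j s ω‖ ^ 2 ∂μ = ∑' j, R j 0 := by
  have h1 := h.integral_tsum_mul_conj hs hs
  simp only [Complex.mul_conj, Complex.normSq_eq_norm_sq, sub_self, abs_zero] at h1
  rw [integral_complex_ofReal] at h1
  exact_mod_cast h1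

lemma heatInt_ae_eq (h : ModeFamily μ X M R) {l t : ℝ} (ht : 0 ≤ t) :
    ∀ᵐ ω ∂μ, heatInt (fun s => ∑' j, X j s ω) l t = heatInt (fun s => ∑' j, cutoff X M j s ω) l t := by
  filter_upwards [h.ae_ae_bound] with ω hω
  refine heatInt_congr_ae ht le_rfl ?_
  filter_upwards [ae_mono (Measure.restrict_mono Ioc_subset_Ioi_self le_rfl) hω] with s hs
  exact (tsum_cutoff_eq hs).symm

lemma memLp_heatInt (h : ModeFamily μ X M R) {l t : ℝ} (hl : 0 ≤ l) (ht : 0 ≤ t) :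
    MemLp (fun ω => heatInt (fun s => ∑' j, X j s ω) l t) 2 μ := by
  have h1 : MemLp (fun ω => heatInt (fun s => ∑' j, cutoff X M j s ω) l t) 2 μ :=
    MemLp.of_bound (measurable_heatInt h.measurable_tsum_cutoff ht).aestronglyMeasurable _
      (Eventually.of_forall fun ω => norm_heatInt_le hl ht fun s => h.norm_tsum_cutoff_le s ω)
  exact h1.ae_eq ((h.heatInt_ae_eq ht).mono fun _ hω => hω.symm)

/-- The large-time limit of the second moment of a Duhamel integral of a stationary sum of
uncorrelated modes. -/
lemma tendsto_integral_norm_heatInt_sq (h : ModeFamily μ X M R) {l : ℝ} (hl : 0 < l) :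
    Tendsto (fun t => ∫ ω, ‖heatInt (fun s => ∑' j, X j s ω) l t‖ ^ 2 ∂μ) atTop
      (𝓝 (l⁻¹ * ∑' j, ∫ x in Ioi (0 : ℝ), Real.exp (-x * l) * R j x)) := by
  have hρc : Continuous fun x => ∑' j, R j |x| :=
    continuous_tsum h.cont h.summable_sq fun j x => h.abs_cov_le j x
  have hρb : ∀ x : ℝ, |∑' j, R j (abs x)| ≤ ∑' j, M j ^ 2 := fun x => by
    rw [← Real.norm_eq_abs]
    exact tsum_of_norm_bounded h.summable_sq.hasSum fun j => h.abs_cov_le j x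
  have hcov : ∀ s r, 0 ≤ s → 0 ≤ r →
      ∫ ω, (∑' j, cutoff X M j s ω) * (starRingEnd ℂ) (∑' j, cutoff X M j r ω) ∂μ =
        ((fun x => ∑' j, R j x) |s - r| : ℝ) := by
    intro s r hs hr
    rw [← h.integral_tsum_mul_conj hs hr]
    refine integral_congr_ae ?_
    filter_upwards [h.ae_bound hs, h.ae_bound hr] with ω h1 h2
    rw [tsum_cutoff_eq h1, tsum_cutoff_eq h2]
  have hexp : IntegrableOn (fun x : ℝ => Real.exp (-x * l)) (Ioi 0) := by
    simpa [mul_comm] using integrableOn_exp_mul_Ioi (neg_lt_zero.2 hl) 0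
  have hRi : ∀ j, ∀ᵐ x ∂volume.restrict (Ioi (0 : ℝ)),
      ‖Real.exp (-x * l) * R j x‖ ≤ Real.exp (-x * l) * M j ^ 2 := by
    intro j
    filter_upwards [ae_restrict_mem measurableSet_Ioi] with x hx
    rw [norm_mul, Real.norm_of_nonneg (Real.exp_pos _).le, Real.norm_eq_abs]
    refine mul_le_mul_of_nonneg_left ?_ (Real.exp_pos _).le
    simpa [abs_of_pos (mem_Ioi.1 hx)] using h.abs_cov_le j x
  have hRint : ∀ j, IntegrableOn (fun x => Real.exp (-x * l) * R j x) (Ioi 0) := by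
    intro j
    refine (hexp.mul_const (M j ^ 2)).mono' ?_ (hRi j)
    have hc : Continuous fun x : ℝ => Real.exp (-x * l) * R j |x| :=
      Continuous.mul (by fun_prop) (h.cont j)
    refine hc.aestronglyMeasurable.congr ?_
    filter_upwards [ae_restrict_mem measurableSet_Ioi] with x hx
    rw [abs_of_pos hx]
  have hswap : ∑' j, ∫ x in Ioi (0 : ℝ), Real.exp (-x * l) * R j x =
      ∫ x in Ioi (0 : ℝ), Real.exp (-x * l) * ∑' j, R j x := by
    simp only [← tsum_mul_left]
    refine (hasSum_integral_of_summable_integral_norm hRint ?_).tsum_eq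
    refine (h.summable_sq.mul_left (∫ x in Ioi (0 : ℝ), Real.exp (-x * l))).of_nonneg_of_le
      (fun j => integral_nonneg fun _ => norm_nonneg _) fun j => ?_
    rw [← integral_mul_const]
    exact integral_mono_ae (hRint j).norm (hexp.mul_const _) (hRi j)
  rw [hswap]
  refine (tendsto_double_integral (ρ := fun x => ∑' j, R j x) hρc hρb hl).congr' ?_
  filter_upwards [eventually_ge_atTop 0] with t ht
  refine (integral_norm_heatInt_sq (ρ := fun x => ∑' j, R j x) h.measurable_tsum_cutoff
    h.norm_tsum_cutoff_le hcov ht).symm.trans ?_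
  refine integral_congr_ae ?_
  filter_upwards [h.heatInt_ae_eq (l := l) ht] with ω hω
  rw [hω]

end ModeFamily

/-! ### The Craya--Herring basis and the velocity -/

/-- The dot product of two wavevectors. -/
def wdot (k j : Wave) : ℝ := ∑ i, (k i : ℝ) * (j i : ℝ)

lemma hnorm_sq (k : Wave) : hnorm k ^ 2 = (k 0 : ℝ) ^ 2 + (k 1 : ℝ) ^ 2 :=
  Real.sq_sqrt (by positivity)

/-- The vectors `e_k`, `f_k` and `k/|k|` form an orthonormal basis: Parseval's identity. -/
lemma IsCrayaHerring.sq_add_sq {e f : Wave → Fin 3 → ℝ} (h : IsCrayaHerring e f) {k : Wave}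
    (hk : k ≠ 0) (j : Wave) :
    rdot (e k) j ^ 2 + rdot (f k) j ^ 2 = wnorm j ^ 2 - wdot k j ^ 2 / wnorm k ^ 2 := by
  have hn := wnorm_sq k
  have hk0 := wnorm_ne_zero hk
  rw [wnorm_sq j]
  simp only [Fin.sum_univ_three, rdot, wdot] at hn ⊢
  by_cases hh : hnorm k = 0
  · obtain ⟨h1, h2, h3, h4, h5⟩ := h.vertical k hk hh
    have hs := hnorm_sq k
    rw [hh] at hs
    have k0 : (k 0 : ℝ) = 0 := by nlinarith [sq_nonneg (k 0 : ℝ), sq_nonneg (k 1 : ℝ)]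
    have k1 : (k 1 : ℝ) = 0 := by nlinarith [sq_nonneg (k 0 : ℝ), sq_nonneg (k 1 : ℝ)]
    rw [k0, k1] at hn ⊢
    have hk2 : (k 2 : ℝ) ≠ 0 := by
      intro h0; rw [h0] at hn; exact hk0 (by nlinarith)
    simp only [Fin.sum_univ_three, rdot, k0, k1, mul_zero, zero_add, mul_eq_zero, hk2, or_false]
      at h1 h2 h3 h4 h5
    rw [h4] at h1 h3 ⊢
    rw [h5] at h2 h3 ⊢
    rw [hn]
    set a := e k 0
    set b := e k 1
    set c := f k 0
    set d := f k 1
    have hab : a * a + b * b = 1 := by linarith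
    have hcd : c * c + d * d = 1 := by linarith
    have hac : a * c + b * d = 0 := by linarith
    have ec : c = -b * (a * d - b * c) := by linear_combination (-c) * hab + a * hac
    have ed : d = a * (a * d - b * c) := by linear_combination (-d) * hab + b * hac
    have hD : (a * d - b * c) ^ 2 = 1 := by
      linear_combination hab * (c * c + d * d) + hcd - (a * c + b * d) * hac
    have e1 : c ^ 2 = b ^ 2 := by
      calc c ^ 2 = b ^ 2 * (a * d - b * c) ^ 2 := by nth_rewrite 1 [ec]; ring
        _ = _ := by rw [hD, mul_one]
    have e2 : d ^ 2 = a ^ 2 := by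
      calc d ^ 2 = a ^ 2 * (a * d - b * c) ^ 2 := by nth_rewrite 1 [ed]; ring
        _ = _ := by rw [hD, mul_one]
    have e3 : c * d = -(a * b) := by
      calc c * d = -(a * b) * (a * d - b * c) ^ 2 := by nth_rewrite 1 [ec]; nth_rewrite 2 [ed]; ring
        _ = _ := by rw [hD, mul_one]
    have hq : ((0 : ℝ) * j 0 + 0 * j 1 + k 2 * j 2) ^ 2 / (0 ^ 2 + 0 ^ 2 + (k 2 : ℝ) ^ 2) =
        (j 2 : ℝ) ^ 2 := by
      rw [show (0 : ℝ) * j 0 + 0 * j 1 + k 2 * j 2 = k 2 * j 2 by ring,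
        show (0 : ℝ) ^ 2 + 0 ^ 2 + (k 2 : ℝ) ^ 2 = (k 2 : ℝ) ^ 2 by ring]
      field_simp
    rw [hq]
    linear_combination (j 0 : ℝ) ^ 2 * (e1 + hab) + (j 1 : ℝ) ^ 2 * (e2 + hab) +
      2 * (j 0 : ℝ) * j 1 * e3
  · rw [h.e_eq k hh, h.f_eq k hh]
    have hs := hnorm_sq k
    have hn' : wnorm k ^ 2 = hnorm k ^ 2 + (k 2 : ℝ) ^ 2 := by rw [hs, hn]
    simp only [Matrix.cons_val_zero, Matrix.cons_val_one, Matrix.cons_val]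
    field_simp
    rw [hn', hs]
    ring

lemma wdot_self (k : Wave) : wdot k k = wnorm k ^ 2 := by
  rw [wnorm_sq, wdot]; exact Finset.sum_congr rfl fun _ _ => by ring

lemma IsCrayaHerring.rdot_self {e f : Wave → Fin 3 → ℝ} (h : IsCrayaHerring e f) {k : Wave}
    (hk : k ≠ 0) : rdot (e k) k = 0 ∧ rdot (f k) k = 0 := by
  have h1 := h.sq_add_sq hk k
  have hk0 := wnorm_ne_zero hk
  have h2 : wnorm k ^ 2 - wdot k k ^ 2 / wnorm k ^ 2 = 0 := by rw [wdot_self]; field_simp; ring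
  rw [h2] at h1
  constructor <;> nlinarith [sq_nonneg (rdot (e k) k), sq_nonneg (rdot (f k) k)]

lemma IsCrayaHerring.abs_rdot_le {e f : Wave → Fin 3 → ℝ} (h : IsCrayaHerring e f) {k : Wave}
    (hk : k ≠ 0) (j : Wave) : |rdot (e k) j| ≤ wnorm j ∧ |rdot (f k) j| ≤ wnorm j := by
  have h1 := h.sq_add_sq hk j
  have h2 : 0 ≤ wdot k j ^ 2 / wnorm k ^ 2 := by positivity
  constructor <;> refine abs_le_of_sq_le_sq ?_ (wnorm_nonneg j) <;>
    nlinarith [sq_nonneg (rdot (e k) j), sq_nonneg (rdot (f k) j)]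

lemma velocity_dot (β Ue Uf : ℝ) (e f : Wave → Fin 3 → ℝ) (V W : Wave → ℂ) {m : Wave} (hm : m ≠ 0)
    (j : Wave) : ∑ i, velocity β Ue Uf e f V W m i * (j i : ℂ) =
      ((wnorm m ^ β * Ue * rdot (e m) j : ℝ) : ℂ) * V m +
      ((wnorm m ^ β * Uf * rdot (f m) j : ℝ) : ℂ) * W m := by
  simp only [velocity, if_neg hm, rdot, Fin.sum_univ_three]
  push_cast; ring

lemma velocity_zero (β Ue Uf : ℝ) (e f : Wave → Fin 3 → ℝ) (V W : Wave → ℂ) :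
    velocity β Ue Uf e f V W 0 = 0 := if_pos rfl

lemma velocity_div {β Ue Uf : ℝ} {e f : Wave → Fin 3 → ℝ} (h : IsCrayaHerring e f) (V W : Wave → ℂ)
    (m : Wave) : ∑ i, velocity β Ue Uf e f V W m i * (m i : ℂ) = 0 := by
  rcases eq_or_ne m 0 with rfl | hm
  · simp
  · rw [velocity_dot _ _ _ _ _ _ _ hm, (h.rdot_self hm).1, (h.rdot_self hm).2]; simp

section Probability

variable {Ω : Type*} [MeasurableSpace Ω] {μ : Measure Ω}
  {ς Ξ : ℝ} {Φ : ℝ → ℝ} {χ : Wave → ℝ} {V W : Wave → ℝ → Ω → ℂ}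

lemma IsVelocityProcess.measurable_V (h : IsVelocityProcess μ ς Ξ Φ χ V W) (k : Wave) (t : ℝ) :
    Measurable (V k t) := (h.measV k).comp measurable_prodMk_left

lemma IsVelocityProcess.measurable_W (h : IsVelocityProcess μ ς Ξ Φ χ V W) (k : Wave) (t : ℝ) :
    Measurable (W k t) := (h.measW k).comp measurable_prodMk_left

lemma measurable_velocity (h : IsVelocityProcess μ ς Ξ Φ χ V W) (β Ue Uf : ℝ)
    (e f : Wave → Fin 3 → ℝ) (k : Wave) (i : Fin 3) :
    Measurable fun p : ℝ × Ω =>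
      velocity β Ue Uf e f (fun k => V k p.1 p.2) (fun k => W k p.1 p.2) k i := by
  unfold velocity
  split_ifs
  · simp only [Pi.zero_apply]; exact measurable_const
  · exact measurable_const.mul ((measurable_const.mul (h.measV k)).add
      (measurable_const.mul (h.measW k)))

lemma smallVelocity_of_ae {β Ue Uf : ℝ} {e f : Wave → Fin 3 → ℝ} (he : IsCrayaHerring e f)
    (h : IsVelocityProcess μ ς Ξ Φ χ V W) {u : Ω → ℝ → Wave → Fin 3 → ℂ}
    (hu : ∀ ω t, u ω t = velocity β Ue Uf e f (fun k => V k t ω) (fun k => W k t ω)) {ω : Ω}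
    (hs : ENNReal.ofReal smallConst * supHHalfSq (u ω) < 1) : SmallVelocity (u ω) where
  zero t := by rw [hu, velocity_zero]
  div t m := by rw [hu]; exact velocity_div he _ _ m
  meas k i := by
    simp only [hu]
    exact (measurable_velocity h β Ue Uf e f k i).comp measurable_prodMk_right
  small := by
    filter_upwards [ENNReal.ae_le_essSup (μ := volume.restrict (Ioi (0 : ℝ)))
      (fun t => hHalfSq (u ω t))] with t ht
    exact (mul_le_mul_right ht _).trans hs.le

lemma integrable_mul_conj [IsFiniteMeasure μ] {P Q : Ω → ℂ} {a b : ℝ} (hP : Measurable P)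
    (hQ : Measurable Q) (h1 : ∀ᵐ ω ∂μ, ‖P ω‖ ≤ a) (h2 : ∀ᵐ ω ∂μ, ‖Q ω‖ ≤ b) :
    Integrable (fun ω => P ω * (starRingEnd ℂ) (Q ω)) μ := by
  refine Integrable.of_bound
    (hP.mul (Complex.continuous_conj.measurable.comp hQ)).aestronglyMeasurable (|a| * |b|) ?_
  filter_upwards [h1, h2] with ω h3 h4
  rw [norm_mul, RCLike.norm_conj]
  exact mul_le_mul (h3.trans (le_abs_self a)) (h4.trans (le_abs_self b)) (norm_nonneg _) (abs_nonneg a)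

/-- The covariance of the combinations of `V` and `W` that occur in `u_{k-j} · j`. -/
lemma IsVelocityProcess.integral_comb [IsProbabilityMeasure μ] (h : IsVelocityProcess μ ς Ξ Φ χ V W)
    {m m' : Wave} (hm : m ≠ 0) (hm' : m' ≠ 0) (a b a' b' : ℝ) {s r : ℝ} (hs : 0 ≤ s) (hr : 0 ≤ r) :
    ∫ ω, ((a : ℂ) * V m s ω + (b : ℂ) * W m s ω) *
      (starRingEnd ℂ) ((a' : ℂ) * V m' r ω + (b' : ℂ) * W m' r ω) ∂μ =
      if m = m' then (((a * a' + b * b') * Φ (χ m * |s - r|) : ℝ) : ℂ) else 0 := by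
  have e1 : ∀ ω, ((a : ℂ) * V m s ω + (b : ℂ) * W m s ω) *
      (starRingEnd ℂ) ((a' : ℂ) * V m' r ω + (b' : ℂ) * W m' r ω) =
      ((a : ℂ) * a' * (V m s ω * (starRingEnd ℂ) (V m' r ω)) +
        (a : ℂ) * b' * (V m s ω * (starRingEnd ℂ) (W m' r ω))) +
      ((b : ℂ) * a' * (starRingEnd ℂ) (V m' r ω * (starRingEnd ℂ) (W m s ω)) +
        (b : ℂ) * b' * (W m s ω * (starRingEnd ℂ) (W m' r ω))) := by
    intro ω
    simp only [map_add, map_mul, Complex.conj_ofReal, Complex.conj_conj]; ring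
  have i1 := integrable_mul_conj (h.measurable_V m s) (h.measurable_V m' r)
    (h.properV m hm s hs).bound (h.properV m' hm' r hr).bound
  have i2 := integrable_mul_conj (h.measurable_V m s) (h.measurable_W m' r)
    (h.properV m hm s hs).bound (h.properW m' hm' r hr).bound
  have i3 := integrable_mul_conj (h.measurable_V m' r) (h.measurable_W m s)
    (h.properV m' hm' r hr).bound (h.properW m hm s hs).bound
  have i3' : Integrable (fun ω => (starRingEnd ℂ) (V m' r ω * (starRingEnd ℂ) (W m s ω))) μ :=
    Complex.conjCLE.toContinuousLinearMap.integrable_comp i3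
  have i4 := integrable_mul_conj (h.measurable_W m s) (h.measurable_W m' r)
    (h.properW m hm s hs).bound (h.properW m' hm' r hr).bound
  have i12 : Integrable (fun ω => (a : ℂ) * a' * (V m s ω * (starRingEnd ℂ) (V m' r ω)) +
      (a : ℂ) * b' * (V m s ω * (starRingEnd ℂ) (W m' r ω))) μ := (i1.const_mul _).add (i2.const_mul _)
  have i34 : Integrable (fun ω =>
      (b : ℂ) * a' * (starRingEnd ℂ) (V m' r ω * (starRingEnd ℂ) (W m s ω)) +
      (b : ℂ) * b' * (W m s ω * (starRingEnd ℂ) (W m' r ω))) μ := (i3'.const_mul _).add (i4.const_mul _)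
  simp only [e1]
  rw [integral_add i12 i34,
    integral_add (i1.const_mul _) (i2.const_mul _), integral_add (i3'.const_mul _) (i4.const_mul _),
    integral_const_mul, integral_const_mul, integral_const_mul, integral_const_mul, integral_conj,
    h.covV _ _ hm hm' _ _ hs hr, h.covW _ _ hm hm' _ _ hs hr, h.covVW _ _ hm hm' _ _ hs hr,
    h.covVW _ _ hm' hm _ _ hr hs]
  split_ifs with hmm
  · subst hmm
    simp only [map_zero, mul_zero, zero_add, add_zero]
    push_cast; ring
  · simp

/-- A correlation function is bounded by one, by Cauchy--Schwarz. -/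
lemma IsVelocityProcess.abs_corr_le [IsProbabilityMeasure μ] (h : IsVelocityProcess μ ς Ξ Φ χ V W)
    (hχ : ∀ k, k ≠ 0 → 0 < χ k) {x : ℝ} (hx : 0 ≤ x) : |Φ x| ≤ 1 := by
  obtain ⟨k, hk⟩ := exists_ne (0 : Wave)
  have hk0 := hχ k hk
  have hs : 0 ≤ x / χ k := by positivity
  have h1 := h.covV k k hk hk (x / χ k) 0 hs le_rfl
  rw [if_pos rfl, sub_zero, abs_of_nonneg hs, mul_div_cancel₀ _ hk0.ne'] at h1
  have hp := h.properV k hk _ hs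
  have hq := h.properV k hk 0 le_rfl
  have isq : ∀ t, 0 ≤ t → Integrable (fun ω => ‖V k t ω‖ ^ 2) μ := fun t ht => by
    refine Integrable.of_bound ((h.measurable_V k t).norm.pow_const 2).aestronglyMeasurable (|Ξ| ^ 2) ?_
    filter_upwards [(h.properV k hk t ht).bound] with ω hω
    rw [norm_pow, norm_norm]
    exact pow_le_pow_left₀ (norm_nonneg _) (hω.trans (le_abs_self _)) 2
  have h2 : ‖∫ ω, V k (x / χ k) ω * (starRingEnd ℂ) (V k 0 ω) ∂μ‖ ≤
      ∫ ω, (2⁻¹ * ‖V k (x / χ k) ω‖ ^ 2 + 2⁻¹ * ‖V k 0 ω‖ ^ 2) ∂μ := by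
    refine norm_integral_le_of_norm_le (((isq _ hs).const_mul _).add ((isq 0 le_rfl).const_mul _))
      (Eventually.of_forall fun ω => ?_)
    rw [norm_mul, RCLike.norm_conj]
    nlinarith [sq_nonneg (‖V k (x / χ k) ω‖ - ‖V k 0 ω‖)]
  rw [integral_add ((isq _ hs).const_mul _) ((isq 0 le_rfl).const_mul _), integral_const_mul,
    integral_const_mul, hp.second, hq.second, h1, Complex.norm_real, Real.norm_eq_abs] at h2
  linarith

/-! ### The source -/

variable {α cg κg : ℝ} {γ : Wave → ℂ} {G : Ω → Wave → ℂ}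

lemma IsSourceAmplitude.summable (h : IsSourceAmplitude α cg κg γ) (hα : α < -4) :
    Summable fun k => wnorm k * ‖γ k‖ := by
  refine Summable.of_norm_bounded_eventually
    ((summable_wnorm_rpow (p := α + 1) (by linarith)).mul_left cg) ?_
  have hfin : {k : Wave | ¬ κg ≤ wnorm k}.Finite :=
    (finite_wnorm_le κg).subset fun k hk => (not_le.1 hk).le
  filter_upwards [hfin.compl_mem_cofinite] with k hk
  have hk1 : κg ≤ wnorm k := by simpa using hk
  have hk0 : 0 < wnorm k := by linarith [h.one_lt]
  rw [Real.norm_of_nonneg (mul_nonneg hk0.le (norm_nonneg _)), Real.rpow_add hk0, Real.rpow_one]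
  calc wnorm k * ‖γ k‖ ≤ wnorm k * (cg * wnorm k ^ α) :=
        mul_le_mul_of_nonneg_left (h.bound k hk1) hk0.le
    _ = _ := by ring

lemma IsSource.exists_bound (h : IsSource μ V W γ G) (hγ : γ 0 = 0) :
    ∃ B, 0 ≤ B ∧ ∀ᵐ ω ∂μ, ∀ k, ‖G ω k‖ ≤ B * ‖γ k‖ := by
  rcases h with h | ⟨ϱ, Ξ', Z, hZ, h⟩
  · exact ⟨1, zero_le_one, Eventually.of_forall fun ω k => by rw [h, one_mul]⟩
  · refine ⟨|Ξ'|, abs_nonneg _, ae_all_iff.2 fun k => ?_⟩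
    rcases eq_or_ne k 0 with rfl | hk
    · exact Eventually.of_forall fun ω => by rw [h, hγ]; simp
    · filter_upwards [(hZ.proper k hk).bound] with ω hω
      rw [h, norm_mul, mul_comm]
      exact mul_le_mul_of_nonneg_right (hω.trans (le_abs_self _)) (norm_nonneg _)

lemma IsSource.measurable (h : IsSource μ V W γ G) (k : Wave) : Measurable fun ω => G ω k := by
  rcases h with h | ⟨ϱ, Ξ', Z, hZ, h⟩
  · simp only [h]; exact measurable_const
  · simp only [h]; exact measurable_const.mul (hZ.meas k)

lemma h1Sq_ne_top {θ : Wave → ℂ} {B : ℝ} (h : IsSourceAmplitude α cg κg γ) (hα : α < -4)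
    (hθ : ∀ k, ‖θ k‖ ≤ B * ‖γ k‖) : h1Sq θ ≠ ⊤ := by
  have hs := summable_sq_of_summable
    (fun k => mul_nonneg (wnorm_nonneg k) (norm_nonneg (γ k))) (h.summable hα)
  refine (hs.mul_left (8 * Real.pi ^ 3 * 2 * B ^ 2)).of_nonneg_of_le (fun k => ?_) (fun k => ?_)
    |>.tsum_ofReal_ne_top
  · have := Real.pi_pos; positivity
  · have hpi := Real.pi_pos
    rcases eq_or_ne k 0 with rfl | hk
    · have h0 : ‖θ 0‖ = 0 := le_antisymm (by simpa [h.zero] using hθ 0) (norm_nonneg _)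
      simp [h0]
    · have h1 := one_le_wnorm_sq hk
      have h2 : ‖θ k‖ ^ 2 ≤ B ^ 2 * ‖γ k‖ ^ 2 := by
        rw [← mul_pow]; exact pow_le_pow_left₀ (norm_nonneg _) (hθ k) 2
      calc 8 * Real.pi ^ 3 * (1 + wnorm k ^ 2) * ‖θ k‖ ^ 2
          ≤ 8 * Real.pi ^ 3 * (2 * wnorm k ^ 2) * (B ^ 2 * ‖γ k‖ ^ 2) := by
            gcongr; linarith
        _ = _ := by ring

/-- Independence of source and velocity: the source contributes `|γ_j|²` on the diagonal. -/
lemma IsSource.exists_cov [IsProbabilityMeasure μ] (h : IsSource μ V W γ G)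
    (hV : IsVelocityProcess μ ς Ξ Φ χ V W) :
    ∃ c : Wave → Wave → ℂ, (∀ j, c j j = 1) ∧ ∀ j l m m' : Wave, j ≠ 0 → l ≠ 0 →
      ∀ (a b a' b' s r : ℝ), 0 ≤ s → 0 ≤ r →
      ∫ ω, (((a : ℂ) * V m s ω + (b : ℂ) * W m s ω) *
        (starRingEnd ℂ) ((a' : ℂ) * V m' r ω + (b' : ℂ) * W m' r ω)) *
        (G ω j * (starRingEnd ℂ) (G ω l)) ∂μ =
      (∫ ω, ((a : ℂ) * V m s ω + (b : ℂ) * W m s ω) *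
        (starRingEnd ℂ) ((a' : ℂ) * V m' r ω + (b' : ℂ) * W m' r ω) ∂μ) *
        (γ j * (starRingEnd ℂ) (γ l) * c j l) := by
  rcases h with h | ⟨ϱ, Ξ', Z, hZ, h⟩
  · refine ⟨fun _ _ => 1, fun _ => rfl, fun j l m m' _ _ a b a' b' s r _ _ => ?_⟩
    simp only [h]
    rw [integral_mul_const, mul_one]
  · refine ⟨fun j l => if j = l then 1 else 0, fun _ => if_pos rfl,
      fun j l m m' hj hl a b a' b' s r hs hr => ?_⟩
    set φ : (Wave × NNReal → ℂ × ℂ) → ℂ := fun x =>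
      ((a : ℂ) * (x (m, ⟨s, hs⟩)).1 + (b : ℂ) * (x (m, ⟨s, hs⟩)).2) *
        (starRingEnd ℂ) ((a' : ℂ) * (x (m', ⟨r, hr⟩)).1 + (b' : ℂ) * (x (m', ⟨r, hr⟩)).2) with hφ
    set ψ : (Wave → ℂ) → ℂ := fun z => z j * (starRingEnd ℂ) (z l) with hψ
    have hφm : Measurable φ := by
      have h1 : Measurable fun x : Wave × NNReal → ℂ × ℂ =>
          (a : ℂ) * (x (m, ⟨s, hs⟩)).1 + (b : ℂ) * (x (m, ⟨s, hs⟩)).2 := by fun_prop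
      have h2 : Measurable fun x : Wave × NNReal → ℂ × ℂ =>
          (a' : ℂ) * (x (m', ⟨r, hr⟩)).1 + (b' : ℂ) * (x (m', ⟨r, hr⟩)).2 := by fun_prop
      exact h1.mul (Complex.continuous_conj.measurable.comp h2)
    have hψm : Measurable ψ :=
      (measurable_pi_apply j).mul (Complex.continuous_conj.measurable.comp (measurable_pi_apply l))
    have hF : Measurable fun ω (p : Wave × NNReal) => (V p.1 (p.2 : ℝ) ω, W p.1 (p.2 : ℝ) ω) :=
      measurable_pi_lambda _ fun p => (hV.measurable_V _ _).prodMk (hV.measurable_W _ _)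
    have hZm : Measurable fun ω (k : Wave) => Z k ω := measurable_pi_lambda _ fun k => hZ.meas k
    have hi := (hZ.indep.comp hφm hψm).integral_fun_mul_eq_mul_integral
      (hφm.comp hF).aestronglyMeasurable (hψm.comp hZm).aestronglyMeasurable
    have hi' : ∫ ω, (((a : ℂ) * V m s ω + (b : ℂ) * W m s ω) *
        (starRingEnd ℂ) ((a' : ℂ) * V m' r ω + (b' : ℂ) * W m' r ω)) *
        (Z j ω * (starRingEnd ℂ) (Z l ω)) ∂μ =
      (∫ ω, ((a : ℂ) * V m s ω + (b : ℂ) * W m s ω) *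
        (starRingEnd ℂ) ((a' : ℂ) * V m' r ω + (b' : ℂ) * W m' r ω) ∂μ) *
        ∫ ω, Z j ω * (starRingEnd ℂ) (Z l ω) ∂μ := hi
    rw [hZ.cov j l hj hl] at hi'
    have e1 : ∀ ω, (((a : ℂ) * V m s ω + (b : ℂ) * W m s ω) *
        (starRingEnd ℂ) ((a' : ℂ) * V m' r ω + (b' : ℂ) * W m' r ω)) *
        (G ω j * (starRingEnd ℂ) (G ω l)) = (γ j * (starRingEnd ℂ) (γ l)) *
        ((((a : ℂ) * V m s ω + (b : ℂ) * W m s ω) *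
        (starRingEnd ℂ) ((a' : ℂ) * V m' r ω + (b' : ℂ) * W m' r ω)) *
        (Z j ω * (starRingEnd ℂ) (Z l ω))) := by
      intro ω; rw [h, h, map_mul]; ring
    simp only [e1]
    rw [integral_const_mul, hi']
    ring

end Probability

section Moments

variable {Ω : Type*} [MeasurableSpace Ω] {μ : Measure Ω} [IsProbabilityMeasure μ]
  {ς Ξ α β Ue Uf cg κg : ℝ} {Φ : ℝ → ℝ} {χ : Wave → ℝ} {V W : Wave → ℝ → Ω → ℂ} {n : ℕ}
  {e f : Wave → Fin 3 → ℝ} {γ : Wave → ℂ} {G : Ω → Wave → ℂ} {u : Ω → ℝ → Wave → Fin 3 → ℂ}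

lemma advectTerm_eq_zero (hu : ∀ ω t, u ω t = velocity β Ue Uf e f (fun k => V k t ω) (fun k => W k t ω))
    {k j : Wave} (hj : j = 0 ∨ j = k) (s : ℝ) (ω : Ω) : advectTerm (u ω s) (G ω) k j = 0 := by
  rcases hj with rfl | rfl
  · simp [advectTerm]
  · simp [advectTerm, hu, velocity_zero]

lemma advectTerm_eq (hu : ∀ ω t, u ω t = velocity β Ue Uf e f (fun k => V k t ω) (fun k => W k t ω))
    {k j : Wave} (hj : ¬(j = 0 ∨ j = k)) (s : ℝ) (ω : Ω) : advectTerm (u ω s) (G ω) k j =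
      Complex.I * (((wnorm (k - j) ^ β * Ue * rdot (e (k - j)) j : ℝ) : ℂ) * V (k - j) s ω +
      ((wnorm (k - j) ^ β * Uf * rdot (f (k - j)) j : ℝ) : ℂ) * W (k - j) s ω) * G ω j := by
  have hkj : k - j ≠ 0 := fun h => hj (Or.inr (sub_eq_zero.1 h).symm)
  rw [advectTerm, hu, velocity_dot _ _ _ _ _ _ _ hkj]

/-- The terms of `u · ∇Δ⁻¹g` at a fixed wavevector are uncorrelated and stationary. -/
lemma modeFamily_advectTerm (hβ : β ≤ 0) (hα : α < -4) (he : IsCrayaHerring e f)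
    (hΦ : IsCorrelation n Φ χ) (hV : IsVelocityProcess μ ς Ξ Φ χ V W)
    (hγ : IsSourceAmplitude α cg κg γ) (hG : IsSource μ V W γ G)
    (hu : ∀ ω t, u ω t = velocity β Ue Uf e f (fun k => V k t ω) (fun k => W k t ω)) (k : Wave) :
    ∃ M, ModeFamily μ (fun j s ω => advectTerm (u ω s) (G ω) k j) M
      (fun j x => spectralWeight β Ue Uf e f γ k j * Φ (χ (k - j) * x)) := by
  obtain ⟨B, hB0, hB⟩ := hG.exists_bound hγ.zero
  obtain ⟨c, hc1, hc⟩ := hG.exists_cov hV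
  refine ⟨fun j => (|Ue| + |Uf|) * |Ξ| * B * (wnorm j * ‖γ j‖), fun j => ?_,
    (hγ.summable hα).mul_left _, fun j s hs => ?_, fun j l s r hs hr => ?_, fun j => ?_⟩
  · have h1 : ∀ i, Measurable fun p : ℝ × Ω => u p.2 p.1 (k - j) i := fun i => by
      simp only [hu]; exact measurable_velocity hV β Ue Uf e f (k - j) i
    have h2 : Measurable fun p : ℝ × Ω => ∑ i, u p.2 p.1 (k - j) i * (j i : ℂ) :=
      Finset.measurable_fun_sum _ fun i _ => (h1 i).mul_const _
    exact (measurable_const.mul h2).mul ((hG.measurable j).comp measurable_snd)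
  · by_cases hj : j = 0 ∨ j = k
    · refine Eventually.of_forall fun ω => ?_
      rw [advectTerm_eq_zero hu hj, norm_zero]
      have := wnorm_nonneg j
      positivity
    · have hkj : k - j ≠ 0 := fun h => hj (Or.inr (sub_eq_zero.1 h).symm)
      filter_upwards [hB, (hV.properV _ hkj s hs).bound, (hV.properW _ hkj s hs).bound]
        with ω h1 h2 h3
      have hw : wnorm (k - j) ^ β ≤ 1 := Real.rpow_le_one_of_one_le_of_nonpos (one_le_wnorm hkj) hβ
      have hw0 : 0 ≤ wnorm (k - j) ^ β := Real.rpow_nonneg (wnorm_nonneg _) _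
      have hterm : ∀ (U x : ℝ) (z : ℂ), |x| ≤ wnorm j → ‖z‖ ≤ Ξ →
          ‖((wnorm (k - j) ^ β * U * x : ℝ) : ℂ) * z‖ ≤ |U| * wnorm j * |Ξ| := by
        intro U x z hx hz
        rw [norm_mul, Complex.norm_real, Real.norm_eq_abs, abs_mul, abs_mul, abs_of_nonneg hw0]
        refine mul_le_mul (mul_le_mul ?_ hx (abs_nonneg _) (abs_nonneg _))
          (hz.trans (le_abs_self _)) (norm_nonneg _) (mul_nonneg (abs_nonneg _) (wnorm_nonneg j))
        exact mul_le_of_le_one_left (abs_nonneg _) hw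
      rw [advectTerm_eq hu hj, norm_mul, norm_mul, Complex.norm_I, one_mul]
      calc _ ≤ (|Ue| * wnorm j * |Ξ| + |Uf| * wnorm j * |Ξ|) * (B * ‖γ j‖) := by
            refine mul_le_mul ((norm_add_le _ _).trans (add_le_add
              (hterm _ _ _ (he.abs_rdot_le hkj j).1 h2) (hterm _ _ _ (he.abs_rdot_le hkj j).2 h3)))
              (h1 j) (norm_nonneg _) ?_
            have := wnorm_nonneg j
            positivity
        _ = _ := by ring
  · by_cases hj : j = 0 ∨ j = k
    · simp only [advectTerm_eq_zero hu hj, zero_mul, integral_zero]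
      simp [spectralWeight, hj]
    by_cases hl : l = 0 ∨ l = k
    · simp only [advectTerm_eq_zero hu hl, map_zero, mul_zero, integral_zero]
      split_ifs with h
      · subst h; exact absurd hl hj
      · rfl
    have hkj : k - j ≠ 0 := fun h => hj (Or.inr (sub_eq_zero.1 h).symm)
    have hkl : k - l ≠ 0 := fun h => hl (Or.inr (sub_eq_zero.1 h).symm)
    have hj0 : j ≠ 0 := fun h => hj (Or.inl h)
    have hl0 : l ≠ 0 := fun h => hl (Or.inl h)
    have h1 := hc j l (k - j) (k - l) hj0 hl0 (wnorm (k - j) ^ β * Ue * rdot (e (k - j)) j)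
      (wnorm (k - j) ^ β * Uf * rdot (f (k - j)) j) (wnorm (k - l) ^ β * Ue * rdot (e (k - l)) l)
      (wnorm (k - l) ^ β * Uf * rdot (f (k - l)) l) s r hs hr
    rw [hV.integral_comb hkj hkl _ _ _ _ hs hr] at h1
    have h2 : ∀ ω, advectTerm (u ω s) (G ω) k j * (starRingEnd ℂ) (advectTerm (u ω r) (G ω) k l) =
        ((((wnorm (k - j) ^ β * Ue * rdot (e (k - j)) j : ℝ) : ℂ) * V (k - j) s ω +
        ((wnorm (k - j) ^ β * Uf * rdot (f (k - j)) j : ℝ) : ℂ) * W (k - j) s ω) *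
        (starRingEnd ℂ) (((wnorm (k - l) ^ β * Ue * rdot (e (k - l)) l : ℝ) : ℂ) * V (k - l) r ω +
        ((wnorm (k - l) ^ β * Uf * rdot (f (k - l)) l : ℝ) : ℂ) * W (k - l) r ω)) *
        (G ω j * (starRingEnd ℂ) (G ω l)) := by
      intro ω
      rw [advectTerm_eq hu hj, advectTerm_eq hu hl, map_mul, map_mul, Complex.conj_I]
      linear_combination (-(((wnorm (k - j) ^ β * Ue * rdot (e (k - j)) j : ℝ) : ℂ) * V (k - j) s ω +
        ((wnorm (k - j) ^ β * Uf * rdot (f (k - j)) j : ℝ) : ℂ) * W (k - j) s ω) *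
        (starRingEnd ℂ) (((wnorm (k - l) ^ β * Ue * rdot (e (k - l)) l : ℝ) : ℂ) * V (k - l) r ω +
        ((wnorm (k - l) ^ β * Uf * rdot (f (k - l)) l : ℝ) : ℂ) * W (k - l) r ω) *
        (G ω j * (starRingEnd ℂ) (G ω l))) * Complex.I_mul_I
    simp only [h2]
    rw [h1]
    by_cases hjl : j = l
    · subst hjl
      rw [if_pos rfl, if_pos rfl, hc1, mul_one, Complex.mul_conj, Complex.normSq_eq_norm_sq,
        ← Complex.ofReal_mul]
      congr 1
      have hr2 : wnorm (k - j) ^ (2 * β) = wnorm (k - j) ^ β * wnorm (k - j) ^ β := by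
        rw [← Real.rpow_add (wnorm_pos hkj)]; ring_nf
      rw [spectralWeight, if_neg hj, hr2]
      ring
    · rw [if_neg (fun h => hjl (sub_right_injective h)), if_neg hjl, zero_mul]
  · by_cases hj : j = 0 ∨ j = k
    · simp only [spectralWeight, if_pos hj, zero_mul]; exact continuous_const
    · have hkj : k - j ≠ 0 := fun h => hj (Or.inr (sub_eq_zero.1 h).symm)
      refine continuous_const.mul ?_
      exact hΦ.smooth.continuousOn.comp_continuous (by fun_prop)
        fun x => mul_nonneg (hΦ.pos _ hkj).le (abs_nonneg x)

/-- The transform `J(x) = ∫₀^∞ e^{-s} Φ(xs) ds` of the correlation function, which weighs each mode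
of the limiting spectrum. -/
noncomputable def corrTransform (Φ : ℝ → ℝ) (x : ℝ) : ℝ :=
  ∫ s in Ioi (0 : ℝ), Real.exp (-s) * Φ (x * s)

lemma integral_exp_mul_corr (Φ : ℝ → ℝ) (c : ℝ) {l : ℝ} (hl : 0 < l) :
    ∫ x in Ioi (0 : ℝ), Real.exp (-x * l) * Φ (c * x) = l⁻¹ * corrTransform Φ (c / l) := by
  have h := integral_comp_mul_left_Ioi (fun s => Real.exp (-s) * Φ (c / l * s)) 0 hl
  rw [mul_zero, smul_eq_mul] at h
  rw [corrTransform, ← h]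
  refine setIntegral_congr_fun measurableSet_Ioi fun x _ => ?_
  have : c / l * (l * x) = c * x := by field_simp
  simp only [this]
  ring_nf

lemma memLp_vartheta (hβ : β ≤ 0) (hα : α < -4) (he : IsCrayaHerring e f)
    (hΦ : IsCorrelation n Φ χ) (hV : IsVelocityProcess μ ς Ξ Φ χ V W)
    (hγ : IsSourceAmplitude α cg κg γ) (hG : IsSource μ V W γ G)
    (hu : ∀ ω t, u ω t = velocity β Ue Uf e f (fun k => V k t ω) (fun k => W k t ω))
    {t : ℝ} (ht : 0 ≤ t) (k : Wave) : MemLp (fun ω => vartheta (u ω) (G ω) t k) 2 μ := by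
  obtain ⟨M, hM⟩ := modeFamily_advectTerm hβ hα he hΦ hV hγ hG hu k
  exact hM.memLp_heatInt (sq_nonneg _) ht

lemma summable_spectralWeight (hβ : β ≤ 0) (hα : α < -4) (he : IsCrayaHerring e f)
    (hΦ : IsCorrelation n Φ χ) (hV : IsVelocityProcess μ ς Ξ Φ χ V W)
    (hγ : IsSourceAmplitude α cg κg γ) (hG : IsSource μ V W γ G)
    (hu : ∀ ω t, u ω t = velocity β Ue Uf e f (fun k => V k t ω) (fun k => W k t ω)) (k : Wave) :
    Summable fun j => spectralWeight β Ue Uf e f γ k j := by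
  obtain ⟨M, hM⟩ := modeFamily_advectTerm hβ hα he hΦ hV hγ hG hu k
  simpa [hΦ.zero] using hM.summable_cov 0

lemma tendsto_integral_vartheta (hβ : β ≤ 0) (hα : α < -4) (he : IsCrayaHerring e f)
    (hΦ : IsCorrelation n Φ χ) (hV : IsVelocityProcess μ ς Ξ Φ χ V W)
    (hγ : IsSourceAmplitude α cg κg γ) (hG : IsSource μ V W γ G)
    (hu : ∀ ω t, u ω t = velocity β Ue Uf e f (fun k => V k t ω) (fun k => W k t ω))
    {k : Wave} (hk : k ≠ 0) :
    Tendsto (fun t => ∫ ω, ‖vartheta (u ω) (G ω) t k‖ ^ 2 ∂μ) atTop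
      (𝓝 ((wnorm k ^ 4)⁻¹ * ∑' j, spectralWeight β Ue Uf e f γ k j *
        corrTransform Φ (χ (k - j) / wnorm k ^ 2))) := by
  obtain ⟨M, hM⟩ := modeFamily_advectTerm hβ hα he hΦ hV hγ hG hu k
  have hl : 0 < wnorm k ^ 2 := pow_pos (wnorm_pos hk) 2
  have h := hM.tendsto_integral_norm_heatInt_sq hl
  have hlim : (wnorm k ^ 4)⁻¹ * ∑' j, spectralWeight β Ue Uf e f γ k j *
      corrTransform Φ (χ (k - j) / wnorm k ^ 2) = (wnorm k ^ 2)⁻¹ * ∑' j, ∫ x in Ioi (0 : ℝ),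
        Real.exp (-x * wnorm k ^ 2) * (spectralWeight β Ue Uf e f γ k j * Φ (χ (k - j) * x)) := by
    rw [show (wnorm k ^ 4)⁻¹ = (wnorm k ^ 2)⁻¹ * (wnorm k ^ 2)⁻¹ by rw [← mul_inv]; ring_nf,
      mul_assoc, ← tsum_mul_left]
    congr 1
    refine tsum_congr fun j => ?_
    simp only [mul_left_comm (Real.exp _)]
    rw [integral_const_mul, integral_exp_mul_corr Φ _ hl]
    ring
  rw [hlim]
  exact h

lemma integral_staticVartheta (hβ : β ≤ 0) (hα : α < -4) (he : IsCrayaHerring e f)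
    (hΦ : IsCorrelation n Φ χ) (hV : IsVelocityProcess μ ς Ξ Φ χ V W)
    (hγ : IsSourceAmplitude α cg κg γ) (hG : IsSource μ V W γ G)
    (hu : ∀ ω t, u ω t = velocity β Ue Uf e f (fun k => V k t ω) (fun k => W k t ω))
    {s₀ : ℝ} (hs : 0 ≤ s₀) (k : Wave) :
    ∫ ω, ‖staticVartheta (u ω s₀) (G ω) k‖ ^ 2 ∂μ =
      (wnorm k ^ 4)⁻¹ * ∑' j, spectralWeight β Ue Uf e f γ k j := by
  obtain ⟨M, hM⟩ := modeFamily_advectTerm hβ hα he hΦ hV hγ hG hu k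
  have h := hM.integral_norm_tsum_sq hs
  simp only [mul_zero, hΦ.zero, mul_one] at h
  rw [← h, ← integral_const_mul]
  refine integral_congr_ae (Eventually.of_forall fun ω => ?_)
  simp only [staticVartheta, norm_mul, Complex.norm_real, advect_eq_tsum, mul_pow,
    Real.norm_eq_abs, sq_abs]
  congr 1
  rw [inv_pow, ← pow_mul]

end Moments

/-! ### Expansion of the correlation transform -/

/-- A function on `[0,∞)` that is bounded by one, equals one at the origin and is continuously
differentiable leaves the value one at most linearly. -/
lemma exists_abs_sub_one_le {Φ : ℝ → ℝ} {n : ℕ} (hn : 2 ≤ n) (hs : ContDiffOn ℝ n Φ (Ici 0))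
    (h0 : Φ 0 = 1) (hb : ∀ x, 0 ≤ x → |Φ x| ≤ 1) :
    ∃ c : ℝ, 0 ≤ c ∧ ∀ s, 0 ≤ s → |Φ s - 1| ≤ c * s := by
  have hs1 : ContDiffOn ℝ 1 Φ (Ici 0) := hs.of_le (by exact_mod_cast (by omega : 1 ≤ n))
  have hd := hs1.differentiableOn one_ne_zero
  have hc := hs1.continuousOn_derivWithin (uniqueDiffOn_Ici 0) le_rfl
  obtain ⟨c, hc⟩ := (isCompact_Icc (a := (0 : ℝ)) (b := 1)).exists_bound_of_continuousOn
    (hc.mono Icc_subset_Ici_self)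
  have hc0 : 0 ≤ c := (norm_nonneg _).trans (hc 0 ⟨le_rfl, zero_le_one⟩)
  refine ⟨c + 2, by linarith, fun s hs0 => ?_⟩
  rcases le_total s 1 with h | h
  · have := Convex.norm_image_sub_le_of_norm_hasDerivWithin_le (s := Icc (0 : ℝ) 1) (f := Φ)
      (f' := derivWithin Φ (Ici 0)) (C := c) (x := 0) (y := s)
      (fun x hx => ((hd x hx.1).hasDerivWithinAt).mono Icc_subset_Ici_self) hc (convex_Icc 0 1)
      ⟨le_rfl, zero_le_one⟩ ⟨hs0, h⟩
    rw [h0, sub_zero, Real.norm_eq_abs, Real.norm_eq_abs, abs_of_nonneg hs0] at this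
    nlinarith
  · calc |Φ s - 1| ≤ |Φ s| + |1| := abs_sub _ _
      _ ≤ 2 := by rw [abs_one]; linarith [hb s hs0]
      _ ≤ _ := by nlinarith

open Classical in
/-- A constant `c ≥ 0` with `|Φ(s) - 1| ≤ c s` for all `s ≥ 0` (zero if there is none). -/
noncomputable def corrSlope (Φ : ℝ → ℝ) : ℝ :=
  if h : ∃ c : ℝ, 0 ≤ c ∧ ∀ s, 0 ≤ s → |Φ s - 1| ≤ c * s then h.choose else 0

lemma corrSlope_nonneg (Φ : ℝ → ℝ) : 0 ≤ corrSlope Φ := by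
  unfold corrSlope
  split_ifs with h
  · exact h.choose_spec.1
  · exact le_rfl

lemma abs_sub_one_le_corrSlope {Φ : ℝ → ℝ}
    (h : ∃ c : ℝ, 0 ≤ c ∧ ∀ s, 0 ≤ s → |Φ s - 1| ≤ c * s) {s : ℝ} (hs : 0 ≤ s) :
    |Φ s - 1| ≤ corrSlope Φ * s := by
  unfold corrSlope
  rw [dif_pos h]
  exact h.choose_spec.2 s hs

lemma integrableOn_exp_neg_mul {h : ℝ → ℝ} (hc : ContinuousOn h (Ici 0)) {H : ℝ}
    (hH : ∀ s, 0 ≤ s → |h s| ≤ H) {a : ℝ} (ha : 0 < a) :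
    IntegrableOn (fun s => Real.exp (-(a * s)) * h s) (Ioi 0) := by
  have h1 : IntegrableOn (fun s => Real.exp (-(a * s))) (Ioi 0) := by
    simpa only [neg_mul] using exp_neg_integrableOn_Ioi 0 ha
  refine (h1.mul_const H).mono' (((by fun_prop : Continuous fun s => Real.exp (-(a * s))).continuousOn.mul
    (hc.mono Ioi_subset_Ici_self)).aestronglyMeasurable measurableSet_Ioi) ?_
  refine (ae_restrict_iff' measurableSet_Ioi).2 (Eventually.of_forall fun s hs => ?_)
  rw [norm_mul, Real.norm_eq_abs, Real.norm_eq_abs, Real.abs_exp]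
  exact mul_le_mul_of_nonneg_left (hH s (le_of_lt hs)) (Real.exp_pos _).le

lemma abs_corrTransform_le {Φ : ℝ → ℝ} (hb : ∀ x, 0 ≤ x → |Φ x| ≤ 1) {x : ℝ} (hx : 0 ≤ x) : |corrTransform Φ x| ≤ 1 := by
  have h1 : IntegrableOn (fun s => Real.exp (-s)) (Ioi (0 : ℝ)) := by
    simpa using exp_neg_integrableOn_Ioi 0 one_pos
  rw [corrTransform, ← Real.norm_eq_abs]
  refine (norm_integral_le_of_norm_le h1 ?_).trans_eq integral_exp_neg_Ioi_zero
  refine (ae_restrict_iff' measurableSet_Ioi).2 (Eventually.of_forall fun s hs => ?_)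
  rw [norm_mul, Real.norm_eq_abs, Real.norm_eq_abs, Real.abs_exp]
  exact mul_le_of_le_one_right (Real.exp_pos _).le (hb _ (mul_nonneg hx (le_of_lt hs)))

lemma abs_corrTransform_sub_one_le {Φ : ℝ → ℝ} (hcont : ContinuousOn Φ (Ici 0)) {c : ℝ}
    (hb : ∀ x, 0 ≤ x → |Φ x| ≤ 1) (hc : ∀ s, 0 ≤ s → |Φ s - 1| ≤ c * s) {x : ℝ} (hx : 0 ≤ x) :
    |corrTransform Φ x - 1| ≤ c * x := by
  have h1 : IntegrableOn (fun s => Real.exp (-s)) (Ioi (0 : ℝ)) := by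
    simpa using exp_neg_integrableOn_Ioi 0 one_pos
  have h2 : IntegrableOn (fun s => Real.exp (-s) * Φ (x * s)) (Ioi (0 : ℝ)) := by
    simpa only [one_mul] using integrableOn_exp_neg_mul (h := fun s => Φ (x * s)) (H := 1)
      (hcont.comp (by fun_prop) fun s hs => mul_nonneg hx hs)
      (fun s hs => hb _ (mul_nonneg hx hs)) one_pos
  have h3 : IntegrableOn (fun s : ℝ => Real.exp (-s) * s) (Ioi (0 : ℝ)) := by
    have := Real.GammaIntegral_convergent (s := 2) two_pos
    norm_num at this
    exact this
  have h4 : ∫ s in Ioi (0 : ℝ), Real.exp (-s) * s = 1 := by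
    have := Real.Gamma_eq_integral (s := 2) two_pos
    norm_num at this
    rw [← this]
  have h5 : corrTransform Φ x - 1 = ∫ s in Ioi (0 : ℝ), Real.exp (-s) * (Φ (x * s) - 1) := by
    simp only [mul_sub, mul_one]
    rw [integral_sub h2 h1, integral_exp_neg_Ioi_zero, corrTransform]
  rw [h5, ← Real.norm_eq_abs]
  have h6 : ∫ s in Ioi (0 : ℝ), c * x * (Real.exp (-s) * s) = c * x := by
    rw [integral_const_mul, h4, mul_one]
  refine (norm_integral_le_of_norm_le (h3.const_mul (c * x)) ?_).trans_eq h6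
  refine (ae_restrict_iff' measurableSet_Ioi).2 (Eventually.of_forall fun s hs => ?_)
  rw [norm_mul, Real.norm_eq_abs, Real.norm_eq_abs, Real.abs_exp]
  calc _ ≤ Real.exp (-s) * (c * (x * s)) :=
        mul_le_mul_of_nonneg_left (hc _ (mul_nonneg hx (le_of_lt hs))) (Real.exp_pos _).le
    _ = _ := by ring

/-- Integration by parts against `e^{-as}` on the half-line. Integrability of `e^{-as} h'` suffices:
the primitive `P` of `|h'|` dominates `h`, and `a ∫₀ᵀ e^{-as} P ≤ P(0) + ∫₀^∞ e^{-as} |h'|`. -/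
lemma integral_exp_mul_eq_of_hasDerivAt {h h' : ℝ → ℝ}
    (hd : ∀ s ∈ Ioi (0 : ℝ), HasDerivAt h (h' s) s)
    (hc : ContinuousOn h (Ici 0)) (hc' : ContinuousOn h' (Ici 0)) {a : ℝ} (ha : 0 < a)
    (hi : IntegrableOn (fun s => Real.exp (-(a * s)) * h' s) (Ioi 0)) :
    IntegrableOn (fun s => Real.exp (-(a * s)) * h s) (Ioi 0) ∧
    a * ∫ s in Ioi (0 : ℝ), Real.exp (-(a * s)) * h s =
      h 0 + ∫ s in Ioi (0 : ℝ), Real.exp (-(a * s)) * h' s := by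
  have hec : Continuous fun s => Real.exp (-(a * s)) := by fun_prop
  have hed : ∀ s, HasDerivAt (fun s => Real.exp (-(a * s))) (Real.exp (-(a * s)) * (-a)) s :=
    fun s => by simpa using (((hasDerivAt_id s).const_mul a).neg).exp
  -- a continuous extension of `h'` to the whole line, so that its primitive is differentiable
  set q : ℝ → ℝ := fun s => h' (max s 0) with hq
  have hqc : Continuous q := hc'.comp_continuous (by fun_prop) fun s => mem_Ici.2 (le_max_right _ _)
  have hqe : ∀ s, 0 ≤ s → q s = h' s := fun s hs => by simp only [hq, max_eq_left hs]
  set P : ℝ → ℝ := fun s => |h 0| + ∫ r in (0 : ℝ)..s, |q r| with hP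
  have hPd : ∀ s, HasDerivAt P (|q s|) s := fun s =>
    ((hqc.abs.integral_hasStrictDerivAt 0 s).hasDerivAt).const_add _
  have hPc : Continuous P := continuous_iff_continuousAt.2 fun s => (hPd s).continuousAt
  have hhP : ∀ s, 0 ≤ s → |h s| ≤ P s := by
    intro s hs
    have h1 : ∫ r in (0 : ℝ)..s, q r = h s - h 0 :=
      intervalIntegral.integral_eq_sub_of_hasDerivAt_of_le hs (hc.mono Icc_subset_Ici_self)
        (fun r hr => by rw [hqe r hr.1.le]; exact hd r hr.1) (hqc.intervalIntegrable _ _)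
    have h2 := intervalIntegral.abs_integral_le_integral_abs (f := q) (μ := volume) hs
    rw [h1] at h2
    have h3 := abs_sub_abs_le_abs_sub (h s) (h 0)
    simp only [hP]
    linarith
  have hP0 : ∀ s, 0 ≤ s → 0 ≤ P s := fun s hs => (abs_nonneg _).trans (hhP s hs)
  have hPi : IntegrableOn (fun s => Real.exp (-(a * s)) * P s) (Ioi 0) := by
    refine integrableOn_Ioi_of_intervalIntegral_norm_bounded
      (a⁻¹ * (|h 0| + ∫ s in Ioi (0 : ℝ), |Real.exp (-(a * s)) * h' s|)) (a := 0) (b := id)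
      (l := atTop) (fun i => (hec.mul hPc).integrableOn_Ioc) tendsto_id
      ((eventually_ge_atTop 0).mono fun T hT => ?_)
    have h1 : ∫ s in (0 : ℝ)..T, (Real.exp (-(a * s)) * (-a) * P s + Real.exp (-(a * s)) * |q s|) =
        Real.exp (-(a * T)) * P T - Real.exp (-(a * 0)) * P 0 :=
      intervalIntegral.integral_eq_sub_of_hasDerivAt
        (fun s _ => (hed s).mul (hPd s))
        (Continuous.intervalIntegrable (by fun_prop) _ _)
    rw [intervalIntegral.integral_add (Continuous.intervalIntegrable (by fun_prop) _ _)
      (Continuous.intervalIntegrable (by fun_prop) _ _)] at h1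
    have h2 : ∫ s in (0 : ℝ)..T, Real.exp (-(a * s)) * (-a) * P s =
        -a * ∫ s in (0 : ℝ)..T, Real.exp (-(a * s)) * P s := by
      rw [← intervalIntegral.integral_const_mul]
      exact intervalIntegral.integral_congr fun s _ => by ring
    have h3 : ∫ s in (0 : ℝ)..T, Real.exp (-(a * s)) * |q s| ≤
        ∫ s in Ioi (0 : ℝ), |Real.exp (-(a * s)) * h' s| := by
      rw [intervalIntegral.integral_of_le hT]
      calc _ = ∫ s in Ioc 0 T, |Real.exp (-(a * s)) * h' s| :=
            setIntegral_congr_fun measurableSet_Ioc fun s hs => by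
              simp only [hqe s hs.1.le, abs_mul, Real.abs_exp]
        _ ≤ _ := setIntegral_mono_set hi.abs (Eventually.of_forall fun s => abs_nonneg _)
              (Eventually.of_forall fun s hs => hs.1)
    have h4 : ∫ s in (0 : ℝ)..T, ‖Real.exp (-(a * s)) * P s‖ =
        ∫ s in (0 : ℝ)..T, Real.exp (-(a * s)) * P s :=
      intervalIntegral.integral_congr fun s hs => by
        rw [uIcc_of_le hT] at hs
        exact Real.norm_of_nonneg (mul_nonneg (Real.exp_pos _).le (hP0 s hs.1))
    have h5 : P 0 = |h 0| := by simp [hP]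
    have h6 : 0 ≤ Real.exp (-(a * T)) * P T := mul_nonneg (Real.exp_pos _).le (hP0 T hT)
    rw [h2, h5, mul_zero, neg_zero, Real.exp_zero, one_mul] at h1
    rw [id, h4, inv_mul_eq_div, le_div_iff₀ ha]
    linarith
  have hint : IntegrableOn (fun s => Real.exp (-(a * s)) * h s) (Ioi 0) := by
    refine hPi.mono' ((hec.continuousOn.mul
      (hc.mono Ioi_subset_Ici_self)).aestronglyMeasurable measurableSet_Ioi) ?_
    refine (ae_restrict_iff' measurableSet_Ioi).2 (Eventually.of_forall fun s hs => ?_)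
    rw [norm_mul, Real.norm_eq_abs, Real.norm_eq_abs, Real.abs_exp]
    exact mul_le_mul_of_nonneg_left (hhP s (le_of_lt hs)) (Real.exp_pos _).le
  refine ⟨hint, ?_⟩
  have hgd : ∀ s ∈ Ioi (0 : ℝ), HasDerivAt (fun s => Real.exp (-(a * s)) * h s)
      (Real.exp (-(a * s)) * h' s - a * (Real.exp (-(a * s)) * h s)) s := fun s hs => by
    refine ((hed s).mul (hd s hs)).congr_deriv ?_
    ring
  have hgi := hi.sub (hint.const_mul a)
  have hlim := tendsto_zero_of_hasDerivAt_of_integrableOn_Ioi hgd hgi hint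
  have hI : ∫ s in Ioi (0 : ℝ), (Real.exp (-(a * s)) * h' s - a * (Real.exp (-(a * s)) * h s)) =
      0 - Real.exp (-(a * 0)) * h 0 := integral_Ioi_of_hasDerivAt_of_tendsto
    ((hec.continuousOn.mul hc).continuousWithinAt (x := 0) self_mem_Ici) hgd hgi hlim
  rw [integral_sub hi (hint.const_mul a), integral_const_mul] at hI
  simp only [mul_zero, neg_zero, Real.exp_zero, one_mul] at hI
  linarith

/-- Repeated integration by parts turns the transform of the correlation function into its finite
expansion in powers of `χ/|k|²`. -/
lemma corrTransform_eq_correlationExpansion {n : ℕ} {Φ : ℝ → ℝ} (hn : 1 ≤ n)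
    (hs : ContDiffOn ℝ n Φ (Ici 0)) (h0 : Φ 0 = 1) {x : ℝ} (hx : 0 < x) {k : Wave} (hk : k ≠ 0)
    (hi : IntegrableOn (remainderIntegrand n Φ x k) (Ioi 0)) :
    corrTransform Φ (x / wnorm k ^ 2) = correlationExpansion n Φ x k := by
  have hk2 : 0 < wnorm k ^ 2 := pow_pos (wnorm_pos hk) 2
  set y := x / wnorm k ^ 2 with hy
  have hy0 : 0 < y := div_pos hx hk2
  set a := y⁻¹ with ha
  have ha0 : 0 < a := inv_pos.2 hy0
  set D : ℕ → ℝ → ℝ := fun i => iteratedDerivWithin i Φ (Ici 0) with hD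
  have hrem : ∀ i, remainderIntegrand i Φ x k = fun s => Real.exp (-(a * s)) * D i s := fun i => by
    funext s
    rw [remainderIntegrand]
    congr 3
    rw [ha, hy]
    field_simp
  have hDc : ∀ i ≤ n, ContinuousOn (D i) (Ici 0) := fun i hin =>
    hs.continuousOn_iteratedDerivWithin (by exact_mod_cast hin) (uniqueDiffOn_Ici 0)
  have hDd : ∀ i < n, ∀ s ∈ Ioi (0 : ℝ), HasDerivAt (D i) (D (i + 1) s) s := fun i hin s hs0 => by
    have h1 := (hs.differentiableOn_iteratedDerivWithin (m := i) (by exact_mod_cast hin)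
      (uniqueDiffOn_Ici 0)) s (Ioi_subset_Ici_self hs0)
    have h2 := h1.hasDerivWithinAt.hasDerivAt (Ici_mem_nhds hs0)
    rwa [← iteratedDerivWithin_succ] at h2
  rw [hrem] at hi
  -- integrability descends from the highest derivative to all lower ones
  have hint : ∀ i ≤ n, IntegrableOn (fun s => Real.exp (-(a * s)) * D (n - i) s) (Ioi 0) := by
    intro i
    induction i with
    | zero => exact fun _ => hi
    | succ i ih =>
      intro hin
      have h1 := ih (by omega)
      rw [show n - i = (n - (i + 1)) + 1 by omega] at h1
      exact (integral_exp_mul_eq_of_hasDerivAt (hDd _ (by omega)) (hDc _ (by omega))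
        (hDc _ (by omega)) ha0 h1).1
  have hstep : ∀ i < n, a * ∫ s in Ioi (0 : ℝ), Real.exp (-(a * s)) * D i s =
      D i 0 + ∫ s in Ioi (0 : ℝ), Real.exp (-(a * s)) * D (i + 1) s := fun i hin => by
    have h1 := hint (n - (i + 1)) (by omega)
    rw [show n - (n - (i + 1)) = i + 1 by omega] at h1
    exact (integral_exp_mul_eq_of_hasDerivAt (hDd i hin) (hDc i hin.le) (hDc _ hin) ha0 h1).2
  have hJ : corrTransform Φ y = a * ∫ s in Ioi (0 : ℝ), Real.exp (-(a * s)) * D 0 s := by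
    have h1 := integral_exp_mul_corr Φ 1 ha0
    rw [show 1 / a = y by rw [ha, one_div, inv_inv]] at h1
    have h2 : ∫ s in Ioi (0 : ℝ), Real.exp (-s * a) * Φ (1 * s) =
        ∫ s in Ioi (0 : ℝ), Real.exp (-(a * s)) * D 0 s := by
      congr 1
      funext s
      simp only [hD, iteratedDerivWithin_zero, one_mul]
      ring_nf
    rw [← h2, h1, mul_inv_cancel_left₀ ha0.ne']
  have hmain : ∀ i, 1 ≤ i → i ≤ n → corrTransform Φ y =
      (1 + ∑ l ∈ Finset.Ico 1 i, y ^ l * D l 0) +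
        y ^ (i - 1) * ∫ s in Ioi (0 : ℝ), Real.exp (-(a * s)) * D i s := by
    intro i hi1
    induction i, hi1 using Nat.le_induction with
    | base =>
      intro h1n
      rw [hJ, hstep 0 h1n]
      simp [hD, h0]
    | succ i hi1 ih =>
      intro hin
      have hst := hstep i (by omega)
      have hya : y ^ (i - 1) = y ^ i * a := by
        rw [ha, ← div_eq_mul_inv, eq_div_iff hy0.ne', ← pow_succ, Nat.sub_add_cancel hi1]
      rw [ih (by omega), Finset.sum_Ico_succ_top hi1, Nat.add_sub_cancel, hya, mul_assoc, hst]
      ring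
  rw [hmain n hn le_rfl, correlationExpansion, hrem]

/-! ### The static spectrum on a shell -/

lemma wdot_le (k j : Wave) : wdot k j ^ 2 ≤ wnorm k ^ 2 * wnorm j ^ 2 := by
  rw [wnorm_sq, wnorm_sq, wdot]
  exact Finset.sum_mul_sq_le_sq_mul_sq _ _ _

/-- `|k × j|²` is unchanged when `k` is replaced by `k - j`. -/
lemma wnorm_sq_mul_sub_wdot_sq (k j : Wave) :
    wnorm j ^ 2 * wnorm (k - j) ^ 2 - wdot (k - j) j ^ 2 =
      wnorm j ^ 2 * wnorm k ^ 2 - wdot k j ^ 2 := by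
  simp only [wnorm_sq, wdot, Fin.sum_univ_three, Pi.sub_apply, Int.cast_sub]
  ring

lemma spectralWeight_eq {β U : ℝ} {e f : Wave → Fin 3 → ℝ} (he : IsCrayaHerring e f)
    (γ : Wave → ℂ) {k j : Wave} (hj : j ≠ k) : spectralWeight β U U e f γ k j =
      U ^ 2 * ‖γ j‖ ^ 2 * (wnorm (k - j) ^ (2 * β - 2) *
        (wnorm j ^ 2 * wnorm k ^ 2 - wdot k j ^ 2)) := by
  by_cases h0 : j = 0
  · subst h0
    simp [spectralWeight, wdot]
  have hkj : k - j ≠ 0 := fun h => hj (sub_eq_zero.1 h).symm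
  have hm := wnorm_pos hkj
  rw [spectralWeight, if_neg (by tauto), ← mul_add, he.sq_add_sq hkj, ← wnorm_sq_mul_sub_wdot_sq k j,
    Real.rpow_sub hm, Real.rpow_two]
  field_simp

lemma spectralWeight_nonneg (β Ue Uf : ℝ) (e f : Wave → Fin 3 → ℝ) (γ : Wave → ℂ) (k j : Wave) :
    0 ≤ spectralWeight β Ue Uf e f γ k j := by
  rw [spectralWeight]
  split_ifs
  · exact le_rfl
  · have := Real.rpow_nonneg (wnorm_nonneg (k - j)) (2 * β)
    positivity

lemma spectralWeight_le {β U : ℝ} {e f : Wave → Fin 3 → ℝ} (he : IsCrayaHerring e f)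
    (γ : Wave → ℂ) (k j : Wave) : spectralWeight β U U e f γ k j ≤
      U ^ 2 * (wnorm j ^ 2 * ‖γ j‖ ^ 2) * wnorm (k - j) ^ (2 * β) := by
  have hr := Real.rpow_nonneg (wnorm_nonneg (k - j)) (2 * β)
  by_cases h : j = 0 ∨ j = k
  · rw [spectralWeight, if_pos h]
    positivity
  have hkj : k - j ≠ 0 := fun h' => h (Or.inr (sub_eq_zero.1 h').symm)
  rw [spectralWeight, if_neg h, ← mul_add, he.sq_add_sq hkj]
  have h1 : wnorm j ^ 2 - wdot (k - j) j ^ 2 / wnorm (k - j) ^ 2 ≤ wnorm j ^ 2 :=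
    sub_le_self _ (by positivity)
  calc _ ≤ U ^ 2 * wnorm j ^ 2 * wnorm (k - j) ^ (2 * β) * ‖γ j‖ ^ 2 := by gcongr
    _ = _ := by ring

lemma abs_rpow_sub_rpow_le {s x y : ℝ} (hs : s ≤ 0) (hy : 0 < y) (hx : y / 2 ≤ x) :
    |x ^ s - y ^ s| ≤ -s * (2 : ℝ) ^ (1 - s) * y ^ (s - 1) * |x - y| := by
  have h2 : 0 < y / 2 := by positivity
  have := Convex.norm_image_sub_le_of_norm_hasDerivWithin_le (s := Ici (y / 2)) (f := fun x => x ^ s)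
    (f' := fun x => s * x ^ (s - 1)) (C := -s * (2 : ℝ) ^ (1 - s) * y ^ (s - 1)) (x := y) (y := x)
    (fun z hz => (Real.hasDerivAt_rpow_const (Or.inl (h2.trans_le hz).ne')).hasDerivWithinAt)
    (fun z hz => ?_) (convex_Ici _) (by simp only [mem_Ici]; linarith) hx
  · simpa [Real.norm_eq_abs] using this
  · have hz' : y / 2 ≤ z := hz
    rw [norm_mul, Real.norm_eq_abs, Real.norm_eq_abs, abs_of_nonpos hs,
      abs_of_nonneg (Real.rpow_nonneg (h2.le.trans hz') _), mul_assoc]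
    refine mul_le_mul_of_nonneg_left ?_ (by linarith)
    calc z ^ (s - 1) ≤ (y / 2) ^ (s - 1) :=
          Real.rpow_le_rpow_of_nonpos h2 hz' (by linarith)
      _ = _ := by
          rw [Real.div_rpow hy.le two_pos.le, show (1 - s) = -(s - 1) by ring,
            Real.rpow_neg two_pos.le, div_eq_mul_inv, mul_comm]

lemma abs_spectralWeight_sub_le {β U : ℝ} (hβ : β ≤ 0) {e f : Wave → Fin 3 → ℝ}
    (he : IsCrayaHerring e f) (γ : Wave → ℂ) {k j : Wave} (hk : k ≠ 0) (hj : 2 * wnorm j ≤ wnorm k) :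
    |(wnorm k ^ 4)⁻¹ * spectralWeight β U U e f γ k j - U ^ 2 * ‖γ j‖ ^ 2 *
      (wnorm k ^ (2 * β - 6) * (wnorm j ^ 2 * wnorm k ^ 2 - wdot k j ^ 2))| ≤
    U ^ 2 * (wnorm j ^ 2 * ‖γ j‖ ^ 2) *
      ((2 - 2 * β) * 2 ^ (3 - 2 * β) * wnorm j * wnorm k ^ (2 * β - 5)) := by
  have hk0 := wnorm_pos hk
  have hjk : j ≠ k := by
    rintro rfl
    linarith
  have hd := abs_wnorm_sub_sub_le k j
  have h1 := abs_rpow_sub_rpow_le (s := 2 * β - 2) (x := wnorm (k - j)) (y := wnorm k) (by linarith)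
    hk0 (by linarith [(abs_le.1 hd).1])
  rw [spectralWeight_eq he γ hjk]
  set q := wnorm j ^ 2 * wnorm k ^ 2 - wdot k j ^ 2 with hq
  have hq0 : 0 ≤ q := by have := wdot_le k j; linarith
  have hq1 : q ≤ wnorm j ^ 2 * wnorm k ^ 2 := by have := sq_nonneg (wdot k j); linarith
  have e6 : wnorm k ^ (2 * β - 6) = (wnorm k ^ 4)⁻¹ * wnorm k ^ (2 * β - 2) := by
    rw [show 2 * β - 6 = -(4 : ℕ) + (2 * β - 2) by push_cast; ring, Real.rpow_add hk0,
      Real.rpow_neg hk0.le, Real.rpow_natCast]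
  have e5 : wnorm k ^ (2 * β - 5) = (wnorm k ^ 4)⁻¹ * wnorm k ^ 2 * wnorm k ^ (2 * β - 2 - 1) := by
    rw [show 2 * β - 5 = -(4 : ℕ) + (2 : ℕ) + (2 * β - 2 - 1) by push_cast; ring,
      Real.rpow_add hk0, Real.rpow_add hk0, Real.rpow_neg hk0.le, Real.rpow_natCast,
      Real.rpow_natCast]
  rw [e6, e5, show (wnorm k ^ 4)⁻¹ * (U ^ 2 * ‖γ j‖ ^ 2 * (wnorm (k - j) ^ (2 * β - 2) * q)) -
    U ^ 2 * ‖γ j‖ ^ 2 * ((wnorm k ^ 4)⁻¹ * wnorm k ^ (2 * β - 2) * q) = U ^ 2 * ‖γ j‖ ^ 2 *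
      (wnorm k ^ 4)⁻¹ * q * (wnorm (k - j) ^ (2 * β - 2) - wnorm k ^ (2 * β - 2)) by ring,
    abs_mul, abs_of_nonneg (a := U ^ 2 * ‖γ j‖ ^ 2 * (wnorm k ^ 4)⁻¹ * q) (by positivity)]
  have hj0 := wnorm_nonneg j
  calc _ ≤ U ^ 2 * ‖γ j‖ ^ 2 * (wnorm k ^ 4)⁻¹ * (wnorm j ^ 2 * wnorm k ^ 2) *
        (-(2 * β - 2) * 2 ^ (1 - (2 * β - 2)) * wnorm k ^ (2 * β - 2 - 1) * wnorm j) := by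
        refine mul_le_mul (mul_le_mul_of_nonneg_left hq1 (by positivity)) (h1.trans ?_)
          (abs_nonneg _) (by positivity)
        refine mul_le_mul_of_nonneg_left hd ?_
        have h3 : 0 ≤ -(2 * β - 2) := by linarith
        positivity
    _ = _ := by
        rw [show 1 - (2 * β - 2) = 3 - 2 * β by ring]
        ring

/-- The reflection of the coordinate `a`, a symmetry of every shell. -/
def reflectCoord (a : Fin 3) : Wave ≃ Wave where
  toFun k i := if i = a then -k i else k i
  invFun k i := if i = a then -k i else k i
  left_inv k := by ext i; by_cases h : i = a <;> simp [h]
  right_inv k := by ext i; by_cases h : i = a <;> simp [h]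

lemma wnorm_reflectCoord (a : Fin 3) (k : Wave) : wnorm (reflectCoord a k) = wnorm k := by
  unfold wnorm
  congr 1
  refine Finset.sum_congr rfl fun i _ => ?_
  by_cases h : i = a <;> simp [reflectCoord, h]

lemma wnorm_comp_perm (σ : Equiv.Perm (Fin 3)) (k : Wave) : wnorm (k ∘ σ) = wnorm k := by
  unfold wnorm
  congr 1
  exact Equiv.sum_comp σ fun i => (k i : ℝ) ^ 2

lemma sum_waveShell_comp (κ : ℝ) (T : Wave ≃ Wave) (hT : ∀ k, wnorm (T k) = wnorm k)
    (g : Wave → ℝ) : ∑ k ∈ waveShell κ, g (T k) = ∑ k ∈ waveShell κ, g k :=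
  Finset.sum_equiv T (fun k => by simp [hT]) fun _ _ => rfl

lemma sum_waveShell_mul_eq_zero (κ : ℝ) (g : ℝ → ℝ) {a b : Fin 3} (hab : a ≠ b) :
    ∑ k ∈ waveShell κ, g (wnorm k) * ((k a : ℝ) * k b) = 0 := by
  have h := sum_waveShell_comp κ (reflectCoord a) (wnorm_reflectCoord a)
    fun k => g (wnorm k) * ((k a : ℝ) * k b)
  simp only [wnorm_reflectCoord] at h
  have h1 : ∀ k : Wave, g (wnorm k) * ((reflectCoord a k a : ℝ) * reflectCoord a k b) =
      -(g (wnorm k) * ((k a : ℝ) * k b)) := fun k => by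
    simp [reflectCoord, hab.symm]
  simp only [h1, Finset.sum_neg_distrib] at h
  linarith

lemma sum_waveShell_sq_eq (κ : ℝ) (g : ℝ → ℝ) (a : Fin 3) :
    ∑ k ∈ waveShell κ, g (wnorm k) * (k a : ℝ) ^ 2 =
      (∑ k ∈ waveShell κ, g (wnorm k) * wnorm k ^ 2) / 3 := by
  have h1 : ∀ b : Fin 3, ∑ k ∈ waveShell κ, g (wnorm k) * (k b : ℝ) ^ 2 =
      ∑ k ∈ waveShell κ, g (wnorm k) * (k a : ℝ) ^ 2 := fun b => by
    have h := sum_waveShell_comp κ ((Equiv.swap a b).arrowCongr (Equiv.refl ℤ))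
      (fun k => wnorm_comp_perm (Equiv.swap a b).symm k) fun k => g (wnorm k) * (k a : ℝ) ^ 2
    rw [← h]
    refine Finset.sum_congr rfl fun k _ => ?_
    have h2 : wnorm ((Equiv.swap a b).arrowCongr (Equiv.refl ℤ) k) = wnorm k :=
      wnorm_comp_perm (Equiv.swap a b).symm k
    rw [h2]
    simp [Equiv.arrowCongr]
  have h3 : ∑ k ∈ waveShell κ, g (wnorm k) * wnorm k ^ 2 =
      ∑ b : Fin 3, ∑ k ∈ waveShell κ, g (wnorm k) * (k b : ℝ) ^ 2 := by
    rw [Finset.sum_comm]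
    exact Finset.sum_congr rfl fun k _ => by rw [wnorm_sq, Finset.mul_sum]
  rw [h3, Finset.sum_congr rfl fun b _ => h1 b]
  simp

/-- By the octahedral symmetry of a shell, `(k·j)²` averages to `|k|²|j|²/3`. -/
lemma sum_waveShell_wdot_sq (κ : ℝ) (g : ℝ → ℝ) (j : Wave) :
    ∑ k ∈ waveShell κ, g (wnorm k) * wdot k j ^ 2 =
      wnorm j ^ 2 / 3 * ∑ k ∈ waveShell κ, g (wnorm k) * wnorm k ^ 2 := by
  have h1 : ∀ k : Wave, g (wnorm k) * wdot k j ^ 2 =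
      ∑ a : Fin 3, ∑ b : Fin 3, (j a : ℝ) * j b * (g (wnorm k) * ((k a : ℝ) * k b)) := fun k => by
    rw [wdot, sq, Finset.sum_mul_sum, Finset.mul_sum]
    refine Finset.sum_congr rfl fun a _ => ?_
    rw [Finset.mul_sum]
    exact Finset.sum_congr rfl fun b _ => by ring
  have h2 : ∀ a b : Fin 3, ∑ k ∈ waveShell κ, (j a : ℝ) * j b * (g (wnorm k) * ((k a : ℝ) * k b)) =
      if a = b then (j a : ℝ) ^ 2 * ((∑ k ∈ waveShell κ, g (wnorm k) * wnorm k ^ 2) / 3) else 0 := by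
    intro a b
    rw [← Finset.mul_sum]
    split_ifs with h
    · subst h
      simp only [← sq]
      rw [sum_waveShell_sq_eq]
    · rw [sum_waveShell_mul_eq_zero κ g h, mul_zero]
  simp only [h1]
  rw [Finset.sum_comm]
  simp only [Finset.sum_comm (s := waveShell κ), h2, Finset.sum_ite_eq, Finset.mem_univ, if_true]
  rw [← Finset.sum_mul, ← wnorm_sq]
  ring

/-- The contribution of one large-scale source mode `j` to the static spectrum on the shell. -/
lemma abs_sum_waveShell_spectralWeight_sub_le {β U κ : ℝ} (hβ : β < -2) (hκ : 4 ≤ κ)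
    {e f : Wave → Fin 3 → ℝ} (he : IsCrayaHerring e f) (γ : Wave → ℂ) {j : Wave}
    (hj : wnorm j ≤ κ ^ (1 / 2 : ℝ)) :
    |∑ k ∈ waveShell κ, (wnorm k ^ 4)⁻¹ * spectralWeight β U U e f γ k j -
      κ ^ (2 * β - 1) * (8 * Real.pi * U ^ 2 / 3) * ((2 ^ (2 * β - 1) - 1) / (2 * β - 1)) *
        (wnorm j ^ 2 * ‖γ j‖ ^ 2)| ≤
    (304 * Real.pi * ((2 - 2 * β) * 2 ^ (3 - 2 * β)) + 120 * Real.pi) * U ^ 2 *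
      κ ^ (2 * β - 3 / 2) * (wnorm j ^ 2 * ‖γ j‖ ^ 2) := by
  have hκ0 : 0 < κ := by linarith
  have hπ := Real.pi_pos
  set C := (2 - 2 * β) * (2 : ℝ) ^ (3 - 2 * β) with hC
  have hC0 : 0 ≤ C := mul_nonneg (by linarith) (by positivity)
  have hj0 := wnorm_nonneg j
  have hj2 : 2 * wnorm j ≤ κ := by
    have h1 : κ ^ (1 / 2 : ℝ) * κ ^ (1 / 2 : ℝ) = κ := by
      rw [← Real.rpow_add hκ0]; norm_num
    have h2 : 0 ≤ κ ^ (1 / 2 : ℝ) := by positivity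
    nlinarith
  set D := U ^ 2 * (wnorm j ^ 2 * ‖γ j‖ ^ 2) with hD
  have hD0 : 0 ≤ D := by positivity
  have hpos : ∀ k ∈ waveShell κ, 0 < wnorm k := fun k hk => hκ0.trans_le (mem_waveShell.1 hk).1
  -- freezing the velocity factor at the shell wavevector
  have hA : |∑ k ∈ waveShell κ, (wnorm k ^ 4)⁻¹ * spectralWeight β U U e f γ k j -
      ∑ k ∈ waveShell κ, U ^ 2 * ‖γ j‖ ^ 2 *
        (wnorm k ^ (2 * β - 6) * (wnorm j ^ 2 * wnorm k ^ 2 - wdot k j ^ 2))| ≤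
      D * (304 * Real.pi * C * κ ^ (2 * β - 3 / 2)) := by
    rw [← Finset.sum_sub_distrib]
    refine (Finset.abs_sum_le_sum_abs _ _).trans ?_
    calc _ ≤ ∑ k ∈ waveShell κ, D * (C * κ ^ (1 / 2 : ℝ) * κ ^ (2 * β - 5)) := by
          refine Finset.sum_le_sum fun k hk => ?_
          have hks := mem_waveShell.1 hk
          refine (abs_spectralWeight_sub_le (by linarith) he γ (ne_zero_of_wnorm_pos (hpos k hk))
            (by linarith)).trans ?_
          refine mul_le_mul_of_nonneg_left ?_ hD0
          refine mul_le_mul (mul_le_mul_of_nonneg_left hj hC0)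
            (Real.rpow_le_rpow_of_nonpos hκ0 hks.1 (by linarith)) (Real.rpow_nonneg (hpos k hk).le _)
            (by positivity)
      _ = ((waveShell κ).card : ℝ) * (D * (C * κ ^ (1 / 2 : ℝ) * κ ^ (2 * β - 5))) := by
          rw [Finset.sum_const, nsmul_eq_mul]
      _ ≤ (38 * Real.pi * (2 * κ) ^ 3) * (D * (C * κ ^ (1 / 2 : ℝ) * κ ^ (2 * β - 5))) := by
          refine mul_le_mul_of_nonneg_right ?_ (by positivity)
          refine le_trans ?_ (card_waveBall_le (R := 2 * κ) (by linarith))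
          exact_mod_cast Finset.card_le_card (Finset.filter_subset _ _)
      _ = _ := by
          rw [show 2 * β - 3 / 2 = (3 : ℕ) + (1 / 2) + (2 * β - 5) by push_cast; ring,
            Real.rpow_add hκ0, Real.rpow_add hκ0, Real.rpow_natCast]
          ring
  -- averaging over the directions of `k`
  have hB : ∑ k ∈ waveShell κ, U ^ 2 * ‖γ j‖ ^ 2 *
      (wnorm k ^ (2 * β - 6) * (wnorm j ^ 2 * wnorm k ^ 2 - wdot k j ^ 2)) =
      D * (2 / 3) * ∑ k ∈ waveShell κ, wnorm k ^ (2 * β - 4) := by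
    have h4 : ∑ k ∈ waveShell κ, wnorm k ^ (2 * β - 4) =
        ∑ k ∈ waveShell κ, wnorm k ^ (2 * β - 6) * wnorm k ^ 2 :=
      Finset.sum_congr rfl fun k hk => by
        rw [show 2 * β - 4 = (2 * β - 6) + (2 : ℕ) by push_cast; ring, Real.rpow_add (hpos k hk),
          Real.rpow_natCast]
    have h5 : ∀ k, wnorm k ^ (2 * β - 6) * (wnorm j ^ 2 * wnorm k ^ 2 - wdot k j ^ 2) =
        wnorm j ^ 2 * (wnorm k ^ (2 * β - 6) * wnorm k ^ 2) -
          wnorm k ^ (2 * β - 6) * wdot k j ^ 2 := fun k => by ring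
    rw [← Finset.mul_sum]
    simp only [h5]
    rw [Finset.sum_sub_distrib, ← Finset.mul_sum,
      sum_waveShell_wdot_sq κ (fun r => r ^ (2 * β - 6)) j, h4, hD]
    ring
  have hE := abs_sum_waveShell_rpow_sub_le (κ := κ) (p := 2 * β - 4) (by linarith) (by linarith)
  rw [show 2 * β - 4 + 3 = 2 * β - 1 by ring, show 2 * β - 4 + 2 = 2 * β - 2 by ring,
    Real.mul_rpow two_pos.le hκ0.le] at hE
  have hκle : κ ^ (2 * β - 2) ≤ κ ^ (2 * β - 3 / 2) :=
    Real.rpow_le_rpow_of_exponent_le (by linarith) (by linarith)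
  have hF : |D * (2 / 3) * ∑ k ∈ waveShell κ, wnorm k ^ (2 * β - 4) -
      κ ^ (2 * β - 1) * (8 * Real.pi * U ^ 2 / 3) * ((2 ^ (2 * β - 1) - 1) / (2 * β - 1)) *
        (wnorm j ^ 2 * ‖γ j‖ ^ 2)| ≤ D * (120 * Real.pi * κ ^ (2 * β - 3 / 2)) := by
    rw [show D * (2 / 3) * ∑ k ∈ waveShell κ, wnorm k ^ (2 * β - 4) -
      κ ^ (2 * β - 1) * (8 * Real.pi * U ^ 2 / 3) * ((2 ^ (2 * β - 1) - 1) / (2 * β - 1)) *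
        (wnorm j ^ 2 * ‖γ j‖ ^ 2) = D * (2 / 3) * (∑ k ∈ waveShell κ, wnorm k ^ (2 * β - 4) -
        4 * Real.pi * ((2 ^ (2 * β - 1) * κ ^ (2 * β - 1) - κ ^ (2 * β - 1)) / (2 * β - 1))) by
          rw [hD]; ring, abs_mul, abs_of_nonneg (a := D * (2 / 3)) (by positivity)]
    calc _ ≤ D * (2 / 3) * (180 * Real.pi * κ ^ (2 * β - 3 / 2)) := by
          refine mul_le_mul_of_nonneg_left (hE.trans ?_) (by positivity)
          exact mul_le_mul_of_nonneg_left hκle (by positivity)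
      _ = _ := by ring
  rw [hB] at hA
  refine (abs_sub_le _ _ _).trans ((add_le_add hA hF).trans_eq ?_)
  rw [hD]
  ring

/-- The contribution of one source mode `j` in the range of the power-law bound. -/
lemma sum_waveShell_spectralWeight_tail_le {α β U κ cg κg : ℝ} (hβ : β < -2) (hα : α < -7)
    (hκ : 1 ≤ κ) {e f : Wave → Fin 3 → ℝ} (he : IsCrayaHerring e f) {γ : Wave → ℂ}
    (hγ : IsSourceAmplitude α cg κg γ) (hκg : κg ≤ κ ^ (1 / 2 : ℝ)) {j : Wave}
    (hj : κ ^ (1 / 2 : ℝ) ≤ wnorm j) :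
    ∑ k ∈ waveShell κ, (wnorm k ^ 4)⁻¹ * spectralWeight β U U e f γ k j ≤
      U ^ 2 * cg ^ 2 * κ ^ α * (∑' m : Wave, wnorm m ^ (2 * β)) * wnorm j ^ (-4 : ℝ) := by
  have hκ0 : 0 < κ := by linarith
  have hj1 : 1 ≤ wnorm j := (Real.one_le_rpow hκ (by norm_num)).trans hj
  have hj0 : 0 < wnorm j := by linarith
  have hs := summable_wnorm_rpow (p := 2 * β) (by linarith)
  have hγj : wnorm j ^ 2 * ‖γ j‖ ^ 2 ≤ cg ^ 2 * κ ^ (α + 3) * wnorm j ^ (-4 : ℝ) := by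
    have h1 : ‖γ j‖ ^ 2 ≤ (cg * wnorm j ^ α) ^ 2 :=
      pow_le_pow_left₀ (norm_nonneg _) (hγ.bound j (hκg.trans hj)) 2
    have h2 : wnorm j ^ 2 * (wnorm j ^ α) ^ 2 = wnorm j ^ (2 * α + 6) * wnorm j ^ (-4 : ℝ) := by
      rw [← Real.rpow_natCast, ← Real.rpow_natCast, ← Real.rpow_mul hj0.le, ← Real.rpow_add hj0,
        ← Real.rpow_add hj0]
      congr 1
      push_cast
      ring
    -- a factor `|j|⁻⁴` keeps the sum over `j` convergent; the rest is evaluated at `|j| = κ^{1/2}`,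
    -- where its exponent is negative because `α < -7`
    have h3 : wnorm j ^ (2 * α + 6) ≤ κ ^ (α + 3) := by
      calc _ ≤ (κ ^ (1 / 2 : ℝ)) ^ (2 * α + 6) :=
            Real.rpow_le_rpow_of_nonpos (by positivity) hj (by linarith)
        _ = _ := by
            rw [← Real.rpow_mul hκ0.le]
            congr 1
            ring
    calc _ ≤ wnorm j ^ 2 * (cg * wnorm j ^ α) ^ 2 := by gcongr
      _ = cg ^ 2 * (wnorm j ^ (2 * α + 6) * wnorm j ^ (-4 : ℝ)) := by rw [← h2]; ring
      _ ≤ cg ^ 2 * (κ ^ (α + 3) * wnorm j ^ (-4 : ℝ)) := by gcongr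
      _ = _ := by ring
  have hκα : (κ ^ 4)⁻¹ * κ ^ (α + 3) ≤ κ ^ α := by
    rw [← Real.rpow_natCast, ← Real.rpow_neg hκ0.le, ← Real.rpow_add hκ0]
    exact Real.rpow_le_rpow_of_exponent_le hκ (by push_cast; linarith)
  calc _ ≤ ∑ k ∈ waveShell κ, (κ ^ 4)⁻¹ * (U ^ 2 * (cg ^ 2 * κ ^ (α + 3) * wnorm j ^ (-4 : ℝ)) *
        wnorm (k - j) ^ (2 * β)) := by
        refine Finset.sum_le_sum fun k hk => ?_
        have hk1 := (mem_waveShell.1 hk).1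
        have hr := Real.rpow_nonneg (wnorm_nonneg (k - j)) (2 * β)
        refine mul_le_mul ?_ ((spectralWeight_le he γ k j).trans ?_)
          (spectralWeight_nonneg _ _ _ _ _ _ _ _) (by positivity)
        · gcongr
        · gcongr
    _ = (κ ^ 4)⁻¹ * (U ^ 2 * (cg ^ 2 * κ ^ (α + 3) * wnorm j ^ (-4 : ℝ))) *
        ∑ k ∈ waveShell κ, wnorm (k - j) ^ (2 * β) := by
        rw [Finset.mul_sum]
        exact Finset.sum_congr rfl fun k _ => by ring
    _ ≤ (κ ^ 4)⁻¹ * (U ^ 2 * (cg ^ 2 * κ ^ (α + 3) * wnorm j ^ (-4 : ℝ))) *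
        ∑' m : Wave, wnorm m ^ (2 * β) := by
        refine mul_le_mul_of_nonneg_left ?_ (by positivity)
        rw [← (Equiv.subRight j).tsum_eq fun m : Wave => wnorm m ^ (2 * β)]
        exact ((Equiv.subRight j).summable_iff.2 hs).sum_le_tsum _
          fun k _ => Real.rpow_nonneg (wnorm_nonneg _) _
    _ = ((κ ^ 4)⁻¹ * κ ^ (α + 3)) * (U ^ 2 * cg ^ 2 * (∑' m : Wave, wnorm m ^ (2 * β)) *
        wnorm j ^ (-4 : ℝ)) := by ring
    _ ≤ κ ^ α * (U ^ 2 * cg ^ 2 * (∑' m : Wave, wnorm m ^ (2 * β)) * wnorm j ^ (-4 : ℝ)) := by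
        refine mul_le_mul_of_nonneg_right hκα ?_
        have : 0 ≤ ∑' m : Wave, wnorm m ^ (2 * β) :=
          tsum_nonneg fun m => Real.rpow_nonneg (wnorm_nonneg m) _
        positivity
    _ = _ := by ring

/-- The constant in front of the contribution of the small-scale part of the source. -/
noncomputable def tailConst (β : ℝ) : ℝ :=
  8 * Real.pi ^ 3 * ((∑' m : Wave, wnorm m ^ (2 * β)) * ∑' m : Wave, wnorm m ^ (-4 : ℝ))

/-- The constant in front of the error made by freezing the velocity spectrum on the shell and
replacing the lattice sum by an integral. -/
noncomputable def shellConst (β : ℝ) : ℝ :=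
  304 * Real.pi * ((2 - 2 * β) * 2 ^ (3 - 2 * β)) + 120 * Real.pi

/-- The power law of the static spectrum on dyadic shells. -/
lemma abs_shell_spectrum_sub_le {α β U κ cg κg : ℝ} (hβ : β < -2) (hα : α < -7)
    (hκ : 4 ≤ κ) {e f : Wave → Fin 3 → ℝ} (he : IsCrayaHerring e f) {γ : Wave → ℂ}
    (hγ : IsSourceAmplitude α cg κg γ) (hκg : κg ≤ κ ^ (1 / 2 : ℝ))
    (hsum : ∀ k, Summable fun j => spectralWeight β U U e f γ k j) :
    |8 * Real.pi ^ 3 * ∑ k ∈ waveShell κ, (wnorm k ^ 4)⁻¹ * ∑' j, spectralWeight β U U e f γ k j -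
      κ ^ (2 * β - 1) * (8 * Real.pi * U ^ 2 / 3) * ((2 ^ (2 * β - 1) - 1) / (2 * β - 1)) *
        projSq 1 (κ ^ (1 / 2 : ℝ)) (fun j => (wnorm j : ℂ) * γ j)| ≤
    cg ^ 2 * U ^ 2 * tailConst β * κ ^ α +
      shellConst β * U ^ 2 * (8 * Real.pi ^ 3 * ∑' j : Wave, wnorm j ^ 2 * ‖γ j‖ ^ 2) *
        κ ^ (2 * β - 3 / 2) := by
  have hκ0 : 0 < κ := by linarith
  set A := κ ^ (2 * β - 1) * (8 * Real.pi * U ^ 2 / 3) * ((2 ^ (2 * β - 1) - 1) / (2 * β - 1))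
  set S := ∑' m : Wave, wnorm m ^ (2 * β)
  have hS0 : 0 ≤ S := tsum_nonneg fun m => Real.rpow_nonneg (wnorm_nonneg m) _
  have hg : Summable fun j : Wave => wnorm j ^ 2 * ‖γ j‖ ^ 2 := by
    simpa only [mul_pow] using summable_sq_of_summable
      (fun j => mul_nonneg (wnorm_nonneg j) (norm_nonneg _)) (hγ.summable (by linarith))
  have h4 := summable_wnorm_rpow (p := -4) (by norm_num)
  set B := {j : Wave | 1 ≤ wnorm j ∧ wnorm j < κ ^ (1 / 2 : ℝ)}
  set T : Wave → ℝ := fun j => ∑ k ∈ waveShell κ, (wnorm k ^ 4)⁻¹ * spectralWeight β U U e f γ k j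
  have hTsum : HasSum T (∑ k ∈ waveShell κ, (wnorm k ^ 4)⁻¹ * ∑' j, spectralWeight β U U e f γ k j) :=
    hasSum_sum fun k _ => (hsum k).hasSum.mul_left _
  have hBsum := (hg.indicator B).hasSum
  have hproj : projSq 1 (κ ^ (1 / 2 : ℝ)) (fun j => (wnorm j : ℂ) * γ j) =
      8 * Real.pi ^ 3 * ∑' j, B.indicator (fun j => wnorm j ^ 2 * ‖γ j‖ ^ 2) j := by
    rw [projSq]
    simp only [norm_mul, Complex.norm_real, Real.norm_eq_abs, abs_of_nonneg (wnorm_nonneg _), mul_pow]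
    rfl
  have hbound : ∀ j, ‖T j - A * B.indicator (fun j => wnorm j ^ 2 * ‖γ j‖ ^ 2) j‖ ≤
      shellConst β * U ^ 2 * κ ^ (2 * β - 3 / 2) * (wnorm j ^ 2 * ‖γ j‖ ^ 2) +
        U ^ 2 * cg ^ 2 * κ ^ α * S * wnorm j ^ (-4 : ℝ) := by
    intro j
    have hc0 : 0 ≤ shellConst β := by
      have : 0 ≤ 2 - 2 * β := by linarith
      unfold shellConst
      positivity
    have hr : 0 ≤ U ^ 2 * cg ^ 2 * κ ^ α * S * wnorm j ^ (-4 : ℝ) := by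
      have := Real.rpow_nonneg (wnorm_nonneg j) (-4)
      positivity
    have hl : 0 ≤ shellConst β * U ^ 2 * κ ^ (2 * β - 3 / 2) * (wnorm j ^ 2 * ‖γ j‖ ^ 2) := by
      positivity
    rw [Real.norm_eq_abs]
    rcases lt_or_ge (wnorm j) (κ ^ (1 / 2 : ℝ)) with h | h
    · have hind : B.indicator (fun j => wnorm j ^ 2 * ‖γ j‖ ^ 2) j = wnorm j ^ 2 * ‖γ j‖ ^ 2 := by
        by_cases h0 : j = 0
        · subst h0
          simp [indicator]
        · exact indicator_of_mem (show j ∈ B from ⟨one_le_wnorm h0, h⟩) _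
      rw [hind]
      exact (abs_sum_waveShell_spectralWeight_sub_le hβ hκ he γ h.le).trans
        (le_add_of_nonneg_right hr)
    · rw [indicator_of_notMem (fun hj : j ∈ B => not_lt.2 h hj.2), mul_zero, sub_zero, abs_of_nonneg]
      · exact (sum_waveShell_spectralWeight_tail_le hβ hα (by linarith) he hγ hκg h).trans
          (le_add_of_nonneg_left hl)
      · exact Finset.sum_nonneg fun k _ => mul_nonneg (by have := wnorm_nonneg k; positivity)
          (spectralWeight_nonneg _ _ _ _ _ _ _ _)
  -- comparing mode by mode: exactly one of the two bounds applies to each `j`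
  have hmain := tsum_of_norm_bounded ((hg.hasSum.mul_left _).add (h4.hasSum.mul_left _)) hbound
  rw [(hTsum.sub (hBsum.mul_left A)).tsum_eq, Real.norm_eq_abs] at hmain
  rw [hproj, mul_left_comm A, ← mul_sub, abs_mul, abs_of_pos (by positivity)]
  refine (mul_le_mul_of_nonneg_left hmain (by positivity)).trans_eq ?_
  rw [tailConst]
  ring

/-! ### The large-time limit and the static spectrum -/

section Limits

variable {Ω : Type*} [MeasurableSpace Ω] {μ : Measure Ω} [IsProbabilityMeasure μ]
  {ς Ξ α β Ue Uf cg κg : ℝ} {Φ : ℝ → ℝ} {χ : Wave → ℝ} {V W : Wave → ℝ → Ω → ℂ} {n : ℕ}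
  {e f : Wave → Fin 3 → ℝ} {γ : Wave → ℂ} {G : Ω → Wave → ℂ} {u : Ω → ℝ → Wave → Fin 3 → ℂ}

lemma ModeFamily.memLp_tsum {ι : Type*} [DecidableEq ι] [Countable ι] {X : ι → ℝ → Ω → ℂ}
    {M : ι → ℝ} {R : ι → ℝ → ℝ} (h : ModeFamily μ X M R) {s : ℝ} (hs : 0 ≤ s) :
    MemLp (fun ω => ∑' j, X j s ω) 2 μ := by
  have h1 : MemLp (fun ω => ∑' j, ModeFamily.cutoff X M j s ω) 2 μ :=
    MemLp.of_bound (h.measurable_tsum_cutoff.comp measurable_prodMk_left).aestronglyMeasurable _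
      (Eventually.of_forall fun ω => h.norm_tsum_cutoff_le s ω)
  exact h1.ae_eq ((h.ae_bound hs).mono fun _ hω => ModeFamily.tsum_cutoff_eq hω)

lemma memLp_staticVartheta (hβ : β ≤ 0) (hα : α < -4) (he : IsCrayaHerring e f)
    (hΦ : IsCorrelation n Φ χ) (hV : IsVelocityProcess μ ς Ξ Φ χ V W)
    (hγ : IsSourceAmplitude α cg κg γ) (hG : IsSource μ V W γ G)
    (hu : ∀ ω t, u ω t = velocity β Ue Uf e f (fun k => V k t ω) (fun k => W k t ω))
    {s₀ : ℝ} (hs : 0 ≤ s₀) (k : Wave) : MemLp (fun ω => staticVartheta (u ω s₀) (G ω) k) 2 μ := by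
  obtain ⟨M, hM⟩ := modeFamily_advectTerm hβ hα he hΦ hV hγ hG hu k
  exact (hM.memLp_tsum hs).const_mul _

lemma projSq_eq_sum (κ : ℝ) (θ : Wave → ℂ) :
    projSq κ (2 * κ) θ = 8 * Real.pi ^ 3 * ∑ k ∈ waveShell κ, ‖θ k‖ ^ 2 := by
  rw [projSq, ← tsum_subtype, ← Finset.tsum_subtype (waveShell κ) fun k => ‖θ k‖ ^ 2]
  congr 1
  have hset : {k : Wave | κ ≤ wnorm k ∧ wnorm k < 2 * κ} = (waveShell κ : Set Wave) := by
    ext k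
    simp
  rw [hset]
  rfl

lemma integral_projSq {θ : Ω → Wave → ℂ} (h : ∀ k, MemLp (fun ω => θ ω k) 2 μ) (κ : ℝ) :
    ∫ ω, projSq κ (2 * κ) (θ ω) ∂μ = 8 * Real.pi ^ 3 * ∑ k ∈ waveShell κ, ∫ ω, ‖θ ω k‖ ^ 2 ∂μ := by
  simp only [projSq_eq_sum]
  rw [integral_const_mul, integral_finsetSum _ fun k _ => (h k).integrable_norm_pow two_ne_zero]

/-- The limiting spectrum differs from the static one by the factors `J(χ/|k|²) = 1 + O(X/|k|²)`. -/
lemma abs_limit_sub_static_le (hβ : β ≤ 0) (hα : α < -4) (he : IsCrayaHerring e f)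
    (hΦ : IsCorrelation n Φ χ) (hV : IsVelocityProcess μ ς Ξ Φ χ V W)
    (hγ : IsSourceAmplitude α cg κg γ) (hG : IsSource μ V W γ G)
    (hu : ∀ ω t, u ω t = velocity β Ue Uf e f (fun k => V k t ω) (fun k => W k t ω))
    {X : ℝ} (hX : ∀ m : Wave, m ≠ 0 → χ m ≤ X) {k : Wave} (hk : k ≠ 0) :
    |(wnorm k ^ 4)⁻¹ * ∑' j, spectralWeight β Ue Uf e f γ k j *
        corrTransform Φ (χ (k - j) / wnorm k ^ 2) -
      (wnorm k ^ 4)⁻¹ * ∑' j, spectralWeight β Ue Uf e f γ k j| ≤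
    corrSlope Φ * (X / wnorm k ^ 2) * ((wnorm k ^ 4)⁻¹ * ∑' j, spectralWeight β Ue Uf e f γ k j) := by
  have hk0 := wnorm_pos hk
  have hb : ∀ x, 0 ≤ x → |Φ x| ≤ 1 := fun x hx => hV.abs_corr_le hΦ.pos hx
  have hslope := exists_abs_sub_one_le hΦ.two_le hΦ.smooth hΦ.zero hb
  have hS := summable_spectralWeight hβ hα he hΦ hV hγ hG hu k
  have hterm : ∀ j, ‖spectralWeight β Ue Uf e f γ k j *
      corrTransform Φ (χ (k - j) / wnorm k ^ 2) - spectralWeight β Ue Uf e f γ k j‖ ≤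
      corrSlope Φ * (X / wnorm k ^ 2) * spectralWeight β Ue Uf e f γ k j := by
    intro j
    have hw := spectralWeight_nonneg β Ue Uf e f γ k j
    by_cases hj : j = k
    · simp [spectralWeight, hj]
    have hkj : k - j ≠ 0 := fun h => hj (sub_eq_zero.1 h).symm
    rw [← mul_sub_one, norm_mul, Real.norm_of_nonneg hw, mul_comm]
    refine mul_le_mul_of_nonneg_right ?_ hw
    refine (abs_corrTransform_sub_one_le hΦ.smooth.continuousOn hb
      (fun s hs => abs_sub_one_le_corrSlope hslope hs)
      (div_nonneg (hΦ.pos _ hkj).le (sq_nonneg _))).trans ?_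
    refine mul_le_mul_of_nonneg_left ?_ (corrSlope_nonneg Φ)
    exact div_le_div_of_nonneg_right (hX _ hkj) (sq_nonneg _)
  have hS2 : Summable fun j => spectralWeight β Ue Uf e f γ k j *
      corrTransform Φ (χ (k - j) / wnorm k ^ 2) := by
    refine ((Summable.of_norm_bounded (hS.mul_left _) hterm).add hS).congr fun j => ?_
    ring
  have h := tsum_of_norm_bounded (hS.hasSum.mul_left _) hterm
  rw [hS2.tsum_sub hS, Real.norm_eq_abs] at h
  rw [← mul_sub, abs_mul, abs_of_nonneg (by positivity)]
  refine (mul_le_mul_of_nonneg_left h (by positivity)).trans_eq ?_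
  ring

end Limits

theorem theorem2 :
    ∃ (c₁ : ℝ) (ca : ℝ → ℝ → ℝ) (cb : ℝ → ℝ) (cΦ : (ℝ → ℝ) → ℝ), 0 < c₁ ∧
    ∀ {Ω : Type*} [MeasurableSpace Ω] (μ : Measure Ω) [IsProbabilityMeasure μ]
      (α β Ue Uf cg κg ς Ξ : ℝ) (e f : Wave → Fin 3 → ℝ)
      (n : ℕ) (Φ : ℝ → ℝ) (χ : Wave → ℝ) (V W : Wave → ℝ → Ω → ℂ)
      (γ : Wave → ℂ) (G : Ω → Wave → ℂ) (u : Ω → ℝ → Wave → Fin 3 → ℂ),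
      β < -2 → α < 2 * min β (-3) - 1 →
      IsCrayaHerring e f →
      IsCorrelation n Φ χ →
      IsVelocityProcess μ ς Ξ Φ χ V W →
      IsSourceAmplitude α cg κg γ →
      IsSource μ V W γ G →
      (∀ ω t, u ω t = velocity β Ue Uf e f (fun k => V k t ω) (fun k => W k t ω)) →
      -- the smallness condition on the velocity
      (∀ᵐ ω ∂μ, ENNReal.ofReal c₁ * supHHalfSq (u ω) < 1) →
      -- convergence of the iteration to the solution, and its decomposition
      (∃ θ δθ : Ω → ℝ → Wave → ℂ, ∀ᵐ ω ∂μ,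
        IsSolution (u ω) (G ω) (θ ω) ∧
        (∀ η, IsSolution (u ω) (G ω) η → ∀ t, 0 ≤ t → η t = θ ω t) ∧
        (∀ T, 0 < T →
          (∀ m, MemL2H1 T (iter (u ω) (G ω) m)) ∧
          MemL2H1 T (vartheta (u ω) (G ω)) ∧ MemL2H1 T (δθ ω) ∧
          Tendsto (fun m => distL2H1Sq T (iter (u ω) (G ω) m) (θ ω)) atTop (𝓝 0)) ∧
        (∀ t, 0 ≤ t → ∀ k,
          iter (u ω) (G ω) 1 t k = -G ω k + vartheta (u ω) (G ω) t k ∧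
          θ ω t k = -G ω k + vartheta (u ω) (G ω) t k + δθ ω t k)) ∧
      -- the spectrum of `ϑ` in the limit of large time
      (∀ t, 0 ≤ t → ∀ k, MemLp (fun ω => vartheta (u ω) (G ω) t k) 2 μ) ∧
      (∀ k : Wave, k ≠ 0 →
        (∀ m : Wave, m ≠ 0 → IntegrableOn (remainderIntegrand n Φ (χ m) k) (Ioi 0)) →
        Summable (fun j : Wave => spectralWeight β Ue Uf e f γ k j *
          correlationExpansion n Φ (χ (k - j)) k) ∧
        Tendsto (fun t => ∫ ω, ‖vartheta (u ω) (G ω) t k‖ ^ 2 ∂μ) atTop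
          (𝓝 ((wnorm k ^ 4)⁻¹ * ∑' j : Wave, spectralWeight β Ue Uf e f γ k j *
            correlationExpansion n Φ (χ (k - j)) k))) ∧
      -- reduction to the static case, mode by mode and on dyadic shells
      (∀ X : ℝ, (∀ m : Wave, m ≠ 0 → χ m ≤ X) → ∀ s₀ : ℝ, 0 ≤ s₀ →
        (∀ k : Wave, k ≠ 0 → ∃ L : ℝ,
          Tendsto (fun t => ∫ ω, ‖vartheta (u ω) (G ω) t k‖ ^ 2 ∂μ) atTop (𝓝 L) ∧
          ∫ ω, ‖staticVartheta (u ω s₀) (G ω) k‖ ^ 2 ∂μ =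
            (wnorm k ^ 4)⁻¹ * ∑' j : Wave, spectralWeight β Ue Uf e f γ k j ∧
          |L - ∫ ω, ‖staticVartheta (u ω s₀) (G ω) k‖ ^ 2 ∂μ| ≤
            cΦ Φ * (X / wnorm k ^ 2) * ∫ ω, ‖staticVartheta (u ω s₀) (G ω) k‖ ^ 2 ∂μ) ∧
        (∀ κ : ℝ, 0 < κ → ∃ L : ℝ,
          Tendsto (fun t => ∫ ω, projSq κ (2 * κ) (vartheta (u ω) (G ω) t) ∂μ) atTop (𝓝 L) ∧
          |L - ∫ ω, projSq κ (2 * κ) (staticVartheta (u ω s₀) (G ω)) ∂μ| ≤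
            cΦ Φ * (X / κ ^ 2) *
              ∫ ω, projSq κ (2 * κ) (staticVartheta (u ω s₀) (G ω)) ∂μ ∧
          (∀ U : ℝ, Ue = U → Uf = U → 16 ≤ κg → 4 * κg ^ 2 ≤ κ →
            |L - κ ^ (2 * β - 1) * (8 * Real.pi * U ^ 2 / 3) *
                ((2 ^ (2 * β - 1) - 1) / (2 * β - 1)) *
                projSq 1 (κ ^ (1 / 2 : ℝ)) (fun j => (wnorm j : ℂ) * γ j)| ≤
              cg ^ 2 * U ^ 2 * ca α β * κ ^ α +
              cb β * U ^ 2 * (8 * Real.pi ^ 3 * ∑' j : Wave, wnorm j ^ 2 * ‖γ j‖ ^ 2) *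
                κ ^ (2 * β - 3 / 2) +
              cΦ Φ * (X / κ ^ 2) *
                ∫ ω, projSq κ (2 * κ) (staticVartheta (u ω s₀) (G ω)) ∂μ))) := by
  refine ⟨smallConst, fun _ β => tailConst β, shellConst, corrSlope, smallConst_pos, ?_⟩
  intro Ω _ μ _ α β Ue Uf cg κg ς Ξ e f n Φ χ V W γ G u hβ2 hα2 he hΦ hV hγ hG hu hsmall
  have hα7 : α < -7 := by
    have := min_le_right β (-3)
    linarith
  have hα : α < -4 := by linarith
  have hβ : β ≤ 0 := by linarith
  have hb : ∀ x, 0 ≤ x → |Φ x| ≤ 1 := fun x hx => hV.abs_corr_le hΦ.pos hx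
  have hlim := fun {k : Wave} (hk : k ≠ 0) =>
    tendsto_integral_vartheta hβ hα he hΦ hV hγ hG hu hk
  have hstat := fun {s₀ : ℝ} (hs : 0 ≤ s₀) (k : Wave) =>
    integral_staticVartheta hβ hα he hΦ hV hγ hG hu hs k
  have hsum := summable_spectralWeight hβ hα he hΦ hV hγ hG hu
  refine ⟨?_, fun t ht k => memLp_vartheta hβ hα he hΦ hV hγ hG hu ht k, ?_, ?_⟩
  · obtain ⟨B, -, hB⟩ := hG.exists_bound hγ.zero
    have hex : ∀ ω, ∃ θ, SmallVelocity (u ω) → h1Sq (G ω) ≠ ⊤ →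
        IsSolution (u ω) (G ω) θ ∧
        (∀ η, IsSolution (u ω) (G ω) η → ∀ t, 0 ≤ t → η t = θ t) ∧
        (∀ T, 0 < T → (∀ m, MemL2H1 T (iter (u ω) (G ω) m)) ∧ MemL2H1 T (vartheta (u ω) (G ω)) ∧
          MemL2H1 T (fun t k => θ t k + G ω k - vartheta (u ω) (G ω) t k) ∧
          Tendsto (fun m => distL2H1Sq T (iter (u ω) (G ω) m) θ) atTop (𝓝 0)) ∧
        ∀ t k, iter (u ω) (G ω) 1 t k = -G ω k + vartheta (u ω) (G ω) t k := by
      intro ω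
      by_cases h : SmallVelocity (u ω) ∧ h1Sq (G ω) ≠ ⊤
      · obtain ⟨θ, hθ⟩ := exists_solution h.1 h.2
        exact ⟨θ, fun _ _ => hθ⟩
      · exact ⟨fun _ _ => 0, fun h1 h2 => absurd ⟨h1, h2⟩ h⟩
    choose θ hθ using hex
    refine ⟨θ, fun ω t k => θ ω t k + G ω k - vartheta (u ω) (G ω) t k, ?_⟩
    filter_upwards [hsmall, hB] with ω h1 h2
    obtain ⟨hs1, hs2, hs3, hs4⟩ := hθ ω (smallVelocity_of_ae he hV hu h1) (h1Sq_ne_top hγ hα h2)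
    exact ⟨hs1, hs2, hs3, fun t _ k => ⟨hs4 t k, by ring⟩⟩
  · intro k hk hint
    have hJ : ∀ j, spectralWeight β Ue Uf e f γ k j * correlationExpansion n Φ (χ (k - j)) k =
        spectralWeight β Ue Uf e f γ k j * corrTransform Φ (χ (k - j) / wnorm k ^ 2) := by
      intro j
      by_cases hj : j = k
      · simp [spectralWeight, hj]
      have hkj : k - j ≠ 0 := fun h => hj (sub_eq_zero.1 h).symm
      rw [corrTransform_eq_correlationExpansion (one_le_two.trans hΦ.two_le) hΦ.smooth hΦ.zero
        (hΦ.pos _ hkj) hk (hint _ hkj)]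
    simp only [hJ]
    refine ⟨Summable.of_norm_bounded (hsum k) fun j => ?_, hlim hk⟩
    by_cases hj : j = k
    · simp [spectralWeight, hj]
    have hkj : k - j ≠ 0 := fun h => hj (sub_eq_zero.1 h).symm
    have hw := spectralWeight_nonneg β Ue Uf e f γ k j
    rw [norm_mul, Real.norm_of_nonneg hw]
    exact mul_le_of_le_one_right hw
      (abs_corrTransform_le hb (div_nonneg (hΦ.pos _ hkj).le (sq_nonneg _)))
  · intro X hX s₀ hs₀
    have hX0 : 0 ≤ X := by
      obtain ⟨m, hm⟩ := exists_ne (0 : Wave)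
      exact (hΦ.pos m hm).le.trans (hX m hm)
    have hdiff := fun {k : Wave} (hk : k ≠ 0) =>
      abs_limit_sub_static_le hβ hα he hΦ hV hγ hG hu hX hk
    refine ⟨fun k hk => ⟨_, hlim hk, hstat hs₀ k, ?_⟩, fun κ hκ => ?_⟩
    · rw [hstat hs₀ k]
      exact hdiff hk
    have hne : ∀ k ∈ waveShell κ, k ≠ 0 := fun k hk =>
      ne_zero_of_wnorm_pos (hκ.trans_le (mem_waveShell.1 hk).1)
    have hproj : ∫ ω, projSq κ (2 * κ) (staticVartheta (u ω s₀) (G ω)) ∂μ = 8 * Real.pi ^ 3 *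
        ∑ k ∈ waveShell κ, (wnorm k ^ 4)⁻¹ * ∑' j, spectralWeight β Ue Uf e f γ k j := by
      rw [integral_projSq fun k => memLp_staticVartheta hβ hα he hΦ hV hγ hG hu hs₀ k]
      simp only [hstat hs₀]
    -- the limit on the shell is the finite sum of the limits of its modes
    set L := 8 * Real.pi ^ 3 * ∑ k ∈ waveShell κ, (wnorm k ^ 4)⁻¹ *
      ∑' j, spectralWeight β Ue Uf e f γ k j * corrTransform Φ (χ (k - j) / wnorm k ^ 2) with hL
    have hLS : |L - ∫ ω, projSq κ (2 * κ) (staticVartheta (u ω s₀) (G ω)) ∂μ| ≤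
        corrSlope Φ * (X / κ ^ 2) *
          ∫ ω, projSq κ (2 * κ) (staticVartheta (u ω s₀) (G ω)) ∂μ := by
      rw [hproj, hL, ← mul_sub, ← Finset.sum_sub_distrib, abs_mul, abs_of_pos (by positivity),
        mul_left_comm, Finset.mul_sum]
      refine mul_le_mul_of_nonneg_left ((Finset.abs_sum_le_sum_abs _ _).trans
        (Finset.sum_le_sum fun k hk => (hdiff (hne k hk)).trans ?_)) (by positivity)
      refine mul_le_mul_of_nonneg_right ?_ (mul_nonneg (by have := wnorm_nonneg k; positivity)
        (tsum_nonneg fun j => spectralWeight_nonneg _ _ _ _ _ _ _ _))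
      refine mul_le_mul_of_nonneg_left ?_ (corrSlope_nonneg Φ)
      exact div_le_div_of_nonneg_left hX0 (by positivity)
        (pow_le_pow_left₀ hκ.le (mem_waveShell.1 hk).1 2)
    refine ⟨L, ?_, hLS, ?_⟩
    · refine Tendsto.congr' ?_ ((tendsto_finsetSum (waveShell κ)
        fun k hk => hlim (hne k hk)).const_mul (8 * Real.pi ^ 3))
      filter_upwards [eventually_ge_atTop 0] with t ht
      rw [integral_projSq fun k => memLp_vartheta hβ hα he hΦ hV hγ hG hu ht k]
    · rintro U rfl rfl hκg hκκg
      have h1 := abs_shell_spectrum_sub_le (U := Uf) (κ := κ) hβ2 hα7 (by nlinarith) he hγ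
        (by rw [← Real.sqrt_eq_rpow]; exact Real.le_sqrt_of_sq_le (by nlinarith)) hsum
      rw [← hproj] at h1
      exact (abs_sub_le _ _ _).trans ((add_le_add hLS h1).trans_eq (by ring))
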